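/- Consider one of two cases. Quaternionic case: fix $m\ge 2$ and put $V_1=\mathbb H^{m-1}$, $V_2=\operatorname{Im}\mathbb H$, $n=4m-1$, and $\kappa(x,y)=\operatorname{Im}\sum_a\bar x_a y_a$. Octonionic case: put $V_1=\mathbb O$, $V_2=\operatorname{Im}\mathbb O$, $n=15$, and $\kappa(x,y)=\operatorname{Im}(\bar x y)$. Equip $V_1,V_2$ with their standard inner products and let $W=\Lambda^2V_1^*\otimes V_2$, so that $\kappa\in W$. Let $X$ be a smooth $n$-manifold with a smooth distribution $\mathcal D\subset TX$ of rank $\dim V_1$. Its Levi bracket $\mathcal L_x\in\Lambda^2\mathcal D_x^*\otimes(T_xX/\mathcal D_x)$ is $\mathcal L_x(Y_x,Z_x)=[Y,Z]_x \bmod \mathcal D_x$ for local sections $Y,Z$ of $\mathcal D$. Let $E_x$ be the set of pairs $p$ of linear isomorphisms $V_1\to\mathcal D_x$, $V_2\to T_xX/\mathcal D_x$. For $p\in E_x$, every bracket $B\in\Lambda^2\mathcal D_x^*\otimes(T_xX/\mathcal D_x)$ has an expression $f_B(p)\in W$; write $f(E_x)=\{f_{\mathcal L_x}(p):p\in E_x\}$.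 A bracket $K\in\Lambda^2\mathcal D_x^*\otimes(T_xX/\mathcal D_x)$ is of quaternionic-contact (resp. octonionic-contact) type if $f_K(p)=\kappa$ for some $p\in E_x$. The images $(\eta,\gamma)$ under $p$ of the inner products of $V_2$ and $V_1$ are then metrics on $T_xX/\mathcal D_x$ and $\mathcal D_x$, determined by $K$ up to $(\eta,\gamma)\mapsto(f^2\eta,f\gamma)$, $f>0$. For brackets $M,N$ at $x$ define $\partial^*_NM=\alpha_NM\oplus\beta_NM\in\operatorname{End}(\mathcal D_x)\oplus\operatorname{End}(T_xX/\mathcal D_x)$ by $$(\alpha_NM)^r_q=\gamma^{jr}\gamma^{ip}\eta_{ko}M_{ij}^kN_{pq}^o,\qquad (\beta_NM)^k_r=-\tfrac12\,\eta_{or}\gamma^{ip}\gamma^{jq}M_{ij}^kN_{pq}^o .$$ The bracket $K$ is compatible with $\mathcal L_x$ if it is of quaternionic-contact (resp. octonionic-contact) type, $\partial^*_KK=\partial^*_{\mathcal L_x}\mathcal L_x$, and $\partial^*_K\mathcal L_x$ is symmetric (its two components are symmetric for $\gamma$ and $\eta$ respectively); here $\partial^*$ and symmetry are taken with respect to the metrics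 $(\eta,\gamma)$ of $K$. Theorem. In each case there is an open set $U\subset W$ containing $\kappa$ with the following property. Let $X$ be a smooth $n$-manifold with a smooth distribution $\mathcal D$ of rank $\dim V_1$, and let $S=\{x\in X: f(E_x)\cap U\neq\emptyset\}$. Then for every $x\in S$ there is a choice of bracket $K_x$ compatible with $\mathcal L_x$, such that $K_x$ depends continuously on $x\in S$ and is locally unique: every point $K_{x_0}$, $x_0\in S$, has a neighbourhood in the bundle $\Lambda^2\mathcal D^*\otimes(TX/\mathcal D)|_S$ in which the $K_x$ are the only brackets compatible with the Levi bracket. -/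

import Mathlib

open scoped Manifold ContDiff Topology InnerProductSpace

universe u

noncomputable section

/-! ### Formal brackets and the codifferential -/

/-- Algebraic brackets, i.e. elements of `Λ² A* ⊗ B`: alternating bilinear maps `A × A → B`. -/
def AlgBracket (A B : Type*) [AddCommGroup A] [Module ℝ A] [AddCommGroup B] [Module ℝ B] :
    Submodule ℝ (A →ₗ[ℝ] A →ₗ[ℝ] B) where
  carrier := {b | ∀ v, b v v = 0}
  add_mem' {a b} ha hb v := by simp [ha v, hb v]
  zero_mem' v := by simp
  smul_mem' c b hb v := by simp [hb v]

section Formal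

variable (V₁ V₂ : Type*) [NormedAddCommGroup V₁] [InnerProductSpace ℝ V₁]
  [NormedAddCommGroup V₂] [InnerProductSpace ℝ V₂]

/-- The space `W = Λ² V₁* ⊗ V₂` of formal Levi brackets, with its usual (norm) topology. -/
def FormalBracket : Submodule ℝ (V₁ →L[ℝ] V₁ →L[ℝ] V₂) where
  carrier := {b | ∀ v, b v v = 0}
  add_mem' {a b} ha hb v := by simp [ha v, hb v]
  zero_mem' v := by simp
  smul_mem' c b hb v := by simp [hb v]

variable {V₁ V₂} [FiniteDimensional ℝ V₁]

/-- On finite-dimensional spaces every algebraic bracket is a formal bracket (continuity is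
automatic). -/
def AlgBracket.toFormal (b : AlgBracket V₁ V₂) : FormalBracket V₁ V₂ :=
  ⟨LinearMap.toContinuousLinearMap
      ((LinearMap.toContinuousLinearMap : (V₁ →ₗ[ℝ] V₂) ≃ₗ[ℝ] (V₁ →L[ℝ] V₂)).toLinearMap ∘ₗ b.1),
    fun v => b.2 v⟩

/-- The component `α_N M` of the codifferential `∂*_N M`; in an orthonormal basis `e` of `V₁`,
`(α_N M)^r_q = ∑_i ⟨M(e_i, e_r), N(e_i, e_q)⟩`. -/
def FormalBracket.alpha (N M : FormalBracket V₁ V₂) : V₁ →ₗ[ℝ] V₁ :=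
  let e := stdOrthonormalBasis ℝ V₁
  ∑ i, ∑ j, ((innerₗ V₂ (M.1 (e i) (e j))) ∘ₗ (N.1 (e i)).toLinearMap).smulRight (e j)

/-- The component `β_N M` of the codifferential `∂*_N M`:
`(β_N M) z = -½ ∑_{i,j} ⟨N(e_i, e_j), z⟩ M(e_i, e_j)`. -/
def FormalBracket.beta (N M : FormalBracket V₁ V₂) : V₂ →ₗ[ℝ] V₂ :=
  let e := stdOrthonormalBasis ℝ V₁
  (-(1 / 2 : ℝ)) • ∑ i, ∑ j, (innerₗ V₂ (N.1 (e i) (e j))).smulRight (M.1 (e i) (e j))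

/-- The codifferential `∂*_N M = α_N M ⊕ β_N M`, formed with the inner products of `V₁`, `V₂`. -/
def FormalBracket.codiff (N M : FormalBracket V₁ V₂) : (V₁ →ₗ[ℝ] V₁) × (V₂ →ₗ[ℝ] V₂) :=
  (FormalBracket.alpha N M, FormalBracket.beta N M)

end Formal

/-! ### The standard brackets -/

/-- The imaginary quaternions. -/
abbrev ImQuaternion : Submodule ℝ (Quaternion ℝ) where
  carrier := {q | q.re = 0}
  add_mem' {a b} (ha : a.re = 0) (hb : b.re = 0) := show (a + b).re = 0 by simp [ha, hb]
  zero_mem' := rfl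
  smul_mem' c q (hq : q.re = 0) := show (c • q).re = 0 by simp [hq]

/-- The right quaternionic vector space `ℍ^k` with its standard Euclidean structure. -/
abbrev QuatSpace (k : ℕ) : Type := PiLp 2 (fun _ : Fin k => Quaternion ℝ)

/-- The standard hermitian metric `h(x, y) = ∑ₐ x̄ₐ yₐ` on `ℍ^k`. -/
def quatHermitian {k : ℕ} (x y : QuatSpace k) : Quaternion ℝ := ∑ a, star (x a) * y a

/-- The standard quaternionic bracket on `ℍ^k`, the imaginary part `κ(x, y) = Im h(x, y)` of the
standard hermitian metric. -/
def quatBracket (k : ℕ) : FormalBracket (QuatSpace k) ImQuaternion :=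
  AlgBracket.toFormal
    ⟨LinearMap.mk₂ ℝ (fun x y => ⟨(quatHermitian x y).im, rfl⟩)
      (fun x x' y => by
        apply Subtype.ext
        simp [quatHermitian, add_mul, Finset.sum_add_distrib])
      (fun c x y => by
        apply Subtype.ext
        simp [quatHermitian, ← Finset.smul_sum])
      (fun x y y' => by
        apply Subtype.ext
        simp [quatHermitian, mul_add, Finset.sum_add_distrib])
      (fun c x y => by
        apply Subtype.ext
        simp [quatHermitian, ← Finset.smul_sum]),
    fun x => by
      apply Subtype.ext
      have h : quatHermitian x x = ((∑ a, Quaternion.normSq (x a) : ℝ) : Quaternion ℝ) := by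
        exact (Finset.sum_congr rfl fun a _ => Quaternion.star_mul_self _).trans
          (map_sum (algebraMap ℝ (Quaternion ℝ)) (fun a => Quaternion.normSq (x a)) _).symm
      show (quatHermitian x x).im = 0
      rw [h, Quaternion.im_coe]⟩

/-- The octonions, as the Cayley-Dickson double `ℍ ⊕ ℍ`, with their standard Euclidean
structure. -/
abbrev Octonion : Type := WithLp 2 (Quaternion ℝ × Quaternion ℝ)

namespace Octonion

/-- Octonion multiplication `(a, b)(c, d) = (a c - d̄ b, d a + b c̄)`. -/
def mul (x y : Octonion) : Octonion :=
  WithLp.toLp 2 (x.fst * y.fst - star y.snd * x.snd, y.snd * x.fst + x.snd * star y.fst)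

/-- Octonion conjugation `(a, b) ↦ (ā, -b)`. -/
def conj (x : Octonion) : Octonion := WithLp.toLp 2 (star x.fst, -x.snd)

end Octonion

/-- The imaginary octonions. -/
abbrev ImOctonion : Submodule ℝ Octonion where
  carrier := {x | x.fst.re = 0}
  add_mem' {a b} (ha : a.fst.re = 0) (hb : b.fst.re = 0) :=
    show (a + b).fst.re = 0 by simp [ha, hb]
  zero_mem' := rfl
  smul_mem' c q (hq : q.fst.re = 0) := show (c • q).fst.re = 0 by simp [hq]

/-- The imaginary part of an octonion. -/
def Octonion.im (x : Octonion) : ImOctonion :=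
  ⟨WithLp.toLp 2 (x.fst.im, x.snd), rfl⟩

theorem Octonion.im_conj_mul_ext {z w : ImOctonion} (h₁ : z.1.fst = w.1.fst)
    (h₂ : z.1.snd = w.1.snd) : z = w :=
  Subtype.ext (WithLp.ofLp_injective 2 (Prod.ext h₁ h₂))

theorem Octonion.im_conj_mul_fst (x y : Octonion) :
    ((x.conj.mul y).im).1.fst = (star x.fst * y.fst + star y.snd * x.snd).im := by
  simp [Octonion.im, Octonion.mul, Octonion.conj]

theorem Octonion.im_conj_mul_snd (x y : Octonion) :
    ((x.conj.mul y).im).1.snd = y.snd * star x.fst - x.snd * star y.fst := by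
  simp [Octonion.im, Octonion.mul, Octonion.conj, sub_eq_add_neg]

/-- The standard octonionic bracket on `𝕆`, the imaginary part `κ(x, y) = Im (x̄ y)` of the
standard hermitian metric. -/
def octBracket : FormalBracket Octonion ImOctonion :=
  AlgBracket.toFormal
    ⟨LinearMap.mk₂ ℝ (fun x y => (x.conj.mul y).im)
      (fun x x' y => by
        apply Octonion.im_conj_mul_ext
        · simp only [Octonion.im_conj_mul_fst, Submodule.coe_add, WithLp.add_fst,
            WithLp.add_snd, ← Quaternion.im_add, star_add]
          congr 1; noncomm_ring
        · simp only [Octonion.im_conj_mul_snd, Submodule.coe_add, WithLp.add_fst,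
            WithLp.add_snd, star_add]
          noncomm_ring)
      (fun c x y => by
        apply Octonion.im_conj_mul_ext
        · simp [Octonion.im_conj_mul_fst]
        · simp [Octonion.im_conj_mul_snd, smul_sub])
      (fun x y y' => by
        apply Octonion.im_conj_mul_ext
        · simp only [Octonion.im_conj_mul_fst, Submodule.coe_add, WithLp.add_fst,
            WithLp.add_snd, ← Quaternion.im_add, star_add]
          congr 1; noncomm_ring
        · simp only [Octonion.im_conj_mul_snd, Submodule.coe_add, WithLp.add_fst,
            WithLp.add_snd, star_add]
          noncomm_ring)
      (fun c x y => by
        apply Octonion.im_conj_mul_ext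
        · simp [Octonion.im_conj_mul_fst]
        · simp [Octonion.im_conj_mul_snd, smul_sub]),
    fun x => by
      apply Octonion.im_conj_mul_ext
      · simp [Octonion.im_conj_mul_fst, Quaternion.star_mul_self]
      · simp [Octonion.im_conj_mul_snd]⟩

/-! ### Coefficients of vector fields in a local frame -/

section SmoothCoefficients

open Bundle
variable {E : Type*} [NormedAddCommGroup E] [NormedSpace ℝ E]
  {X : Type*} [TopologicalSpace X] [ChartedSpace E X] {r : ℕ}

theorem mdifferentiableAt_pi {f : X → Fin r → E} {x : X}
    (h : ∀ i, MDifferentiableAt 𝓘(ℝ, E) 𝓘(ℝ, E) (fun y => f y i) x) :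
    MDifferentiableAt 𝓘(ℝ, E) 𝓘(ℝ, Fin r → E) f x := by
  rw [mdifferentiableAt_iff]
  refine ⟨continuousAt_pi.2 fun i => (h i).continuousAt, ?_⟩
  rw [differentiableWithinAt_pi]
  exact fun i => ((mdifferentiableAt_iff _ _).1 (h i)).2

variable [FiniteDimensional ℝ E] [IsManifold 𝓘(ℝ, E) ∞ X]

/-- Differentiable dependence of coefficients on a frame, in a fixed vector space. -/
theorem exists_coeff_aux (S₀ : Fin r → E) (hS₀ : LinearIndependent ℝ S₀) (u₀ : E) :
    ∃ G : (Fin r → E) × E → (Fin r → ℝ), DifferentiableAt ℝ G (S₀, u₀) ∧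
      ∀ᶠ S in 𝓝 S₀, ∀ c : Fin r → ℝ, G (S, ∑ i, c i • S i) = c := by
  let L₀ : (Fin r → ℝ) →ₗ[ℝ] E := Fintype.linearCombination ℝ S₀
  have hL₀ : LinearMap.ker L₀ = ⊥ := by
    rw [LinearMap.ker_eq_bot]
    exact linearIndependent_iff_injective_fintypeLinearCombination.1 hS₀
  obtain ⟨Φ', hΦ'⟩ := L₀.exists_leftInverse_of_injective hL₀
  let Φ : E →L[ℝ] (Fin r → ℝ) := LinearMap.toContinuousLinearMap Φ'
  let Tl : (Fin r → E) →ₗ[ℝ] ((Fin r → ℝ) →L[ℝ] (Fin r → ℝ)) :=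
    { toFun := fun S => Φ.comp (LinearMap.toContinuousLinearMap (Fintype.linearCombination ℝ S))
      map_add' := fun S S' => by
        ext1 c
        simp [Fintype.linearCombination_apply, smul_add, Finset.sum_add_distrib]
      map_smul' := fun k S => by
        ext1 c
        simp only [ContinuousLinearMap.comp_apply, LinearMap.coe_toContinuousLinearMap',
          Fintype.linearCombination_apply, Pi.smul_apply, RingHom.id_apply,
          smul_apply]
        rw [← map_smul, Finset.smul_sum]
        congr 1
        exact Finset.sum_congr rfl fun i _ => smul_comm _ _ _ }
  let T : (Fin r → E) →L[ℝ] ((Fin r → ℝ) →L[ℝ] (Fin r → ℝ)) := LinearMap.toContinuousLinearMap Tl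
  have hT : ∀ S c, T S c = Φ (∑ i, c i • S i) := fun S c => by
    simp [T, Tl, Fintype.linearCombination_apply]
  have hT₀ : T S₀ = 1 := by
    ext1 c
    exact LinearMap.congr_fun hΦ' c
  have hu : IsUnit (T S₀) := by rw [hT₀]; exact isUnit_one
  refine ⟨fun p => Ring.inverse (T p.1) (Φ p.2), ?_, ?_⟩
  · have h1 : DifferentiableAt ℝ (fun p : (Fin r → E) × E => Ring.inverse (T p.1)) (S₀, u₀) :=
      DifferentiableAt.comp (S₀, u₀) (g := Ring.inverse) (f := fun p : (Fin r → E) × E => T p.1)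
        (differentiableAt_inverse hu) (T.differentiableAt.comp _ differentiableAt_fst)
    exact h1.clm_apply (Φ.differentiableAt.comp _ differentiableAt_snd)
  · filter_upwards [T.continuous.continuousAt.eventually (Units.isOpen.mem_nhds hu)] with S hS c
    have : Ring.inverse (T S) * T S = 1 := Ring.inverse_mul_cancel _ hS
    calc Ring.inverse (T S) (Φ (∑ i, c i • S i)) = (Ring.inverse (T S) * T S) c := by
          rw [← hT]; rfl
      _ = c := by rw [this]; rfl

/-- A differentiable vector field in the span of a differentiable frame has differentiable
coefficients. -/
theorem exists_coeff {x : X} (s : Fin r → (y : X) → TangentSpace 𝓘(ℝ, E) y)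
    (hs : ∀ i, MDifferentiableAt 𝓘(ℝ, E) (𝓘(ℝ, E).prod 𝓘(ℝ, E))
      (fun y => (⟨y, s i y⟩ : TangentBundle 𝓘(ℝ, E) X)) x)
    (hli : LinearIndependent ℝ fun i => s i x)
    (U : (y : X) → TangentSpace 𝓘(ℝ, E) y)
    (hU : MDifferentiableAt 𝓘(ℝ, E) (𝓘(ℝ, E).prod 𝓘(ℝ, E))
      (fun y => (⟨y, U y⟩ : TangentBundle 𝓘(ℝ, E) X)) x)
    (hspan : ∀ᶠ y in 𝓝 x, U y ∈ Submodule.span ℝ (Set.range fun i => s i y)) :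
    ∃ a : Fin r → X → ℝ, (∀ i, MDifferentiableAt 𝓘(ℝ, E) 𝓘(ℝ, ℝ) (a i) x) ∧
      ∀ᶠ y in 𝓝 x, U y = ∑ i, a i y • s i y := by
  let e := trivializationAt E (TangentSpace 𝓘(ℝ, E)) x
  have hx : x ∈ e.baseSet := FiberBundle.mem_baseSet_trivializationAt E _ x
  let t : (y : X) → TangentSpace 𝓘(ℝ, E) y →ₗ[ℝ] E := fun y => e.linearMapAt ℝ y
  have ht : ∀ y ∈ e.baseSet, ∀ v : TangentSpace 𝓘(ℝ, E) y, t y v = (e ⟨y, v⟩).2 := fun y hy v => by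
    simp [t, e.coe_linearMapAt_of_mem hy]
  have hmem : ∀ᶠ y in 𝓝 x, y ∈ e.baseSet := e.open_baseSet.mem_nhds hx
  have hinj : ∀ y ∈ e.baseSet, Function.Injective (t y) := fun y hy => by
    intro v w h
    have := congrArg (e.symmₗ ℝ y) h
    simpa [t, e.symmₗ_linearMapAt hy] using this
  have key : ∀ (V : (y : X) → TangentSpace 𝓘(ℝ, E) y),
      MDifferentiableAt 𝓘(ℝ, E) (𝓘(ℝ, E).prod 𝓘(ℝ, E))
        (fun y => (⟨y, V y⟩ : TangentBundle 𝓘(ℝ, E) X)) x →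
      MDifferentiableAt 𝓘(ℝ, E) 𝓘(ℝ, E) (fun y => t y (V y)) x := by
    intro V hV
    refine ((mdifferentiableAt_section _ V).1 hV).congr_of_eventuallyEq ?_
    filter_upwards [hmem] with y hy
    exact ht y hy _
  have hli' : LinearIndependent ℝ fun i => t x (s i x) :=
    hli.map' (t x) (LinearMap.ker_eq_bot.2 (hinj x hx))
  obtain ⟨G, hG, hG'⟩ := exists_coeff_aux (fun i => t x (s i x)) hli' (t x (U x))
  have hS : MDifferentiableAt 𝓘(ℝ, E) 𝓘(ℝ, Fin r → E) (fun y i => t y (s i y)) x := by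
    exact mdifferentiableAt_pi fun i => key _ (hs i)
  have hpair := hS.prodMk_space (key U hU)
  have ha : MDifferentiableAt 𝓘(ℝ, E) 𝓘(ℝ, Fin r → ℝ)
      (fun y => G (fun i => t y (s i y), t y (U y))) x :=
    MDifferentiableAt.comp (g := G) x hG.mdifferentiableAt hpair
  refine ⟨fun i y => G (fun i => t y (s i y), t y (U y)) i, fun i => ?_, ?_⟩
  · exact MDifferentiableAt.comp (g := fun c : Fin r → ℝ => c i) x
      (ContinuousLinearMap.proj (R := ℝ) (φ := fun _ : Fin r => ℝ) i).mdifferentiableAt ha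
  · filter_upwards [hmem, hspan, hS.continuousAt.eventually hG'] with y hy hsp hGy
    obtain ⟨c, hc⟩ := (Submodule.mem_span_range_iff_exists_fun ℝ).1 hsp
    have h1 : t y (U y) = ∑ i, c i • t y (s i y) := by
      rw [← hc]; simp
    rw [h1, hGy c, hc]
open VectorField in
theorem mkQ_mlieBracket_left {x : X} (D : Submodule ℝ (TangentSpace 𝓘(ℝ, E) x))
    (s : Fin r → (y : X) → TangentSpace 𝓘(ℝ, E) y)
    (hs : ∀ i, MDifferentiableAt 𝓘(ℝ, E) (𝓘(ℝ, E).prod 𝓘(ℝ, E))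
      (fun y => (⟨y, s i y⟩ : TangentBundle 𝓘(ℝ, E) X)) x)
    (hsD : ∀ i, s i x ∈ D) (a : Fin r → X → ℝ)
    (ha : ∀ i, MDifferentiableAt 𝓘(ℝ, E) 𝓘(ℝ, ℝ) (a i) x)
    (U V : (y : X) → TangentSpace 𝓘(ℝ, E) y) (hU : ∀ᶠ y in 𝓝 x, U y = ∑ i, a i y • s i y) :
    D.mkQ (mlieBracket 𝓘(ℝ, E) U V x) =
      ∑ i, a i x • D.mkQ (mlieBracket 𝓘(ℝ, E) (s i) V x) := by
  have : IsManifold 𝓘(ℝ, E) 2 X :=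
    inferInstance
  have h1 : mlieBracket 𝓘(ℝ, E) U V x
      = mlieBracket 𝓘(ℝ, E) (fun y => ∑ i, (a i • s i) y) V x :=
    Filter.EventuallyEq.mlieBracket_vectorField_eq hU (Filter.EventuallyEq.refl _ _)
  have h2 : ∀ t : Finset (Fin r), D.mkQ (mlieBracket 𝓘(ℝ, E) (fun y => ∑ i ∈ t, (a i • s i) y) V x)
      = ∑ i ∈ t, a i x • D.mkQ (mlieBracket 𝓘(ℝ, E) (s i) V x) := by
    classical
    intro t
    have hd : ∀ i, MDifferentiableAt 𝓘(ℝ, E) (𝓘(ℝ, E).prod 𝓘(ℝ, E))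
      (fun y => (⟨y, (a i • s i) y⟩ : TangentBundle 𝓘(ℝ, E) X)) x :=
      fun i => (ha i).smul_section (hs i)
    induction t using Finset.induction_on with
    | empty =>
      simp only [Finset.sum_empty]
      have := congrFun (mlieBracket_zero_left (I := 𝓘(ℝ, E)) (W := V)) x
      exact (congrArg D.mkQ this).trans (map_zero _)
    | insert i t hi ih =>
      simp only [Finset.sum_insert hi]
      rw [← ih]
      have := mlieBracket_add_left (I := 𝓘(ℝ, E)) (W := V) (hd i)
        (V₁ := fun y => ∑ i ∈ t, (a i • s i) y)
        (MDifferentiableAt.sum_section fun i _ => hd i)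
      refine (congrArg D.mkQ this).trans ?_
      rw [map_add, mlieBracket_smul_left (ha i) (hs i), map_add, map_smul, map_smul]
      have h0 : D.mkQ (s i x) = 0 := by simpa using hsD i
      rw [h0, smul_zero, zero_add]
  rw [h1, h2]

end SmoothCoefficients

/-! ### Distributions and their Levi brackets -/

/-- A smooth distribution of rank `r` on `X`: a field of subspaces of the tangent spaces that is
locally spanned by `r` pointwise linearly independent smooth vector fields. -/
structure TangentDistribution (E : Type*) [NormedAddCommGroup E] [NormedSpace ℝ E]
    (X : Type*) [TopologicalSpace X] [ChartedSpace E X] [IsManifold 𝓘(ℝ, E) ∞ X] (r : ℕ) where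
  /-- the fibre `D_x ⊆ T_x X` -/
  space : ∀ x : X, Submodule ℝ (TangentSpace 𝓘(ℝ, E) x)
  exists_frame : ∀ x₀ : X, ∃ (O : Set X) (s : Fin r → (x : X) → TangentSpace 𝓘(ℝ, E) x),
    IsOpen O ∧ x₀ ∈ O ∧
    (∀ i, ContMDiffOn 𝓘(ℝ, E) (𝓘(ℝ, E).prod 𝓘(ℝ, E)) ∞
      (fun x => (⟨x, s i x⟩ : TangentBundle 𝓘(ℝ, E) X)) O) ∧
    ∀ x ∈ O, LinearIndependent ℝ (fun i => s i x) ∧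
      Submodule.span ℝ (Set.range fun i => s i x) = space x

namespace TangentDistribution

variable {E : Type*} [NormedAddCommGroup E] [NormedSpace ℝ E]
  {X : Type*} [TopologicalSpace X] [ChartedSpace E X] [IsManifold 𝓘(ℝ, E) ∞ X] {r : ℕ}
  (D : TangentDistribution E X r)

/-- The fibre at `x` of the bundle `Λ² D* ⊗ (TX / D)`. -/
abbrev Bracket (x : X) : Type _ :=
  AlgBracket (D.space x) (TangentSpace 𝓘(ℝ, E) x ⧸ D.space x)

/-- A smooth local frame of `D` near `x`. -/
def localFrame (x : X) : Fin r → (y : X) → TangentSpace 𝓘(ℝ, E) y :=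
  (D.exists_frame x).choose_spec.choose

/-- The basis of `D_x` given by the local frame. -/
def basisAt (x : X) : Module.Basis (Fin r) ℝ (D.space x) :=
  let h := (D.exists_frame x).choose_spec.choose_spec
  (Module.Basis.span (h.2.2.2 x h.2.1).1).map (LinearEquiv.ofEq _ _ (h.2.2.2 x h.2.1).2)

/-- The bilinear map on `D_x` with `(s_i(x), s_j(x)) ↦ [s_i, s_j]_x mod D_x` for a smooth local
frame `s` of `D`. -/
def leviBilin (x : X) :
    D.space x →ₗ[ℝ] D.space x →ₗ[ℝ] (TangentSpace 𝓘(ℝ, E) x ⧸ D.space x) :=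
  (D.basisAt x).constr ℝ fun i => (D.basisAt x).constr ℝ fun j =>
    (D.space x).mkQ
      (VectorField.mlieBracket 𝓘(ℝ, E) (D.localFrame x i) (D.localFrame x j) x)

theorem leviBilin_self (x : X) (v : D.space x) : D.leviBilin x v v = 0 := by
  have h : (D.leviBilin x).flip = -D.leviBilin x := by
    refine (D.basisAt x).ext fun i => (D.basisAt x).ext fun j => ?_
    simp only [LinearMap.flip_apply, LinearMap.neg_apply, leviBilin, Module.Basis.constr_basis]
    rw [VectorField.mlieBracket_swap_apply, map_neg]
  have h' : D.leviBilin x v v = -D.leviBilin x v v := by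
    have := LinearMap.congr_fun₂ h v v
    simpa using this
  have h2 : (2 : ℝ) • D.leviBilin x v v = 0 := by
    rw [two_smul]; nth_rewrite 1 [h']; simp
  simpa using h2

/-- The Levi bracket `L_x ∈ Λ² D_x* ⊗ (T_x X / D_x)` of the distribution, the value at `x` of
`(U, V) ↦ [U, V] mod D`. It is computed in a local frame; `leviBracket_apply` shows that
`L_x(U(x), V(x)) = [U, V]_x mod D_x` for all smooth local sections `U`, `V` of `D`. -/
def leviBracket (x : X) : D.Bracket x := ⟨D.leviBilin x, D.leviBilin_self x⟩

/-- The Levi bracket is `[U, V] mod D` on smooth local sections `U`, `V` of `D`. -/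
theorem leviBracket_apply [FiniteDimensional ℝ E] {O : Set X} (hO : IsOpen O)
    (U V : (x : X) → TangentSpace 𝓘(ℝ, E) x)
    (hU : ContMDiffOn 𝓘(ℝ, E) (𝓘(ℝ, E).prod 𝓘(ℝ, E)) ∞
      (fun x => (⟨x, U x⟩ : TangentBundle 𝓘(ℝ, E) X)) O)
    (hV : ContMDiffOn 𝓘(ℝ, E) (𝓘(ℝ, E).prod 𝓘(ℝ, E)) ∞
      (fun x => (⟨x, V x⟩ : TangentBundle 𝓘(ℝ, E) X)) O)
    (hUD : ∀ x ∈ O, U x ∈ D.space x) (hVD : ∀ x ∈ O, V x ∈ D.space x)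
    (x : X) (hx : x ∈ O) :
    (D.leviBracket x).1 ⟨U x, hUD x hx⟩ ⟨V x, hVD x hx⟩ =
      (D.space x).mkQ (VectorField.mlieBracket 𝓘(ℝ, E) U V x) := by
  obtain ⟨hO', hx', hs, hfr⟩ := (D.exists_frame x).choose_spec.choose_spec
  set O' := (D.exists_frame x).choose
  change ∀ i, ContMDiffOn _ _ _ (fun x_1 => (⟨x_1, D.localFrame x i x_1⟩ : TangentBundle 𝓘(ℝ, E) X)) O' at hs
  change ∀ y ∈ O', LinearIndependent ℝ (fun i => D.localFrame x i y) ∧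
    Submodule.span ℝ (Set.range fun i => D.localFrame x i y) = D.space y at hfr
  have hb : ∀ i, ((D.basisAt x i : D.space x) : TangentSpace 𝓘(ℝ, E) x) = D.localFrame x i x :=
    fun i => by
      simp only [basisAt, Module.Basis.map_apply, LinearEquiv.coe_ofEq_apply]
      exact congrArg Subtype.val (Module.Basis.span_apply (hfr x hx').1 i)
  have hs' : ∀ i, MDifferentiableAt 𝓘(ℝ, E) (𝓘(ℝ, E).prod 𝓘(ℝ, E))
      (fun y => (⟨y, D.localFrame x i y⟩ : TangentBundle 𝓘(ℝ, E) X)) x := fun i =>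
    ((hs i).contMDiffAt (hO'.mem_nhds hx')).mdifferentiableAt (by simp)
  have hsD : ∀ i, D.localFrame x i x ∈ D.space x := fun i => by
    rw [← hb i]; exact (D.basisAt x i).2
  have hex : ∀ W : (x : X) → TangentSpace 𝓘(ℝ, E) x,
      ContMDiffOn 𝓘(ℝ, E) (𝓘(ℝ, E).prod 𝓘(ℝ, E)) ∞
        (fun x => (⟨x, W x⟩ : TangentBundle 𝓘(ℝ, E) X)) O → (∀ x ∈ O, W x ∈ D.space x) →
      ∃ a : Fin r → X → ℝ, (∀ i, MDifferentiableAt 𝓘(ℝ, E) 𝓘(ℝ, ℝ) (a i) x) ∧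
        ∀ᶠ y in 𝓝 x, W y = ∑ i, a i y • D.localFrame x i y := fun W hW hWD => by
    refine exists_coeff _ hs' (hfr x hx').1 W
      ((hW.contMDiffAt (hO.mem_nhds hx)).mdifferentiableAt (by simp)) ?_
    filter_upwards [hO.mem_nhds hx, hO'.mem_nhds hx'] with y hy hy'
    rw [(hfr y hy').2]
    exact hWD y hy
  obtain ⟨a, ha, hUa⟩ := hex U hU hUD
  obtain ⟨b, hb', hVb⟩ := hex V hV hVD
  have e1 : (⟨U x, hUD x hx⟩ : D.space x) = ∑ i, a i x • D.basisAt x i := by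
    apply Subtype.ext
    simp only [AddSubmonoidClass.coe_finsetSum, Submodule.coe_smul, hb]
    exact hUa.self_of_nhds
  have e2 : (⟨V x, hVD x hx⟩ : D.space x) = ∑ i, b i x • D.basisAt x i := by
    apply Subtype.ext
    simp only [AddSubmonoidClass.coe_finsetSum, Submodule.coe_smul, hb]
    exact hVb.self_of_nhds
  rw [e1, e2, mkQ_mlieBracket_left (D.space x) _ hs' hsD a ha U V hUa]
  simp only [leviBracket, map_sum, map_smul, LinearMap.sum_apply, LinearMap.smul_apply]
  simp only [Finset.smul_sum]
  rw [Finset.sum_comm]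
  refine Finset.sum_congr rfl fun i _ => ?_
  simp only [smul_comm (b _ x)]
  rw [← Finset.smul_sum]
  congr 1
  rw [VectorField.mlieBracket_swap_apply, map_neg,
    mkQ_mlieBracket_left (D.space x) _ hs' hsD b hb' V _ hVb, ← Finset.sum_neg_distrib]
  refine Finset.sum_congr rfl fun j _ => ?_
  rw [leviBilin, Module.Basis.constr_basis, Module.Basis.constr_basis,
    VectorField.mlieBracket_swap_apply, map_neg, smul_neg]

end TangentDistribution

/-! ### Adapted frames, compatible brackets -/

namespace TangentDistribution

variable {E : Type*} [NormedAddCommGroup E] [NormedSpace ℝ E]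
  {X : Type*} [TopologicalSpace X] [ChartedSpace E X] [IsManifold 𝓘(ℝ, E) ∞ X] {r : ℕ}
  (D : TangentDistribution E X r)

section

variable (V₁ V₂ : Type*) [NormedAddCommGroup V₁] [InnerProductSpace ℝ V₁]
  [NormedAddCommGroup V₂] [InnerProductSpace ℝ V₂]

/-- A frame adapted to `D` at `x`: an isomorphism `V₁ ⊕ V₂ ≃ T_x X` carrying `V₁` onto `D_x`. It is
the same as a pair of isomorphisms `V₁ ≃ D_x`, `V₂ ≃ T_x X / D_x`, i.e. a point of the
`GL(V₁) × GL(V₂)`-principal bundle `E`, with a lift of the second one to `T_x X`. -/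
structure AdaptedFrame (x : X) where
  /-- the isomorphism `V₁ ⊕ V₂ ≃ T_x X` -/
  toLin : (V₁ × V₂) ≃ₗ[ℝ] TangentSpace 𝓘(ℝ, E) x
  mem_iff : ∀ v, toLin v ∈ D.space x ↔ v.2 = 0

/-- The bundle of adapted frames. -/
structure FrameBundle where
  /-- the base point -/
  pt : X
  /-- the frame at the base point -/
  frame : D.AdaptedFrame V₁ V₂ pt

/-- The topology of the bundle of adapted frames: the coarsest one for which each
`p ↦ p(v) ∈ TX`, `v ∈ V₁ ⊕ V₂`, is continuous. -/
instance : TopologicalSpace (D.FrameBundle V₁ V₂) :=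
  TopologicalSpace.induced
    (fun p (v : V₁ × V₂) => (⟨p.pt, p.frame.toLin v⟩ : TangentBundle 𝓘(ℝ, E) X)) inferInstance

end

namespace AdaptedFrame

variable {D} {V₁ V₂ : Type*} [NormedAddCommGroup V₁] [InnerProductSpace ℝ V₁]
  [NormedAddCommGroup V₂] [InnerProductSpace ℝ V₂] {x : X} (p : D.AdaptedFrame V₁ V₂ x)

/-- The isomorphism `V₁ → D_x` given by an adapted frame. -/
def horizontal : V₁ →ₗ[ℝ] D.space x :=
  LinearMap.codRestrict (D.space x) (p.toLin.toLinearMap ∘ₗ LinearMap.inl ℝ V₁ V₂)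
    fun v => (p.mem_iff (v, 0)).2 rfl

/-- The isomorphism `T_x X / D_x → V₂` given by an adapted frame. -/
def vertical : (TangentSpace 𝓘(ℝ, E) x ⧸ D.space x) →ₗ[ℝ] V₂ :=
  (D.space x).liftQ (LinearMap.snd ℝ V₁ V₂ ∘ₗ p.toLin.symm.toLinearMap) fun w hw => by
    have := p.mem_iff (p.toLin.symm w)
    rw [LinearEquiv.apply_symm_apply] at this
    exact this.1 hw

/-- The expression `f_B(p) ∈ W` of a bracket `B` at `x` in the adapted frame `p`. -/
def coords [FiniteDimensional ℝ V₁] (B : D.Bracket x) : FormalBracket V₁ V₂ :=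
  AlgBracket.toFormal
    ⟨(B.1.compl₁₂ p.horizontal p.horizontal).compr₂ p.vertical, fun v => by
      simp [LinearMap.compr₂_apply, LinearMap.compl₁₂_apply, B.2 (p.horizontal v)]⟩

end AdaptedFrame

variable {V₁ V₂ : Type*} [NormedAddCommGroup V₁] [InnerProductSpace ℝ V₁]
  [NormedAddCommGroup V₂] [InnerProductSpace ℝ V₂] [FiniteDimensional ℝ V₁]

variable (V₁ V₂) in
/-- The bracket orbit `f(E_x) ⊆ W`: all expressions of the Levi bracket at `x` in adapted frames. -/
def bracketOrbit (x : X) : Set (FormalBracket V₁ V₂) :=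
  {l | ∃ p : D.AdaptedFrame V₁ V₂ x, p.coords (D.leviBracket x) = l}

variable {D}

/-- `K` is compatible with `L` at `x` (relative to the standard bracket `κ`): `K` is of standard
type, i.e. becomes `κ` in some adapted frame `p`, and `∂*_K K = ∂*_L L`, `∂*_K L` is symmetric.
The metrics `(η, γ)` defined by `K`, with respect to which `∂*` and symmetry are taken, are the
images under `p` of the inner products of `V₂` and `V₁`; so the conditions can be written for the
expressions `κ`, `l` of `K`, `L` in the frame `p`. (Two frames in which `K` becomes `κ` differ by an
element of the stabiliser of `κ`, which acts by conformal changes `(η, γ) ↦ (f² η, f γ)`; the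
conditions are invariant under those.) -/
def IsCompatible (κ : FormalBracket V₁ V₂) {x : X} (K L : D.Bracket x) : Prop :=
  ∃ p : D.AdaptedFrame V₁ V₂ x, p.coords K = κ ∧
    FormalBracket.codiff κ κ = FormalBracket.codiff (p.coords L) (p.coords L) ∧
    (FormalBracket.codiff κ (p.coords L)).1.IsSymmetric ∧
    (FormalBracket.codiff κ (p.coords L)).2.IsSymmetric

variable (V₁ V₂) in
/-- A field `K` of brackets, i.e. a section of `Λ² D* ⊗ (TX / D)`, is continuous over `S`: its
expression `f_K` on the bundle of adapted frames is continuous over `S`. -/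
def ContinuousOver (K : (x : X) → D.Bracket x) (S : Set X) : Prop :=
  ContinuousOn (fun p : D.FrameBundle V₁ V₂ => p.frame.coords (K p.pt)) {p | p.pt ∈ S}

/-- Local uniqueness of `K` over `S`: in the bundle `Λ² D* ⊗ (TX / D)` over `S`, each point `K_x`
has a neighbourhood in which the values of `K` are the only brackets compatible with the Levi
bracket. The neighbourhood is described through frames `p` near an arbitrary frame `p₀` at `x`. -/
def LocallyUniqueOver (κ : FormalBracket V₁ V₂) (K : (x : X) → D.Bracket x) (S : Set X) : Prop :=
  ∀ p₀ : D.FrameBundle V₁ V₂, p₀.pt ∈ S →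
    ∃ 𝒩 ∈ 𝓝 p₀, ∃ N ∈ 𝓝 (p₀.frame.coords (K p₀.pt)), ∀ p ∈ 𝒩, p.pt ∈ S →
      ∀ B : D.Bracket p.pt, IsCompatible κ B (D.leviBracket p.pt) →
        p.frame.coords B ∈ N → B = K p.pt

end TangentDistribution

end

/-!
A change of adapted frame changes the expressions of brackets by the action `bilAct` of
`GL(V₁) × GL(V₂)` on bilinear maps. The codifferential is the polarised moment map of this action
(`FormalBracket.bilInner_bilInf`), so in a frame in which `K` becomes `κ`, compatibility of `K`
with the Levi bracket says that the expression of the Levi bracket lies in `normalSlice κ`: it has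
the moment map of `κ` and is a critical point of `⟨κ, ·⟩` on its orthogonal orbit
(`FormalBracket.mem_normalSlice_iff`). The task is thus to bring a bracket `l` near `κ` into the
normal slice, and to see that the image of `κ` under the inverse change of frame depends only on
`l`.

Two properties of `κ` make this work: its moment map is central (`CentralMoment`), and the
symmetric part of its infinitesimal stabiliser consists of the multiples of the grading element
(`SymmStabilizerTrivial`). Both standard brackets come from Clifford modules,
`⟨J z x, y⟩ = ⟨z, κ(x, y)⟩`, and the Clifford relations give the first property. For a
symmetric pair `(a, b)` in the stabiliser, they show that `b` is scalar; after subtraction of the grading, `a` anticommutes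
with all `J z`. Since `-1` is a product of three, respectively seven, of the `J z`, and these
numbers are odd, `a` vanishes.

Existence. The slice equations, with gauge conditions that factor out the stabiliser, form a
square system. Its linearisation at `κ` is injective, because the centrality of the moment map
makes the infinitesimal stabiliser closed under transposes. The implicit function theorem applies
at `κ` and at all nearby points of the slice (`exists_eventually_bilAct_mem_normalSlice`).

Uniqueness. If `(A, B)` relates two points of the slice near `κ`, the Kempf–Ness argument shows
that it acts as a unitary pair (`exists_unitary_of_mem_normalSlice`). Unitary pairs that move `κ`
only slightly are, by compactness, close to the unitary stabiliser of `κ`; division by the nearest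
element of the stabiliser puts the pair into the gauge, where the implicit function theorem yields
local uniqueness. Hence `(A, B)` fixes `κ` (`exists_bilAct_eq`). In particular the bracket `k`
attached to `l`, the one that becomes `κ` when `l` is moved to a point of the slice near `κ`, is
unique (`NearNormalPair.unique`), which together with existence near `l` gives continuity.

Local uniqueness is stronger, since a compatible bracket near `k` could a priori be compatible
through a frame in which the Levi bracket is far from `κ`. But a standard bracket near `k` becomes
`κ` in a frame close to the one for `k`, and all frames in which it becomes `κ` agree on whether
the Levi bracket is in the slice, because the stabiliser of `κ` preserves the slice
(`NearNormalPair.exists_nhds`).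

On a manifold these algebraic facts apply in each adapted frame, and the Levi bracket is
continuous on the bundle of adapted frames (`TangentDistribution.continuous_coords_leviBracket`).
-/

set_option linter.unusedSectionVars false

/-! ### The action of pairs of endomorphisms on bilinear maps -/

section BilinearMaps

variable {V₁ V₂ : Type*} [NormedAddCommGroup V₁] [InnerProductSpace ℝ V₁]
  [NormedAddCommGroup V₂] [InnerProductSpace ℝ V₂]

/-- The right action of `End V₁` combined with the left action of `End V₂` on bilinear maps:
`(A, B)` sends `l` to `(x, y) ↦ B (l (A x, A y))`. A change of adapted frame acts in this way on the
expressions of brackets. -/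
noncomputable def bilAct (A : V₁ →L[ℝ] V₁) (B : V₂ →L[ℝ] V₂) (l : V₁ →L[ℝ] V₁ →L[ℝ] V₂) :
    V₁ →L[ℝ] V₁ →L[ℝ] V₂ :=
  (ContinuousLinearMap.compL ℝ V₁ V₂ V₂ B).comp (l.bilinearComp A A)

/-- The infinitesimal version of `bilAct`:
`(a, b)` sends `l` to `(x, y) ↦ b (l (x, y)) + l (a x, y) + l (x, a y)`. -/
noncomputable def bilInf (a : V₁ →L[ℝ] V₁) (b : V₂ →L[ℝ] V₂) (l : V₁ →L[ℝ] V₁ →L[ℝ] V₂) :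
    V₁ →L[ℝ] V₁ →L[ℝ] V₂ :=
  (ContinuousLinearMap.compL ℝ V₁ V₂ V₂ b).comp l +
    l.bilinearComp a (ContinuousLinearMap.id ℝ V₁) + l.bilinearComp (ContinuousLinearMap.id ℝ V₁) a

@[simp] theorem bilAct_apply (A : V₁ →L[ℝ] V₁) (B : V₂ →L[ℝ] V₂) (l : V₁ →L[ℝ] V₁ →L[ℝ] V₂)
    (x y : V₁) : bilAct A B l x y = B (l (A x) (A y)) := rfl

@[simp] theorem bilInf_apply (a : V₁ →L[ℝ] V₁) (b : V₂ →L[ℝ] V₂) (l : V₁ →L[ℝ] V₁ →L[ℝ] V₂)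
    (x y : V₁) : bilInf a b l x y = b (l x y) + l (a x) y + l x (a y) := rfl

theorem bilAct_bilAct (A A' : V₁ →L[ℝ] V₁) (B B' : V₂ →L[ℝ] V₂) (l : V₁ →L[ℝ] V₁ →L[ℝ] V₂) :
    bilAct A B (bilAct A' B' l) = bilAct (A' * A) (B * B') l := rfl

@[simp] theorem bilAct_one (l : V₁ →L[ℝ] V₁ →L[ℝ] V₂) : bilAct 1 1 l = l := rfl

theorem bilAct_smul_smul {t s : ℝ} (h : s * (t * t) = 1) (A : V₁ →L[ℝ] V₁) (B : V₂ →L[ℝ] V₂)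
    (l : V₁ →L[ℝ] V₁ →L[ℝ] V₂) : bilAct (t • A) (s • B) l = bilAct A B l := by
  ext x y
  simp only [bilAct_apply, smul_apply, map_smul, smul_smul]
  rw [show t * t * s = 1 by linarith, one_smul]

theorem bilInf_add_left (a a' : V₁ →L[ℝ] V₁) (b b' : V₂ →L[ℝ] V₂) (l : V₁ →L[ℝ] V₁ →L[ℝ] V₂) :
    bilInf (a + a') (b + b') l = bilInf a b l + bilInf a' b' l := by
  ext x y
  simp only [bilInf_apply, add_apply, map_add]
  abel

theorem bilInf_smul_left (c : ℝ) (a : V₁ →L[ℝ] V₁) (b : V₂ →L[ℝ] V₂) (l : V₁ →L[ℝ] V₁ →L[ℝ] V₂) :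
    bilInf (c • a) (c • b) l = c • bilInf a b l := by
  ext x y
  simp only [bilInf_apply, smul_apply, map_smul, smul_add]

theorem bilInf_neg_left (a : V₁ →L[ℝ] V₁) (b : V₂ →L[ℝ] V₂) (l : V₁ →L[ℝ] V₁ →L[ℝ] V₂) :
    bilInf (-a) (-b) l = -bilInf a b l := by
  ext x y
  simp only [bilInf_apply, neg_apply, map_neg]
  abel

/-- The grading element `(1, -2)` acts trivially. -/
theorem bilInf_grading (l : V₁ →L[ℝ] V₁ →L[ℝ] V₂) : bilInf 1 ((-2 : ℝ) • 1) l = 0 := by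
  ext x y
  simp only [bilInf_apply, smul_apply, one_apply_eq_self, zero_apply]
  module

variable [FiniteDimensional ℝ V₁]

/-- The Hilbert–Schmidt inner product of bilinear maps `V₁ × V₁ → V₂`. -/
noncomputable def bilInner (l m : V₁ →L[ℝ] V₁ →L[ℝ] V₂) : ℝ :=
  ∑ i, ∑ j, ⟪l (stdOrthonormalBasis ℝ V₁ i) (stdOrthonormalBasis ℝ V₁ j),
    m (stdOrthonormalBasis ℝ V₁ i) (stdOrthonormalBasis ℝ V₁ j)⟫_ℝ

theorem bilInner_comm (l m : V₁ →L[ℝ] V₁ →L[ℝ] V₂) : bilInner l m = bilInner m l := by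
  simp only [bilInner, real_inner_comm]

theorem bilInner_add_left (l l' m : V₁ →L[ℝ] V₁ →L[ℝ] V₂) :
    bilInner (l + l') m = bilInner l m + bilInner l' m := by
  simp only [bilInner, add_apply, inner_add_left, Finset.sum_add_distrib]

theorem bilInner_smul_left (c : ℝ) (l m : V₁ →L[ℝ] V₁ →L[ℝ] V₂) :
    bilInner (c • l) m = c * bilInner l m := by
  simp only [bilInner, smul_apply, real_inner_smul_left, Finset.mul_sum]

theorem bilInner_zero_left (m : V₁ →L[ℝ] V₁ →L[ℝ] V₂) : bilInner 0 m = 0 := by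
  simp [bilInner]

theorem bilInner_zero_right (m : V₁ →L[ℝ] V₁ →L[ℝ] V₂) : bilInner m 0 = 0 := by
  rw [bilInner_comm, bilInner_zero_left]

theorem bilInner_self_eq_zero {l : V₁ →L[ℝ] V₁ →L[ℝ] V₂} (h : bilInner l l = 0) : l = 0 := by
  have h1 := (Finset.sum_eq_zero_iff_of_nonneg fun i _ =>
    Finset.sum_nonneg fun j _ => real_inner_self_nonneg).1 h
  have h2 : ∀ i j, l (stdOrthonormalBasis ℝ V₁ i) (stdOrthonormalBasis ℝ V₁ j) = 0 := fun i j =>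
    inner_self_eq_zero.1 ((Finset.sum_eq_zero_iff_of_nonneg fun j _ =>
      real_inner_self_nonneg).1 (h1 i (Finset.mem_univ _)) j (Finset.mem_univ _))
  apply ContinuousLinearMap.coe_injective
  refine (stdOrthonormalBasis ℝ V₁).toBasis.ext fun i => ?_
  apply ContinuousLinearMap.coe_injective
  refine (stdOrthonormalBasis ℝ V₁).toBasis.ext fun j => ?_
  simpa using h2 i j

theorem sum_inner_apply_eq_trace [FiniteDimensional ℝ V₂] {ι : Type*} [Fintype ι]
    (e : OrthonormalBasis ι ℝ V₁) (f g : V₁ →ₗ[ℝ] V₂) :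
    ∑ i, ⟪f (e i), g (e i)⟫_ℝ = LinearMap.trace ℝ V₁ (LinearMap.adjoint f ∘ₗ g) := by
  rw [LinearMap.trace_eq_sum_inner _ e]
  simp [LinearMap.adjoint_inner_right]

/-- The Hilbert–Schmidt inner product may be computed in any orthonormal basis. -/
theorem bilInner_eq_sum [FiniteDimensional ℝ V₂] {ι : Type*} [Fintype ι]
    (e : OrthonormalBasis ι ℝ V₁) (l m : V₁ →L[ℝ] V₁ →L[ℝ] V₂) :
    bilInner l m = ∑ i, ∑ j, ⟪l (e i) (e j), m (e i) (e j)⟫_ℝ := by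
  have h1 : bilInner l m = ∑ i, ∑ j, ⟪l (stdOrthonormalBasis ℝ V₁ i) (e j),
      m (stdOrthonormalBasis ℝ V₁ i) (e j)⟫_ℝ := Finset.sum_congr rfl fun i _ =>
    (sum_inner_apply_eq_trace _ (l (stdOrthonormalBasis ℝ V₁ i)).toLinearMap
      (m (stdOrthonormalBasis ℝ V₁ i)).toLinearMap).trans (sum_inner_apply_eq_trace e _ _).symm
  rw [h1]
  refine Finset.sum_comm.trans (Eq.trans ?_ Finset.sum_comm)
  exact Finset.sum_congr rfl fun j _ =>
    (sum_inner_apply_eq_trace _ (l.flip (e j)).toLinearMap (m.flip (e j)).toLinearMap).trans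
      (sum_inner_apply_eq_trace e _ _).symm

/-- The unitary pairs act by isometries. -/
theorem bilInner_bilAct_bilAct [FiniteDimensional ℝ V₂] [CompleteSpace V₁] [CompleteSpace V₂]
    {A : V₁ →L[ℝ] V₁} {B : V₂ →L[ℝ] V₂} (hA : A ∈ unitary (V₁ →L[ℝ] V₁))
    (hB : B ∈ unitary (V₂ →L[ℝ] V₂)) (l m : V₁ →L[ℝ] V₁ →L[ℝ] V₂) :
    bilInner (bilAct A B l) (bilAct A B m) = bilInner l m := by
  rw [bilInner_eq_sum ((stdOrthonormalBasis ℝ V₁).map (Unitary.linearIsometryEquiv ⟨A, hA⟩)) l m]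
  have hB' : ∀ x y, ⟪B x, B y⟫_ℝ = ⟪x, y⟫_ℝ := fun x y =>
    (Unitary.linearIsometryEquiv ⟨B, hB⟩).inner_map_map x y
  simp only [bilInner, bilAct_apply, hB']
  rfl

/-- The transpose of an infinitesimal action is the infinitesimal action of the transposes. -/
theorem bilInner_bilInf_adjoint [CompleteSpace V₁] [CompleteSpace V₂] (a : V₁ →L[ℝ] V₁)
    (b : V₂ →L[ℝ] V₂) (l m : V₁ →L[ℝ] V₁ →L[ℝ] V₂) :
    bilInner (bilInf (star a) (star b) l) m = bilInner l (bilInf a b m) := by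
  have key : ∀ f g : V₁ →L[ℝ] V₂,
      ∑ i, ⟪f (star a (stdOrthonormalBasis ℝ V₁ i)), g (stdOrthonormalBasis ℝ V₁ i)⟫_ℝ =
      ∑ i, ⟪f (stdOrthonormalBasis ℝ V₁ i), g (a (stdOrthonormalBasis ℝ V₁ i))⟫_ℝ := by
    intro f g
    -- both sides are the trace of `(star f) g a`
    have h1 : ∑ i, ⟪f (star a (stdOrthonormalBasis ℝ V₁ i)), g (stdOrthonormalBasis ℝ V₁ i)⟫_ℝ =
        LinearMap.trace ℝ V₁ (a.toLinearMap ∘ₗ (f.adjoint.comp g).toLinearMap) := by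
      rw [LinearMap.trace_eq_sum_inner _ (stdOrthonormalBasis ℝ V₁)]
      refine Finset.sum_congr rfl fun i _ => ?_
      simp only [LinearMap.comp_apply, ContinuousLinearMap.coe_coe, ContinuousLinearMap.comp_apply]
      rw [ContinuousLinearMap.star_eq_adjoint, ← ContinuousLinearMap.adjoint_inner_left a,
        ContinuousLinearMap.adjoint_inner_right f]
    have h2 : ∑ i, ⟪f (stdOrthonormalBasis ℝ V₁ i), g (a (stdOrthonormalBasis ℝ V₁ i))⟫_ℝ =
        LinearMap.trace ℝ V₁ ((f.adjoint.comp g).toLinearMap ∘ₗ a.toLinearMap) := by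
      rw [LinearMap.trace_eq_sum_inner _ (stdOrthonormalBasis ℝ V₁)]
      refine Finset.sum_congr rfl fun i _ => ?_
      simp only [LinearMap.comp_apply, ContinuousLinearMap.coe_coe, ContinuousLinearMap.comp_apply]
      rw [ContinuousLinearMap.adjoint_inner_right]
    rw [h1, h2, LinearMap.trace_comp_comm']
  simp only [bilInner, bilInf_apply, inner_add_left, inner_add_right, Finset.sum_add_distrib]
  congr 1
  · congr 1
    · simp only [ContinuousLinearMap.star_eq_adjoint, ContinuousLinearMap.adjoint_inner_left]
    · rw [Finset.sum_comm, Finset.sum_comm (f := fun i j =>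
        ⟪l (stdOrthonormalBasis ℝ V₁ i) (stdOrthonormalBasis ℝ V₁ j),
          m (a (stdOrthonormalBasis ℝ V₁ i)) (stdOrthonormalBasis ℝ V₁ j)⟫_ℝ)]
      exact Finset.sum_congr rfl fun j _ => key (l.flip _) (m.flip _)
  · exact Finset.sum_congr rfl fun i _ => key (l _) (m _)

end BilinearMaps

/-! ### Brackets in normal position and the Kempf–Ness argument -/

section KempfNess

variable {V₁ V₂ : Type*} [NormedAddCommGroup V₁] [InnerProductSpace ℝ V₁] [FiniteDimensional ℝ V₁]
  [NormedAddCommGroup V₂] [InnerProductSpace ℝ V₂] [FiniteDimensional ℝ V₂]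

/-- The bilinear maps in normal position with respect to `κ`: those with the same moment map as `κ`
that are critical for `⟨κ, ·⟩` on their orbit under the orthogonal groups. -/
def normalSlice (κ : V₁ →L[ℝ] V₁ →L[ℝ] V₂) : Set (V₁ →L[ℝ] V₁ →L[ℝ] V₂) :=
  {l | ∀ a b, bilInner (bilInf a b l) l = bilInner (bilInf a b κ) κ ∧
    bilInner (bilInf a b κ) l = bilInner κ (bilInf a b l)}

theorem self_mem_normalSlice (κ : V₁ →L[ℝ] V₁ →L[ℝ] V₂) : κ ∈ normalSlice κ :=
  fun _ _ => ⟨rfl, bilInner_comm _ _⟩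

variable [CompleteSpace V₁] [CompleteSpace V₂]

/-- The symmetric part of the infinitesimal stabiliser of `l` is spanned by the grading element
`(1, -2)`. -/
def SymmStabilizerTrivial (l : V₁ →L[ℝ] V₁ →L[ℝ] V₂) : Prop :=
  ∀ a b, IsSelfAdjoint a → IsSelfAdjoint b → bilInf a b l = 0 →
    ∃ c : ℝ, a = c • 1 ∧ b = (-2 * c) • 1

/-- The moment map of `l` takes a central value. -/
def CentralMoment (l : V₁ →L[ℝ] V₁ →L[ℝ] V₂) : Prop :=
  ∃ c₁ c₂ : ℝ, ∀ a b, bilInner (bilInf a b l) l =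
    c₁ * LinearMap.trace ℝ V₁ a.toLinearMap + c₂ * LinearMap.trace ℝ V₂ b.toLinearMap

section Diagonal

variable {V : Type*} [NormedAddCommGroup V] [InnerProductSpace ℝ V] [FiniteDimensional ℝ V]
  [CompleteSpace V]

theorem exists_isSelfAdjoint_diagonal {ι : Type*} [Fintype ι] [DecidableEq ι]
    (e : OrthonormalBasis ι ℝ V) (d : ι → ℝ) :
    ∃ a : V →L[ℝ] V, IsSelfAdjoint a ∧ (∀ i, a (e i) = d i • e i) ∧
      LinearMap.trace ℝ V a.toLinearMap = ∑ i, d i := by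
  let a : V →L[ℝ] V := ∑ i, d i • (innerSL ℝ (e i)).smulRight (e i)
  have ha : ∀ x, a x = ∑ i, d i • (⟪e i, x⟫_ℝ • e i) := fun x => by
    simp [a]
  have hae : ∀ i, a (e i) = d i • e i := fun i => by
    rw [ha, Finset.sum_eq_single i]
    · simp
    · intro j _ hj
      rw [e.orthonormal.2 hj, zero_smul, smul_zero]
    · simp
  refine ⟨a, ?_, hae, ?_⟩
  · rw [ContinuousLinearMap.isSelfAdjoint_iff_isSymmetric]
    intro x y
    simp only [ContinuousLinearMap.coe_coe, ha, sum_inner, inner_sum, real_inner_smul_left,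
      real_inner_smul_right]
    refine Finset.sum_congr rfl fun i _ => ?_
    rw [real_inner_comm x (e i)]
    ring
  · rw [LinearMap.trace_eq_sum_inner _ e]
    refine Finset.sum_congr rfl fun i _ => ?_
    rw [ContinuousLinearMap.coe_coe, hae, real_inner_smul_right, real_inner_self_eq_norm_sq,
      e.orthonormal.1]
    simp

/-- Singular value decomposition of an invertible endomorphism. -/
theorem exists_singularValues {A : V →L[ℝ] V} (hA : IsUnit A) :
    ∃ (e u : OrthonormalBasis (Fin (Module.finrank ℝ V)) ℝ V)
      (σ : Fin (Module.finrank ℝ V) → ℝ), (∀ i, 0 < σ i) ∧ ∀ i, A (e i) = σ i • u i := by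
  have hinj : ∀ x, A x = 0 → x = 0 := by
    obtain ⟨u, rfl⟩ := hA
    intro x hx
    have := congrArg (↑u⁻¹ : V →L[ℝ] V) hx
    rw [← mul_apply_eq_comp, Units.inv_mul] at this
    simpa using this
  have hS : (star A * A).toLinearMap.IsSymmetric :=
    (ContinuousLinearMap.isSelfAdjoint_iff_isSymmetric).1 (IsSelfAdjoint.star_mul_self A)
  set e := hS.eigenvectorBasis rfl with he
  have hAe : ∀ i j, ⟪A (e i), A (e j)⟫_ℝ = hS.eigenvalues rfl j * ⟪e i, e j⟫_ℝ := by
    intro i j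
    have h := hS.apply_eigenvectorBasis rfl j
    have h2 : (star A * A) (e j) = (hS.eigenvalues rfl j : ℝ) • e j := h
    rw [← ContinuousLinearMap.adjoint_inner_right, ← ContinuousLinearMap.star_eq_adjoint]
    rw [← real_inner_smul_right, ← h2]
    rfl
  have hpos : ∀ i, 0 < ‖A (e i)‖ := fun i => norm_pos_iff.2 fun h => by
    have h1 := hinj _ h
    have h2 := e.orthonormal.1 i
    rw [h1, norm_zero] at h2
    exact zero_ne_one h2
  have hon : Orthonormal ℝ fun i => (‖A (e i)‖)⁻¹ • A (e i) := by
    refine ⟨fun i => ?_, fun i j hij => ?_⟩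
    · rw [norm_smul, norm_inv, norm_norm, inv_mul_cancel₀ (hpos i).ne']
    · simp only [real_inner_smul_left, real_inner_smul_right, hAe, e.orthonormal.2 hij, mul_zero]
  have hcard : Fintype.card (Fin (Module.finrank ℝ V)) = Module.finrank ℝ V := Fintype.card_fin _
  refine ⟨e, OrthonormalBasis.mk hon ?_, fun i => ‖A (e i)‖, hpos, fun i => ?_⟩
  · exact (hon.linearIndependent.span_eq_top_of_card_eq_finrank' hcard).ge
  · rw [OrthonormalBasis.coe_mk, smul_inv_smul₀ (hpos i).ne']

theorem exists_unitary_map_orthonormalBasis {ι : Type*} [Fintype ι]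
    (e u : OrthonormalBasis ι ℝ V) : ∃ U ∈ unitary (V →L[ℝ] V), ∀ i, U (e i) = u i := by
  refine ⟨_, (Unitary.linearIsometryEquiv.symm (e.equiv u (Equiv.refl ι))).2, fun i => ?_⟩
  simp

omit [CompleteSpace V] in
theorem trace_mul_sub_mul (p q : V →L[ℝ] V) :
    LinearMap.trace ℝ V (p * q - q * p).toLinearMap = 0 := by
  have : (p * q - q * p).toLinearMap =
    p.toLinearMap * q.toLinearMap - q.toLinearMap * p.toLinearMap := rfl
  rw [this, map_sub, LinearMap.trace_mul_comm, sub_self]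

end Diagonal

theorem sub_one_mul_log_nonneg {w : ℝ} (hw : 0 < w) : 0 ≤ (w ^ 2 - 1) * Real.log w := by
  rcases le_total 1 w with h | h
  · exact mul_nonneg (by nlinarith) (Real.log_nonneg h)
  · exact mul_nonneg_of_nonpos_of_nonpos (by nlinarith) (Real.log_nonpos hw.le h)

/-- A diagonal pair acts on the components of `l` by its weights `αᵢ + αⱼ + βₛ`; so the moment map
of `l`, evaluated at this pair, is a weighted sum of the squares of the components. -/
theorem bilInner_bilInf_diagonal {ι₁ ι₂ : Type*} [Fintype ι₁] [Fintype ι₂]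
    (u : OrthonormalBasis ι₁ ℝ V₁) (f : OrthonormalBasis ι₂ ℝ V₂) {a : V₁ →L[ℝ] V₁}
    {b : V₂ →L[ℝ] V₂} {α : ι₁ → ℝ} {β : ι₂ → ℝ} (hb' : IsSelfAdjoint b)
    (ha : ∀ i, a (u i) = α i • u i) (hb : ∀ s, b (f s) = β s • f s)
    (l : V₁ →L[ℝ] V₁ →L[ℝ] V₂) (i j : ι₁) (s : ι₂) :
    ⟪bilInf a b l (u i) (u j), f s⟫_ℝ = (α i + α j + β s) * ⟪l (u i) (u j), f s⟫_ℝ := by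
  rw [bilInf_apply, inner_add_left, inner_add_left, ha, ha, map_smul, map_smul, smul_apply,
    real_inner_smul_left, real_inner_smul_left]
  have : ⟪b (l (u i) (u j)), f s⟫_ℝ = β s * ⟪l (u i) (u j), f s⟫_ℝ := by
    rw [← real_inner_smul_right, ← hb]
    exact (ContinuousLinearMap.isSelfAdjoint_iff_isSymmetric.1 hb') _ _
  rw [this]
  ring

theorem bilInner_eq_sum_components {ι₁ ι₂ : Type*} [Fintype ι₁] [Fintype ι₂]
    (u : OrthonormalBasis ι₁ ℝ V₁) (f : OrthonormalBasis ι₂ ℝ V₂) (l m : V₁ →L[ℝ] V₁ →L[ℝ] V₂) :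
    bilInner l m = ∑ i, ∑ j, ∑ s, ⟪l (u i) (u j), f s⟫_ℝ * ⟪m (u i) (u j), f s⟫_ℝ := by
  rw [bilInner_eq_sum u]
  refine Finset.sum_congr rfl fun i _ => Finset.sum_congr rfl fun j _ => ?_
  rw [← f.sum_inner_mul_inner]
  exact Finset.sum_congr rfl fun s _ => by rw [real_inner_comm (f s) (m _ _)]

theorem ext_of_components {ι₁ ι₂ : Type*} [Fintype ι₁] [Fintype ι₂]
    (u : OrthonormalBasis ι₁ ℝ V₁) (f : OrthonormalBasis ι₂ ℝ V₂) {l : V₁ →L[ℝ] V₁ →L[ℝ] V₂}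
    (h : ∀ i j s, ⟪l (u i) (u j), f s⟫_ℝ = 0) : l = 0 := by
  apply bilInner_self_eq_zero
  rw [bilInner_eq_sum_components u f]
  simp [h]

/-- The discrete form of the Kempf–Ness theorem: if two maps in normal position lie in the same
orbit, then the singular values of the pair `(A, B)` relating them satisfy `σᵢ σⱼ τₛ = 1` wherever
the map has a nonzero component, because `∑ l_{ijs}² (w² - 1) log w = 0` for `w = σᵢ σⱼ τₛ` while
all summands are nonnegative. Hence `(log σ, log τ)` stabilises the map, and the pair acts as a
unitary one. -/
theorem exists_unitary_of_mem_normalSlice {κ l₁ l₂ : V₁ →L[ℝ] V₁ →L[ℝ] V₂} (hκ : CentralMoment κ)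
    (h₁ : l₁ ∈ normalSlice κ) (h₂ : l₂ ∈ normalSlice κ) (hl₁ : SymmStabilizerTrivial l₁)
    {A : V₁ →L[ℝ] V₁} {B : V₂ →L[ℝ] V₂} (hA : IsUnit A) (hB : IsUnit B)
    (h : bilAct A B l₁ = l₂) :
    ∃ U₁ ∈ unitary (V₁ →L[ℝ] V₁), ∃ U₂ ∈ unitary (V₂ →L[ℝ] V₂),
      ∀ l, bilAct A B l = bilAct U₁ U₂ l := by
  obtain ⟨e, u, σ, hσ, hAe⟩ := exists_singularValues hA
  obtain ⟨f, v, τ, hτ, hBf⟩ := exists_singularValues hB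
  obtain ⟨c₁, c₂, hc⟩ := hκ
  have hBv : ∀ y s, ⟪B y, v s⟫_ℝ = τ s * ⟪y, f s⟫_ℝ := by
    intro y s
    conv_lhs => rw [← f.sum_repr y]
    simp only [map_sum, map_smul, hBf, sum_inner, real_inner_smul_left]
    rw [Finset.sum_eq_single s]
    · rw [real_inner_self_eq_norm_sq, v.orthonormal.1, OrthonormalBasis.repr_apply_apply,
        real_inner_comm]
      ring
    · intro t _ ht
      rw [v.orthonormal.2 ht]
      simp
    · simp
  have hcomp : ∀ i j s, ⟪l₂ (e i) (e j), v s⟫_ℝ =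
      (σ i * σ j * τ s) * ⟪l₁ (u i) (u j), f s⟫_ℝ := by
    intro i j s
    rw [← h, bilAct_apply, hBv, hAe, hAe]
    simp only [map_smul, smul_apply, real_inner_smul_left]
    ring
  have hlog : ∀ i j s, Real.log (σ i * σ j * τ s) =
      Real.log (σ i) + Real.log (σ j) + Real.log (τ s) := fun i j s => by
    rw [Real.log_mul (mul_pos (hσ i) (hσ j)).ne' (hτ s).ne',
      Real.log_mul (hσ i).ne' (hσ j).ne']
  -- compare the two moment maps along the diagonal pairs with entries `log σ`, `log τ`
  obtain ⟨a, ha, hau, hat⟩ := exists_isSelfAdjoint_diagonal u fun i => Real.log (σ i)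
  obtain ⟨b, hb, hbf, hbt⟩ := exists_isSelfAdjoint_diagonal f fun s => Real.log (τ s)
  obtain ⟨a', ha', hau', hat'⟩ := exists_isSelfAdjoint_diagonal e fun i => Real.log (σ i)
  obtain ⟨b', hb', hbf', hbt'⟩ := exists_isSelfAdjoint_diagonal v fun s => Real.log (τ s)
  have e₁ := (h₁ a b).1.trans (hc a b)
  have e₂ := (h₂ a' b').1.trans (hc a' b')
  rw [hat, hbt, bilInner_eq_sum_components u f] at e₁
  rw [hat', hbt', ← e₁, bilInner_eq_sum_components e v, ← sub_eq_zero] at e₂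
  simp only [bilInner_bilInf_diagonal u f hb hau hbf, bilInner_bilInf_diagonal e v hb' hau' hbf',
    hcomp, ← Finset.sum_sub_distrib, ← hlog] at e₂
  have hterm : ∀ i j s, 0 ≤ Real.log (σ i * σ j * τ s) *
      (σ i * σ j * τ s * ⟪l₁ (u i) (u j), f s⟫_ℝ) * (σ i * σ j * τ s * ⟪l₁ (u i) (u j), f s⟫_ℝ) -
      Real.log (σ i * σ j * τ s) * ⟪l₁ (u i) (u j), f s⟫_ℝ * ⟪l₁ (u i) (u j), f s⟫_ℝ := by
    intro i j s
    have := mul_nonneg (sub_one_mul_log_nonneg (mul_pos (mul_pos (hσ i) (hσ j)) (hτ s)))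
      (sq_nonneg ⟪l₁ (u i) (u j), f s⟫_ℝ)
    linarith
  have hzero : ∀ i j s, Real.log (σ i * σ j * τ s) * ⟪l₁ (u i) (u j), f s⟫_ℝ = 0 := by
    intro i j s
    have hz := (Finset.sum_eq_zero_iff_of_nonneg fun i _ => Finset.sum_nonneg fun j _ =>
      Finset.sum_nonneg fun s _ => hterm i j s).1 e₂ i (Finset.mem_univ _)
    have hz := (Finset.sum_eq_zero_iff_of_nonneg fun j _ =>
      Finset.sum_nonneg fun s _ => hterm i j s).1 hz j (Finset.mem_univ _)
    have hz := (Finset.sum_eq_zero_iff_of_nonneg fun s _ => hterm i j s).1 hz s (Finset.mem_univ _)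
    set w := σ i * σ j * τ s with hw
    have hwpos : 0 < w := mul_pos (mul_pos (hσ i) (hσ j)) (hτ s)
    have h3 : (w - 1) * ((w + 1) * (Real.log w * ⟪l₁ (u i) (u j), f s⟫_ℝ ^ 2)) = 0 := by
      linarith
    rcases mul_eq_zero.1 h3 with h4 | h4
    · rw [sub_eq_zero.1 h4, Real.log_one, zero_mul]
    · rcases mul_eq_zero.1 ((mul_eq_zero.1 h4).resolve_left (by positivity)) with h5 | h5
      · rw [h5, zero_mul]
      · rw [pow_eq_zero_iff two_ne_zero] at h5
        rw [h5, mul_zero]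
  obtain ⟨c, hac, hbc⟩ := hl₁ a b ha hb (ext_of_components u f fun i j s => by
    rw [bilInner_bilInf_diagonal u f hb hau hbf, ← hlog, hzero])
  have hσc : ∀ i, σ i = Real.exp c := fun i => by
    have h1 := hau i
    rw [hac] at h1
    have h2 := smul_left_injective ℝ (u.orthonormal.ne_zero i) h1
    rw [h2, Real.exp_log (hσ i)]
  have hτc : ∀ s, τ s = Real.exp (-2 * c) := fun s => by
    have h1 := hbf s
    rw [hbc] at h1
    have h2 := smul_left_injective ℝ (f.orthonormal.ne_zero s) h1
    rw [h2, Real.exp_log (hτ s)]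
  obtain ⟨U₁, hU₁, hU₁'⟩ := exists_unitary_map_orthonormalBasis e u
  obtain ⟨U₂, hU₂, hU₂'⟩ := exists_unitary_map_orthonormalBasis f v
  refine ⟨U₁, hU₁, U₂, hU₂, fun l => ?_⟩
  have hAU : A = Real.exp c • U₁ := by
    apply ContinuousLinearMap.coe_injective
    refine e.toBasis.ext fun i => ?_
    simp [hAe, hσc, hU₁']
  have hBU : B = Real.exp (-2 * c) • U₂ := by
    apply ContinuousLinearMap.coe_injective
    refine f.toBasis.ext fun i => ?_
    simp only [OrthonormalBasis.coe_toBasis, ContinuousLinearMap.coe_coe, hBf, smul_apply, hτc,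
      hU₂']
  rw [hAU, hBU, bilAct_smul_smul]
  rw [← Real.exp_add, ← Real.exp_add, ← Real.exp_zero]
  congr 1
  ring

/-- Unitary pairs fixing `κ` preserve the normal slice. -/
theorem bilAct_mem_normalSlice_of_unitary {κ l : V₁ →L[ℝ] V₁ →L[ℝ] V₂} {A : V₁ →L[ℝ] V₁}
    {B : V₂ →L[ℝ] V₂} (hA : A ∈ unitary (V₁ →L[ℝ] V₁)) (hB : B ∈ unitary (V₂ →L[ℝ] V₂))
    (hκ : bilAct A B κ = κ) (hl : l ∈ normalSlice κ) : bilAct A B l ∈ normalSlice κ := by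
  intro a b
  have hA' : ∀ x, star A (A x) = x := fun x => by
    rw [← mul_apply_eq_comp, Unitary.star_mul_self_of_mem hA]; rfl
  have hB' : ∀ x, B (star B x) = x := fun x => by
    rw [← mul_apply_eq_comp, Unitary.mul_star_self_of_mem hB]; rfl
  -- conjugation moves the infinitesimal action across the unitary action
  have hconj : ∀ m : V₁ →L[ℝ] V₁ →L[ℝ] V₂, bilInf a b (bilAct A B m) =
      bilAct A B (bilInf (A * a * star A) (star B * b * B) m) := by
    intro m
    ext x y
    simp only [bilInf_apply, bilAct_apply, map_add, mul_apply_eq_comp, hA', hB']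
  have h := hl (A * a * star A) (star B * b * B)
  have e₁ : bilInner (bilInf a b κ) κ =
      bilInner (bilInf (A * a * star A) (star B * b * B) κ) κ := by
    conv_lhs => rw [← hκ, hconj, bilInner_bilAct_bilAct hA hB]
  constructor
  · rw [hconj, bilInner_bilAct_bilAct hA hB, h.1, e₁]
  · conv_lhs => rw [← hκ, hconj, bilInner_bilAct_bilAct hA hB, h.2]
    rw [hconj]
    conv_rhs => rw [← hκ]
    rw [bilInner_bilAct_bilAct hA hB]

/-- The full stabiliser of `κ` preserves the normal slice. -/
theorem bilAct_mem_normalSlice {κ l : V₁ →L[ℝ] V₁ →L[ℝ] V₂} (hκ : CentralMoment κ)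
    (hκ' : SymmStabilizerTrivial κ) {A : V₁ →L[ℝ] V₁} {B : V₂ →L[ℝ] V₂} (hA : IsUnit A)
    (hB : IsUnit B) (h : bilAct A B κ = κ) (hl : l ∈ normalSlice κ) :
    bilAct A B l ∈ normalSlice κ := by
  obtain ⟨U₁, hU₁, U₂, hU₂, hU⟩ := exists_unitary_of_mem_normalSlice hκ (self_mem_normalSlice κ)
    (self_mem_normalSlice κ) hκ' hA hB h
  rw [hU]
  exact bilAct_mem_normalSlice_of_unitary hU₁ hU₂ (by rw [← hU, h]) hl

/-- If the moment map of `κ` is central, the infinitesimal stabiliser is closed under transposes: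
`|(a, b)κ|² - |(aᵀ, bᵀ)κ|²` is the moment map evaluated at a commutator. -/
theorem bilInf_star_eq_zero {κ : V₁ →L[ℝ] V₁ →L[ℝ] V₂} (hκ : CentralMoment κ) {a : V₁ →L[ℝ] V₁}
    {b : V₂ →L[ℝ] V₂} (h : bilInf a b κ = 0) : bilInf (star a) (star b) κ = 0 := by
  obtain ⟨c₁, c₂, hc⟩ := hκ
  apply bilInner_self_eq_zero
  have hcomm : bilInf a b (bilInf (star a) (star b) κ) =
      bilInf (star a * a - a * star a) (b * star b - star b * b) κ +
        bilInf (star a) (star b) (bilInf a b κ) := by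
    ext x y
    simp only [bilInf_apply, add_apply, map_add, sub_apply, map_sub,
      mul_apply_eq_comp]
    abel
  rw [bilInner_bilInf_adjoint, hcomm, h]
  have h0 : bilInf (star a) (star b) (0 : V₁ →L[ℝ] V₁ →L[ℝ] V₂) = 0 := by
    ext x y
    simp
  rw [h0, add_zero, bilInner_comm, hc, trace_mul_sub_mul,
    trace_mul_sub_mul, mul_zero, mul_zero, add_zero]

end KempfNess

/-! ### The implicit function theorem for finite-dimensional systems -/

section Implicit

variable {T G H : Type*} [NormedAddCommGroup T] [NormedSpace ℝ T]
  [NormedAddCommGroup G] [NormedSpace ℝ G] [FiniteDimensional ℝ G]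
  [NormedAddCommGroup H] [NormedSpace ℝ H]

theorem eventually_injective_of_continuous_apply {f : T → G →L[ℝ] H}
    (hf : ∀ y, Continuous fun l => f l y) {l₀ : T} (h : Function.Injective (f l₀)) :
    ∀ᶠ l in 𝓝 l₀, Function.Injective (f l) :=
  (continuous_clm_apply.2 hf).continuousAt.eventually_mem
    (ContinuousLinearMap.isOpen_injective.mem_nhds h)

/-- Joint injectivity of a family of linear maps and a fixed linear map is an open condition. -/
theorem eventually_eq_zero_of_apply_eq_zero {H' : Type*} [NormedAddCommGroup H'] [NormedSpace ℝ H']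
    {f : T → G →ₗ[ℝ] H} (hf : ∀ y, Continuous fun l => f l y) (g : G →ₗ[ℝ] H') {l₀ : T}
    (h : ∀ y, f l₀ y = 0 → g y = 0 → y = 0) : ∀ᶠ l in 𝓝 l₀, ∀ y, f l y = 0 → g y = 0 → y = 0 := by
  have hinj : Function.Injective (LinearMap.toContinuousLinearMap ((f l₀).prod g)) := by
    rw [injective_iff_map_eq_zero]
    intro y hy
    exact h y (congrArg Prod.fst hy) (congrArg Prod.snd hy)
  have hcont : ∀ y, Continuous fun l => LinearMap.toContinuousLinearMap ((f l).prod g) y :=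
    fun y => (hf y).prodMk continuous_const
  filter_upwards [eventually_injective_of_continuous_apply hcont hinj] with l hl y h₁ h₂
  exact (injective_iff_map_eq_zero _).1 hl y (Prod.ext h₁ h₂)

theorem isInvertible_of_injective_dual {L : G →L[ℝ] (G →L[ℝ] ℝ)} (hL : Function.Injective L) :
    L.IsInvertible := by
  have hfin : Module.finrank ℝ G = Module.finrank ℝ (G →L[ℝ] ℝ) := by
    rw [← (LinearMap.toContinuousLinearMap : (G →ₗ[ℝ] ℝ) ≃ₗ[ℝ] (G →L[ℝ] ℝ)).finrank_eq]
    exact (Subspace.dual_finrank_eq (K := ℝ) (V := G)).symm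
  refine ⟨(LinearMap.linearEquivOfInjective L.toLinearMap hL hfin).toContinuousLinearEquiv, ?_⟩
  ext x y
  rfl

theorem hasDerivAt_mk_smul (l₀ : T) (X : G) :
    HasDerivAt (fun t : ℝ => (l₀, t • X)) (0, X) 0 := by
  have h1 : HasDerivAt (fun t : ℝ => t • X) X 0 := by
    simpa using (hasDerivAt_id (0 : ℝ)).smul_const X
  exact (hasDerivAt_const (0 : ℝ) l₀).prodMk h1

theorem hasDerivAt_comp_mk_smul {F : T × G → H} {l₀ : T} {F' : T × G →L[ℝ] H}
    (hd : HasFDerivAt F F' (l₀, 0)) (X : G) :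
    HasDerivAt (fun t : ℝ => F (l₀, t • X)) (F' (0, X)) 0 := by
  have hd' : HasFDerivAt F F' (l₀, (0 : ℝ) • X) := by rwa [zero_smul]
  exact hd'.comp_hasDerivAt (0 : ℝ) (hasDerivAt_mk_smul l₀ X)

theorem hasDerivAt_apply_comp_mk_smul {F : T × G → (G →L[ℝ] ℝ)} {l₀ : T}
    {F' : T × G →L[ℝ] (G →L[ℝ] ℝ)} (hd : HasFDerivAt F F' (l₀, 0)) (X Y : G) :
    HasDerivAt (fun t : ℝ => F (l₀, t • X) Y) (F' (0, X) Y) 0 := by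
  have h1 := (hasDerivAt_comp_mk_smul hd X).clm_apply (hasDerivAt_const (0 : ℝ) Y)
  refine h1.congr_deriv ?_
  simp

/-- The derivatives along lines decide whether the partial derivative is injective. -/
theorem injective_partial_fderiv {F : T × G → (G →L[ℝ] ℝ)} {l₀ : T} (hF : ContDiff ℝ 1 F)
    {D : G → G → ℝ} (hD : ∀ X Y, HasDerivAt (fun t : ℝ => F (l₀, t • X) Y) (D X Y) 0)
    (hker : ∀ X, (∀ Y, D X Y = 0) → X = 0) :
    Function.Injective (fderiv ℝ F (l₀, 0) ∘L ContinuousLinearMap.inr ℝ T G) := by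
  rw [injective_iff_map_eq_zero]
  intro X hX
  refine hker X fun Y => ?_
  have hX' : fderiv ℝ F (l₀, 0) (0, X) = 0 := hX
  have hd : HasFDerivAt F (fderiv ℝ F (l₀, 0)) (l₀, 0) :=
    (hF.differentiable (by simp) _).hasFDerivAt
  rw [← (hasDerivAt_apply_comp_mk_smul hd X Y).unique (hD X Y), hX']
  rfl

variable [CompleteSpace T] {F : T × G → (G →L[ℝ] ℝ)} {l₀ : T} {D : G → G → ℝ}

/-- A `C¹` system with nondegenerate partial derivative at `(l₀, 0)` can be solved near all nearby
solutions of the form `(l, 0)`. -/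
theorem exists_eventually_solution (hF : ContDiff ℝ 1 F)
    (hD : ∀ X Y, HasDerivAt (fun t : ℝ => F (l₀, t • X) Y) (D X Y) 0)
    (hker : ∀ X, (∀ Y, D X Y = 0) → X = 0) :
    ∀ᶠ l₁ in 𝓝 l₀, F (l₁, 0) = 0 →
      ∀ δ > 0, ∀ᶠ l in 𝓝 l₁, ∃ X, ‖X‖ < δ ∧ F (l, X) = 0 := by
  have : CompleteSpace G := FiniteDimensional.complete ℝ G
  have hcont : ∀ X : G, Continuous fun l : T =>
      (fderiv ℝ F (l, 0) ∘L ContinuousLinearMap.inr ℝ T G) X := by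
    intro X
    have h := hF.continuous_fderiv (by simp)
    exact (h.comp (by fun_prop : Continuous fun l : T => (l, (0 : G)))).clm_apply continuous_const
  filter_upwards [eventually_injective_of_continuous_apply hcont
    (injective_partial_fderiv hF hD hker)] with l₁ hl₁ hmem δ hδ
  have hs : HasStrictFDerivAt F (fderiv ℝ F (l₁, 0)) (l₁, 0) :=
    hF.contDiffAt.hasStrictFDerivAt (by simp)
  have hi := isInvertible_of_injective_dual hl₁
  filter_upwards [hs.eventually_apply_implicitFunctionOfProdDomain hi,
    (hs.tendsto_implicitFunctionOfProdDomain hi).eventually_mem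
      (Metric.ball_mem_nhds 0 hδ)] with l h₁ h₂
  exact ⟨_, mem_ball_zero_iff.1 h₂, h₁.trans hmem⟩

/-- Where `(l, 0)` is a solution, it is the only one near `(l₀, 0)` over `l`. -/
theorem eventually_solution_unique (hF : ContDiff ℝ 1 F)
    (hD : ∀ X Y, HasDerivAt (fun t : ℝ => F (l₀, t • X) Y) (D X Y) 0)
    (hker : ∀ X, (∀ Y, D X Y = 0) → X = 0) (h₀ : F (l₀, 0) = 0) :
    ∃ δ > 0, ∀ l X, ‖l - l₀‖ < δ → ‖X‖ < δ → F (l, X) = 0 → F (l, 0) = 0 → X = 0 := by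
  have : CompleteSpace G := FiniteDimensional.complete ℝ G
  have hs : HasStrictFDerivAt F (fderiv ℝ F (l₀, 0)) (l₀, 0) :=
    hF.contDiffAt.hasStrictFDerivAt (by simp)
  have hi := isInvertible_of_injective_dual (injective_partial_fderiv hF hD hker)
  have huniq := hs.eventually_apply_eq_iff_implicitFunctionOfProdDomain hi
  have hproj : Filter.Tendsto (fun v : T × G => (v.1, (0 : G))) (𝓝 (l₀, 0)) (𝓝 (l₀, 0)) :=
    (by fun_prop : Continuous fun v : T × G => (v.1, (0 : G))).tendsto _
  obtain ⟨δ, hδ, h⟩ := Metric.eventually_nhds_iff.1 (huniq.and (hproj.eventually huniq))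
  refine ⟨δ, hδ, fun l X hl hX h₁ h₂ => ?_⟩
  have hd : dist (l, X) (l₀, (0 : G)) < δ := by
    rw [Prod.dist_eq, dist_eq_norm, dist_zero_right]
    exact max_lt hl hX
  exact ((h hd).1.1 (h₁.trans h₀.symm)).symm.trans ((h hd).2.1 (h₂.trans h₀.symm))

end Implicit

/-! ### A local slice through the normal slice -/

section Slice

variable {V₁ V₂ : Type*} [NormedAddCommGroup V₁] [InnerProductSpace ℝ V₁] [FiniteDimensional ℝ V₁]
  [NormedAddCommGroup V₂] [InnerProductSpace ℝ V₂] [FiniteDimensional ℝ V₂]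

/-- The Hilbert–Schmidt inner product of endomorphisms. -/
noncomputable def endInner {V : Type*} [NormedAddCommGroup V] [InnerProductSpace ℝ V]
    [FiniteDimensional ℝ V] (a b : V →L[ℝ] V) : ℝ :=
  ∑ i, ⟪a (stdOrthonormalBasis ℝ V i), b (stdOrthonormalBasis ℝ V i)⟫_ℝ

section EndInner

variable {V : Type*} [NormedAddCommGroup V] [InnerProductSpace ℝ V] [FiniteDimensional ℝ V]

theorem endInner_comm (a b : V →L[ℝ] V) : endInner a b = endInner b a := by
  simp only [endInner, real_inner_comm]

theorem endInner_add_right (a b c : V →L[ℝ] V) :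
    endInner a (b + c) = endInner a b + endInner a c := by
  simp only [endInner, add_apply, inner_add_right, Finset.sum_add_distrib]

theorem endInner_smul_right (r : ℝ) (a b : V →L[ℝ] V) :
    endInner a (r • b) = r * endInner a b := by
  simp only [endInner, smul_apply, real_inner_smul_right, Finset.mul_sum]

theorem endInner_sub_left (a b c : V →L[ℝ] V) :
    endInner (a - b) c = endInner a c - endInner b c := by
  simp only [endInner, sub_apply, inner_sub_left, Finset.sum_sub_distrib]

theorem endInner_smul_left (r : ℝ) (a b : V →L[ℝ] V) :
    endInner (r • a) b = r * endInner a b := by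
  rw [endInner_comm, endInner_smul_right, endInner_comm]

theorem endInner_zero_left (a : V →L[ℝ] V) : endInner 0 a = 0 := by
  simp [endInner]

theorem endInner_self_nonneg (a : V →L[ℝ] V) : 0 ≤ endInner a a :=
  Finset.sum_nonneg fun _ _ => real_inner_self_nonneg

theorem endInner_self_eq_zero {a : V →L[ℝ] V} (h : endInner a a = 0) : a = 0 := by
  have h1 := (Finset.sum_eq_zero_iff_of_nonneg fun i _ => real_inner_self_nonneg).1 h
  apply ContinuousLinearMap.coe_injective
  refine (stdOrthonormalBasis ℝ V).toBasis.ext fun i => ?_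
  simpa using h1 i (Finset.mem_univ _)

theorem endInner_one_left (a : V →L[ℝ] V) : endInner 1 a = LinearMap.trace ℝ V a.toLinearMap := by
  rw [LinearMap.trace_eq_sum_inner _ (stdOrthonormalBasis ℝ V)]
  rfl

theorem endInner_one_one : endInner (1 : V →L[ℝ] V) 1 = Module.finrank ℝ V := by
  simp [endInner, one_apply_eq_self]

variable [CompleteSpace V]

theorem trace_star (a : V →L[ℝ] V) :
    LinearMap.trace ℝ V (star a).toLinearMap = LinearMap.trace ℝ V a.toLinearMap := by
  rw [LinearMap.trace_eq_sum_inner _ (stdOrthonormalBasis ℝ V),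
    LinearMap.trace_eq_sum_inner _ (stdOrthonormalBasis ℝ V)]
  refine Finset.sum_congr rfl fun i _ => ?_
  rw [ContinuousLinearMap.coe_coe, ContinuousLinearMap.star_eq_adjoint,
    ContinuousLinearMap.adjoint_inner_right, real_inner_comm]
  rfl

theorem trace_eq_zero_of_star_eq_neg {a : V →L[ℝ] V} (h : star a = -a) :
    LinearMap.trace ℝ V a.toLinearMap = 0 := by
  have h1 := trace_star a
  rw [h, ContinuousLinearMap.toLinearMap_neg, map_neg] at h1
  linarith

end EndInner

variable [CompleteSpace V₁] [CompleteSpace V₂]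

/-- The skew part of the infinitesimal stabiliser of `κ`, i.e. the Lie algebra of the group of
unitary pairs fixing `κ`. -/
noncomputable def skewStabilizer (κ : V₁ →L[ℝ] V₁ →L[ℝ] V₂) :
    Submodule ℝ ((V₁ →L[ℝ] V₁) × (V₂ →L[ℝ] V₂)) where
  carrier := {Y | star Y.1 = -Y.1 ∧ star Y.2 = -Y.2 ∧ bilInf Y.1 Y.2 κ = 0}
  add_mem' {X Y} hX hY := by
    refine ⟨?_, ?_, ?_⟩
    · simp [hX.1, hY.1, add_comm]
    · simp [hX.2.1, hY.2.1, add_comm]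
    · simp [bilInf_add_left, hX.2.2, hY.2.2]
  zero_mem' := ⟨by simp, by simp, by ext; simp⟩
  smul_mem' c X hX := by
    refine ⟨?_, ?_, ?_⟩
    · simp [hX.1]
    · simp [hX.2.1]
    · rw [Prod.smul_fst, Prod.smul_snd, bilInf_smul_left, hX.2.2]
      ext x y
      simp only [smul_apply, zero_apply, smul_zero]

/-- The equations for `(1 + X)` to move `l` into the normal slice of `κ`, complemented by gauge
conditions that remove the freedom of the stabiliser of `κ`: orthogonality of `X` to the skew part
of the stabiliser (`P` is a projection onto it), and a normalisation of the Hilbert–Schmidt norm of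
the first component, which is satisfied by unitary pairs and transversal to the grading element. The
equations form a linear functional on pairs of endomorphisms. -/
noncomputable def sliceEquation (κ : V₁ →L[ℝ] V₁ →L[ℝ] V₂)
    (P : ((V₁ →L[ℝ] V₁) × (V₂ →L[ℝ] V₂)) →ₗ[ℝ] ((V₁ →L[ℝ] V₁) × (V₂ →L[ℝ] V₂)))
    (v : (V₁ →L[ℝ] V₁ →L[ℝ] V₂) × ((V₁ →L[ℝ] V₁) × (V₂ →L[ℝ] V₂))) :
    ((V₁ →L[ℝ] V₁) × (V₂ →L[ℝ] V₂)) →L[ℝ] ℝ :=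
  let m := bilAct (1 + v.2.1) (1 + v.2.2) v.1
  LinearMap.toContinuousLinearMap
    { toFun := fun Y => bilInner (bilInf Y.1 Y.2 m) m - bilInner (bilInf Y.1 Y.2 κ) κ +
        (1 / 2) * (bilInner (bilInf Y.1 Y.2 κ) m - bilInner (bilInf Y.1 Y.2 m) κ) +
        (endInner v.2.1 (P Y).1 + endInner v.2.2 (P Y).2) +
        (endInner (1 + v.2.1) (1 + v.2.1) - Module.finrank ℝ V₁) * endInner 1 Y.1
      map_add' := fun Y Y' => by
        simp only [Prod.fst_add, Prod.snd_add, bilInf_add_left, bilInner_add_left, map_add,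
          endInner_add_right]
        ring
      map_smul' := fun c Y => by
        simp only [Prod.smul_fst, Prod.smul_snd, bilInf_smul_left, bilInner_smul_left, map_smul,
          endInner_smul_right, RingHom.id_apply, smul_eq_mul]
        ring }

theorem sliceEquation_apply (κ : V₁ →L[ℝ] V₁ →L[ℝ] V₂)
    (P : ((V₁ →L[ℝ] V₁) × (V₂ →L[ℝ] V₂)) →ₗ[ℝ] ((V₁ →L[ℝ] V₁) × (V₂ →L[ℝ] V₂)))
    (l : V₁ →L[ℝ] V₁ →L[ℝ] V₂) (X Y : (V₁ →L[ℝ] V₁) × (V₂ →L[ℝ] V₂)) :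
    sliceEquation κ P (l, X) Y =
      bilInner (bilInf Y.1 Y.2 (bilAct (1 + X.1) (1 + X.2) l)) (bilAct (1 + X.1) (1 + X.2) l) -
        bilInner (bilInf Y.1 Y.2 κ) κ +
        (1 / 2) * (bilInner (bilInf Y.1 Y.2 κ) (bilAct (1 + X.1) (1 + X.2) l) -
          bilInner (bilInf Y.1 Y.2 (bilAct (1 + X.1) (1 + X.2) l)) κ) +
        (endInner X.1 (P Y).1 + endInner X.2 (P Y).2) +
        (endInner (1 + X.1) (1 + X.1) - Module.finrank ℝ V₁) * endInner 1 Y.1 := rfl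

theorem contDiff_bilInner {G : Type*} [NormedAddCommGroup G] [NormedSpace ℝ G]
    {f g : G → V₁ →L[ℝ] V₁ →L[ℝ] V₂} (hf : ∀ x y, ContDiff ℝ 1 fun v => f v x y)
    (hg : ∀ x y, ContDiff ℝ 1 fun v => g v x y) : ContDiff ℝ 1 fun v => bilInner (f v) (g v) :=
  ContDiff.sum fun _ _ => ContDiff.sum fun _ _ => (hf _ _).inner ℝ (hg _ _)

theorem contDiff_endInner {G V : Type*} [NormedAddCommGroup G] [NormedSpace ℝ G]
    [NormedAddCommGroup V] [InnerProductSpace ℝ V] [FiniteDimensional ℝ V] {f g : G → V →L[ℝ] V}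
    (hf : ContDiff ℝ 1 f) (hg : ContDiff ℝ 1 g) : ContDiff ℝ 1 fun v => endInner (f v) (g v) :=
  ContDiff.sum fun _ _ => (hf.clm_apply contDiff_const).inner ℝ (hg.clm_apply contDiff_const)

theorem contDiff_sliceEquation (κ : V₁ →L[ℝ] V₁ →L[ℝ] V₂)
    (P : ((V₁ →L[ℝ] V₁) × (V₂ →L[ℝ] V₂)) →ₗ[ℝ] ((V₁ →L[ℝ] V₁) × (V₂ →L[ℝ] V₂))) :
    ContDiff ℝ 1 (sliceEquation κ P) := by
  rw [contDiff_clm_apply_iff]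
  intro Y
  have hm : ∀ x y, ContDiff ℝ 1 fun v : (V₁ →L[ℝ] V₁ →L[ℝ] V₂) × ((V₁ →L[ℝ] V₁) × (V₂ →L[ℝ] V₂)) =>
      bilAct (1 + v.2.1) (1 + v.2.2) v.1 x y := by
    intro x y
    simp only [bilAct_apply]
    fun_prop
  have hm' : ∀ x y, ContDiff ℝ 1 fun v : (V₁ →L[ℝ] V₁ →L[ℝ] V₂) × ((V₁ →L[ℝ] V₁) × (V₂ →L[ℝ] V₂)) =>
      bilInf Y.1 Y.2 (bilAct (1 + v.2.1) (1 + v.2.2) v.1) x y := by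
    intro x y
    simp only [bilInf_apply]
    exact ((Y.2.contDiff.comp (hm x y)).add (hm _ _)).add (hm _ _)
  have hc : ∀ (m : V₁ →L[ℝ] V₁ →L[ℝ] V₂) x y,
      ContDiff ℝ 1 fun _ : (V₁ →L[ℝ] V₁ →L[ℝ] V₂) × ((V₁ →L[ℝ] V₁) × (V₂ →L[ℝ] V₂)) => m x y :=
    fun m x y => contDiff_const
  refine ((((contDiff_bilInner hm' hm).sub contDiff_const).add (contDiff_const.mul
    ((contDiff_bilInner (hc _) hm).sub (contDiff_bilInner hm' (hc κ))))).add
    ((contDiff_endInner contDiff_snd.fst contDiff_const).add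
      (contDiff_endInner contDiff_snd.snd contDiff_const))).add
    (((contDiff_endInner (contDiff_const.add contDiff_snd.fst)
      (contDiff_const.add contDiff_snd.fst)).sub contDiff_const).mul contDiff_const)

section Projection

variable {κ : V₁ →L[ℝ] V₁ →L[ℝ] V₂}
  {P : ((V₁ →L[ℝ] V₁) × (V₂ →L[ℝ] V₂)) →ₗ[ℝ] ((V₁ →L[ℝ] V₁) × (V₂ →L[ℝ] V₂))}

theorem bilInner_bilInf_eq_zero_of_mem_skewStabilizer {Y : (V₁ →L[ℝ] V₁) × (V₂ →L[ℝ] V₂)}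
    (hY : Y ∈ skewStabilizer κ) (m : V₁ →L[ℝ] V₁ →L[ℝ] V₂) :
    bilInner (bilInf Y.1 Y.2 m) κ = 0 := by
  have h := bilInner_bilInf_adjoint Y.1 Y.2 κ m
  have h1 : bilInf (star Y.1) (star Y.2) κ = 0 := by
    rw [hY.1, hY.2.1, bilInf_neg_left, hY.2.2, neg_zero]
  rw [bilInner_comm, ← h, h1, bilInner_zero_left]

theorem bilInner_bilInf_self_of_star_eq_neg {a : V₁ →L[ℝ] V₁} {b : V₂ →L[ℝ] V₂}
    (ha : star a = -a) (hb : star b = -b) (m : V₁ →L[ℝ] V₁ →L[ℝ] V₂) :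
    bilInner (bilInf a b m) m = 0 := by
  have h := bilInner_bilInf_adjoint a b m m
  rw [ha, hb, bilInf_neg_left, ← neg_one_smul ℝ (bilInf a b m), bilInner_smul_left,
    bilInner_comm m] at h
  linarith

variable [Nontrivial V₁]

/-- Solutions of the slice equation move `l` into the normal slice: evaluating on the stabiliser
shows that the gauge terms vanish. -/
theorem bilAct_mem_normalSlice_of_sliceEquation (hP : ∀ Y, P Y ∈ skewStabilizer κ)
    (hP' : ∀ Y ∈ skewStabilizer κ, P Y = Y) {l : V₁ →L[ℝ] V₁ →L[ℝ] V₂}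
    {X : (V₁ →L[ℝ] V₁) × (V₂ →L[ℝ] V₂)} (h : sliceEquation κ P (l, X) = 0) :
    bilAct (1 + X.1) (1 + X.2) l ∈ normalSlice κ := by
  have h' : ∀ Y, sliceEquation κ P (l, X) Y = 0 := fun Y => by rw [h]; rfl
  simp only [sliceEquation_apply] at h'
  set m := bilAct (1 + X.1) (1 + X.2) l
  have h1 : ∀ Y ∈ skewStabilizer κ, endInner X.1 Y.1 + endInner X.2 Y.2 = 0 := by
    intro Y hY
    have := h' Y
    rw [hP' Y hY, bilInner_bilInf_eq_zero_of_mem_skewStabilizer hY,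
      bilInner_bilInf_eq_zero_of_mem_skewStabilizer hY,
      bilInner_bilInf_self_of_star_eq_neg hY.1 hY.2.1, hY.2.2, bilInner_zero_left,
      endInner_one_left, trace_eq_zero_of_star_eq_neg hY.1] at this
    linarith
  have h2 : endInner (1 + X.1) (1 + X.1) - Module.finrank ℝ V₁ = 0 := by
    have := h' (1, (-2 : ℝ) • 1)
    rw [h1 _ (hP _)] at this
    simp only [bilInf_grading, bilInner_zero_left, endInner_one_one] at this
    have hd : (0 : ℝ) < Module.finrank ℝ V₁ := by exact_mod_cast Module.finrank_pos
    exact (mul_eq_zero.1 (by linarith)).resolve_right hd.ne'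
  have h3 : ∀ a b, bilInner (bilInf a b m) m - bilInner (bilInf a b κ) κ +
      (1 / 2) * (bilInner (bilInf a b κ) m - bilInner (bilInf a b m) κ) = 0 := by
    intro a b
    have := h' (a, b)
    rw [h1 _ (hP _), h2, zero_mul, add_zero, add_zero] at this
    exact this
  intro a b
  -- add the equations for `(a, b)` and for its transpose
  have e₁ := h3 a b
  have e₂ := h3 (star a) (star b)
  rw [bilInner_bilInf_adjoint, bilInner_bilInf_adjoint, bilInner_bilInf_adjoint,
    bilInner_bilInf_adjoint, bilInner_comm m, bilInner_comm κ (bilInf a b κ),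
    bilInner_comm κ (bilInf a b m), bilInner_comm m] at e₂
  constructor
  · linarith
  · rw [bilInner_comm κ]
    linarith

theorem sliceEquation_eq_zero (hP : ∀ Y, P Y ∈ skewStabilizer κ)
    {l : V₁ →L[ℝ] V₁ →L[ℝ] V₂} {X : (V₁ →L[ℝ] V₁) × (V₂ →L[ℝ] V₂)}
    (h : bilAct (1 + X.1) (1 + X.2) l ∈ normalSlice κ)
    (h₁ : ∀ Y ∈ skewStabilizer κ, endInner X.1 Y.1 + endInner X.2 Y.2 = 0)
    (h₂ : endInner (1 + X.1) (1 + X.1) = Module.finrank ℝ V₁) :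
    sliceEquation κ P (l, X) = 0 := by
  refine ContinuousLinearMap.ext fun Y => ?_
  rw [sliceEquation_apply, h₁ _ (hP Y), h₂, (h Y.1 Y.2).1, (h Y.1 Y.2).2, bilInner_comm κ]
  simp

theorem sliceEquation_zero_of_mem (hP : ∀ Y, P Y ∈ skewStabilizer κ)
    {l : V₁ →L[ℝ] V₁ →L[ℝ] V₂} (h : l ∈ normalSlice κ) : sliceEquation κ P (l, 0) = 0 := by
  refine sliceEquation_eq_zero hP (by simpa using h) (fun Y _ => ?_) ?_
  · simp [endInner_zero_left]
  · simp [endInner_one_one]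

theorem hasDerivAt_bilInner {f g : ℝ → V₁ →L[ℝ] V₁ →L[ℝ] V₂} {f' g' : V₁ →L[ℝ] V₁ →L[ℝ] V₂}
    {t : ℝ} (hf : ∀ x y, HasDerivAt (fun t => f t x y) (f' x y) t)
    (hg : ∀ x y, HasDerivAt (fun t => g t x y) (g' x y) t) :
    HasDerivAt (fun t => bilInner (f t) (g t)) (bilInner (f t) g' + bilInner f' (g t)) t := by
  simp only [bilInner, ← Finset.sum_add_distrib]
  exact HasDerivAt.fun_sum fun i _ => HasDerivAt.fun_sum fun j _ => (hf _ _).inner ℝ (hg _ _)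

theorem hasDerivAt_bilInf {f : ℝ → V₁ →L[ℝ] V₁ →L[ℝ] V₂} {f' : V₁ →L[ℝ] V₁ →L[ℝ] V₂} {t : ℝ}
    (hf : ∀ x y, HasDerivAt (fun t => f t x y) (f' x y) t) (a : V₁ →L[ℝ] V₁) (b : V₂ →L[ℝ] V₂)
    (x y : V₁) : HasDerivAt (fun t => bilInf a b (f t) x y) (bilInf a b f' x y) t :=
  ((b.hasFDerivAt.comp_hasDerivAt t (hf x y)).add (hf _ _)).add (hf _ _)

theorem hasDerivAt_bilAct (l : V₁ →L[ℝ] V₁ →L[ℝ] V₂) (X : (V₁ →L[ℝ] V₁) × (V₂ →L[ℝ] V₂))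
    (x y : V₁) : HasDerivAt (fun t : ℝ => bilAct (1 + t • X.1) (1 + t • X.2) l x y)
      (bilInf X.1 X.2 l x y) 0 := by
  have h1 : ∀ z, HasDerivAt (fun t : ℝ => (1 + t • X.1) z) (X.1 z) 0 := fun z => by
    have := ((hasDerivAt_id (0 : ℝ)).smul_const (X.1 z)).const_add z
    simpa using this
  have h2 : HasDerivAt (fun t : ℝ => 1 + t • X.2) X.2 0 := by
    have := ((hasDerivAt_id (0 : ℝ)).smul_const X.2).const_add 1
    simpa using this
  have h3 : HasDerivAt (fun t : ℝ => l ((1 + t • X.1) x)) (l (X.1 x)) 0 :=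
    l.hasFDerivAt.comp_hasDerivAt (0 : ℝ) (h1 x)
  have h4 := h2.clm_apply (h3.clm_apply (h1 y))
  simp only [bilAct_apply]
  convert h4 using 1
  simp only [bilInf_apply, zero_smul, add_zero, one_apply_eq_self]
  abel

theorem hasDerivAt_sliceEquation (X Y : (V₁ →L[ℝ] V₁) × (V₂ →L[ℝ] V₂)) :
    HasDerivAt (fun t : ℝ => sliceEquation κ P (κ, t • X) Y)
      (bilInner (bilInf Y.1 Y.2 κ) (bilInf X.1 X.2 κ) +
        bilInner (bilInf Y.1 Y.2 (bilInf X.1 X.2 κ)) κ +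
        (1 / 2) * (bilInner (bilInf Y.1 Y.2 κ) (bilInf X.1 X.2 κ) -
          bilInner (bilInf Y.1 Y.2 (bilInf X.1 X.2 κ)) κ) +
        (endInner X.1 (P Y).1 + endInner X.2 (P Y).2) +
        (2 * endInner 1 X.1) * endInner 1 Y.1) 0 := by
  simp only [sliceEquation_apply, Prod.smul_fst, Prod.smul_snd, endInner_smul_left]
  have hm := hasDerivAt_bilAct κ X
  have hm' := hasDerivAt_bilInf hm Y.1 Y.2
  have hc : ∀ (m : V₁ →L[ℝ] V₁ →L[ℝ] V₂) (x y : V₁),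
      HasDerivAt (fun _ : ℝ => m x y) ((0 : V₁ →L[ℝ] V₁ →L[ℝ] V₂) x y) 0 :=
    fun m x y => hasDerivAt_const _ _
  have h1 := hasDerivAt_bilInner hm' hm
  have h2 := hasDerivAt_bilInner (hc (bilInf Y.1 Y.2 κ)) hm
  have h3 := hasDerivAt_bilInner hm' (hc κ)
  have hid := hasDerivAt_id (0 : ℝ)
  have h4 : HasDerivAt (fun t : ℝ => endInner (1 + t • X.1) (1 + t • X.1)) (2 * endInner 1 X.1)
      0 := by
    have : ∀ t : ℝ, endInner (1 + t • X.1) (1 + t • X.1) =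
        endInner (1 : V₁ →L[ℝ] V₁) 1 + (t * (2 * endInner 1 X.1) + t ^ 2 * endInner X.1 X.1) := by
      intro t
      rw [endInner_add_right, endInner_comm _ 1, endInner_comm _ (t • X.1), endInner_add_right,
        endInner_add_right, endInner_smul_right, endInner_smul_right, endInner_smul_left,
        endInner_smul_left, endInner_comm X.1 1]
      ring
    simp only [this]
    have h5 := ((hid.mul_const (2 * endInner 1 X.1)).add
      ((hid.pow 2).mul_const (endInner X.1 X.1))).const_add (endInner (1 : V₁ →L[ℝ] V₁) 1)
    refine h5.congr_deriv ?_
    simp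
  have h := (((h1.sub_const (bilInner (bilInf Y.1 Y.2 κ) κ)).add
    ((h2.sub h3).const_mul (1 / 2))).add
      ((hid.mul_const (endInner X.1 (P Y).1)).add (hid.mul_const (endInner X.2 (P Y).2)))).add
      ((h4.sub_const (Module.finrank ℝ V₁ : ℝ)).mul_const (endInner 1 Y.1))
  refine h.congr_deriv ?_
  simp only [zero_smul, add_zero, bilAct_one, bilInner_zero_left, bilInner_zero_right, zero_add,
    one_mul]

/-- The linearised slice equation at `κ` has no kernel. -/
theorem eq_zero_of_linearized_sliceEquation (hκ : CentralMoment κ)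
    (hκ' : SymmStabilizerTrivial κ) (hP : ∀ Y, P Y ∈ skewStabilizer κ)
    (hP' : ∀ Y ∈ skewStabilizer κ, P Y = Y) {X : (V₁ →L[ℝ] V₁) × (V₂ →L[ℝ] V₂)}
    (h : ∀ Y : (V₁ →L[ℝ] V₁) × (V₂ →L[ℝ] V₂), bilInner (bilInf Y.1 Y.2 κ) (bilInf X.1 X.2 κ) +
        bilInner (bilInf Y.1 Y.2 (bilInf X.1 X.2 κ)) κ +
        (1 / 2) * (bilInner (bilInf Y.1 Y.2 κ) (bilInf X.1 X.2 κ) -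
          bilInner (bilInf Y.1 Y.2 (bilInf X.1 X.2 κ)) κ) +
        (endInner X.1 (P Y).1 + endInner X.2 (P Y).2) +
        (2 * endInner 1 X.1) * endInner 1 Y.1 = 0) : X = 0 := by
  have h1 : ∀ Y ∈ skewStabilizer κ, endInner X.1 Y.1 + endInner X.2 Y.2 = 0 := by
    intro Y hY
    have := h Y
    rw [hP' Y hY, bilInner_bilInf_eq_zero_of_mem_skewStabilizer hY, hY.2.2, bilInner_zero_left,
      endInner_one_left Y.1, trace_eq_zero_of_star_eq_neg hY.1] at this
    linarith
  have h2 : LinearMap.trace ℝ V₁ X.1.toLinearMap = 0 := by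
    have := h (1, (-2 : ℝ) • 1)
    rw [h1 _ (hP _)] at this
    simp only [bilInf_grading, bilInner_zero_left, endInner_one_one] at this
    have hd : (0 : ℝ) < Module.finrank ℝ V₁ := by exact_mod_cast Module.finrank_pos
    rw [← endInner_one_left]
    have h3 : 2 * endInner 1 X.1 * (Module.finrank ℝ V₁ : ℝ) = 0 := by linarith
    have h4 := (mul_eq_zero.1 h3).resolve_right hd.ne'
    linarith
  -- testing against `3 X - Xᵀ` isolates `‖X κ‖²`
  have h3 : bilInf X.1 X.2 κ = 0 := by
    have := h ((3 : ℝ) • X.1 + (-1 : ℝ) • star X.1, (3 : ℝ) • X.2 + (-1 : ℝ) • star X.2)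
    rw [h1 _ (hP _), endInner_one_left, h2] at this
    simp only [bilInf_add_left, bilInf_smul_left, bilInner_add_left, bilInner_smul_left] at this
    rw [bilInner_bilInf_adjoint, bilInner_bilInf_adjoint,
      bilInner_comm (bilInf X.1 X.2 (bilInf X.1 X.2 κ)) κ] at this
    exact bilInner_self_eq_zero (by linarith)
  have h4 := bilInf_star_eq_zero hκ h3
  obtain ⟨c, hc₁, hc₂⟩ := hκ' (X.1 + star X.1) (X.2 + star X.2) (IsSelfAdjoint.add_star_self _)
    (IsSelfAdjoint.add_star_self _) (by rw [bilInf_add_left, h3, h4, add_zero])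
  have hc : c = 0 := by
    have h5 := congrArg (fun a : V₁ →L[ℝ] V₁ => endInner 1 a) hc₁
    simp only [endInner_add_right, endInner_smul_right, endInner_one_one] at h5
    rw [endInner_one_left, endInner_one_left, trace_star, h2] at h5
    have hd : (0 : ℝ) < Module.finrank ℝ V₁ := by exact_mod_cast Module.finrank_pos
    have h6 : c * (Module.finrank ℝ V₁ : ℝ) = 0 := by linarith
    exact (mul_eq_zero.1 h6).resolve_right hd.ne'
  rw [hc, zero_smul] at hc₁
  rw [hc, mul_zero, zero_smul] at hc₂
  have hX : X ∈ skewStabilizer κ :=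
    ⟨(neg_eq_of_add_eq_zero_right hc₁).symm, (neg_eq_of_add_eq_zero_right hc₂).symm, h3⟩
  have h5 := h1 X hX
  have h6 := endInner_self_nonneg X.1
  have h7 := endInner_self_nonneg X.2
  exact Prod.ext (endInner_self_eq_zero (by linarith)) (endInner_self_eq_zero (by linarith))

end Projection

end Slice

section Slice

variable {V₁ V₂ : Type*} [NormedAddCommGroup V₁] [InnerProductSpace ℝ V₁] [FiniteDimensional ℝ V₁]
  [NormedAddCommGroup V₂] [InnerProductSpace ℝ V₂] [FiniteDimensional ℝ V₂]
  [CompleteSpace V₁] [CompleteSpace V₂] [Nontrivial V₁] {κ : V₁ →L[ℝ] V₁ →L[ℝ] V₂}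
  {P : ((V₁ →L[ℝ] V₁) × (V₂ →L[ℝ] V₂)) →ₗ[ℝ] ((V₁ →L[ℝ] V₁) × (V₂ →L[ℝ] V₂))}

theorem exists_projection_skewStabilizer (κ : V₁ →L[ℝ] V₁ →L[ℝ] V₂) :
    ∃ P : ((V₁ →L[ℝ] V₁) × (V₂ →L[ℝ] V₂)) →ₗ[ℝ] ((V₁ →L[ℝ] V₁) × (V₂ →L[ℝ] V₂)),
      (∀ Y, P Y ∈ skewStabilizer κ) ∧ ∀ Y ∈ skewStabilizer κ, P Y = Y := by
  obtain ⟨p, hp⟩ := (skewStabilizer κ).subtype.exists_leftInverse_of_injective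
    (Submodule.ker_subtype _)
  refine ⟨(skewStabilizer κ).subtype ∘ₗ p, fun Y => (p Y).2, fun Y hY => ?_⟩
  exact congrArg Subtype.val (LinearMap.congr_fun hp ⟨Y, hY⟩)

/-- Near a point of the normal slice of `κ` close to `κ`, every map can be moved into the normal
slice by a pair close to the identity. -/
theorem exists_eventually_bilAct_mem_normalSlice (hκ : CentralMoment κ)
    (hκ' : SymmStabilizerTrivial κ) :
    ∀ᶠ l₀ in 𝓝 κ, l₀ ∈ normalSlice κ → ∀ δ > 0, ∀ᶠ l in 𝓝 l₀,
      ∃ X : (V₁ →L[ℝ] V₁) × (V₂ →L[ℝ] V₂), ‖X‖ < δ ∧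
        bilAct (1 + X.1) (1 + X.2) l ∈ normalSlice κ := by
  obtain ⟨P, hP, hP'⟩ := exists_projection_skewStabilizer κ
  have h := exists_eventually_solution (contDiff_sliceEquation κ P)
    hasDerivAt_sliceEquation fun _ => eq_zero_of_linearized_sliceEquation hκ hκ' hP hP'
  refine h.mono fun l₀ hl₀ hmem δ hδ => ?_
  refine (hl₀ (sliceEquation_zero_of_mem hP hmem) δ hδ).mono fun l hl => ?_
  obtain ⟨X, hX, hX'⟩ := hl
  exact ⟨X, hX, bilAct_mem_normalSlice_of_sliceEquation hP hP' hX'⟩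

/-- The pair moving `l` into the normal slice is locally unique once the stabiliser of `κ` is
factored out. -/
theorem exists_eq_zero_of_bilAct_mem_normalSlice (hκ : CentralMoment κ)
    (hκ' : SymmStabilizerTrivial κ) :
    ∃ δ > 0, ∀ (l : V₁ →L[ℝ] V₁ →L[ℝ] V₂) (X : (V₁ →L[ℝ] V₁) × (V₂ →L[ℝ] V₂)),
      ‖l - κ‖ < δ → ‖X‖ < δ →
      l ∈ normalSlice κ → bilAct (1 + X.1) (1 + X.2) l ∈ normalSlice κ →
      (∀ Y ∈ skewStabilizer κ, endInner X.1 Y.1 + endInner X.2 Y.2 = 0) →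
      endInner (1 + X.1) (1 + X.1) = Module.finrank ℝ V₁ → X = 0 := by
  obtain ⟨P, hP, hP'⟩ := exists_projection_skewStabilizer κ
  have h := eventually_solution_unique (contDiff_sliceEquation κ P)
    hasDerivAt_sliceEquation (fun _ => eq_zero_of_linearized_sliceEquation hκ hκ' hP hP')
    (sliceEquation_zero_of_mem hP (self_mem_normalSlice κ))
  obtain ⟨δ, hδ, h⟩ := h
  exact ⟨δ, hδ, fun l X hl hX h₁ h₂ h₃ h₄ => h l X hl hX (sliceEquation_eq_zero hP h₂ h₃ h₄)
    (sliceEquation_zero_of_mem hP h₁)⟩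

/-- The infinitesimal action on `l` as a linear map. -/
noncomputable def bilInfLinear (l : V₁ →L[ℝ] V₁ →L[ℝ] V₂) :
    ((V₁ →L[ℝ] V₁) × (V₂ →L[ℝ] V₂)) →ₗ[ℝ] (V₁ →L[ℝ] V₁ →L[ℝ] V₂) where
  toFun Y := bilInf Y.1 Y.2 l
  map_add' _ _ := bilInf_add_left _ _ _ _ _
  map_smul' _ _ := bilInf_smul_left _ _ _ _

/-- The skew part of a pair of endomorphisms and the trace of its first component. -/
noncomputable def skewPartTrace :
    ((V₁ →L[ℝ] V₁) × (V₂ →L[ℝ] V₂)) →ₗ[ℝ] (((V₁ →L[ℝ] V₁) × (V₂ →L[ℝ] V₂)) × ℝ) where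
  toFun Y := ((Y.1 - star Y.1, Y.2 - star Y.2), endInner 1 Y.1)
  map_add' Y Y' := by
    refine Prod.ext (Prod.ext ?_ ?_) (endInner_add_right _ _ _)
    · simp only [Prod.fst_add, star_add]; abel
    · simp only [Prod.snd_add, star_add, Prod.fst_add]; abel
  map_smul' c Y := by
    refine Prod.ext (Prod.ext ?_ ?_) (endInner_smul_right _ _ _)
    · simp [smul_sub]
    · simp [smul_sub]

theorem continuous_bilInfLinear_apply (Y : (V₁ →L[ℝ] V₁) × (V₂ →L[ℝ] V₂)) :
    Continuous fun l : V₁ →L[ℝ] V₁ →L[ℝ] V₂ => bilInfLinear l Y := by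
  refine continuous_clm_apply.2 fun x => continuous_clm_apply.2 fun y => ?_
  change Continuous fun l : V₁ →L[ℝ] V₁ →L[ℝ] V₂ => bilInf Y.1 Y.2 l x y
  simp only [bilInf_apply]
  fun_prop

theorem finrank_pos_real : (0 : ℝ) < Module.finrank ℝ V₁ := by
  exact_mod_cast Module.finrank_pos

theorem eq_zero_of_symmStabilizerTrivial (hκ' : SymmStabilizerTrivial κ)
    (Y : (V₁ →L[ℝ] V₁) × (V₂ →L[ℝ] V₂)) (h : bilInfLinear κ Y = 0) (hs : skewPartTrace Y = 0) :
    Y = 0 := by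
  have h2 : Y.1 - star Y.1 = 0 := congrArg (fun z => z.1.1) hs
  have h3 : Y.2 - star Y.2 = 0 := congrArg (fun z => z.1.2) hs
  have h4 : endInner 1 Y.1 = 0 := congrArg Prod.snd hs
  obtain ⟨c, hc₁, hc₂⟩ := hκ' Y.1 Y.2 (sub_eq_zero.1 h2).symm (sub_eq_zero.1 h3).symm h
  rw [hc₁, endInner_smul_right, endInner_one_one] at h4
  have hc := (mul_eq_zero.1 h4).resolve_right finrank_pos_real.ne'
  exact Prod.ext (by rw [hc₁, hc, zero_smul]; rfl) (by rw [hc₂, hc, mul_zero, zero_smul]; rfl)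

theorem symmStabilizerTrivial_of_forall {l : V₁ →L[ℝ] V₁ →L[ℝ] V₂}
    (hl : ∀ Y, bilInfLinear l Y = 0 → skewPartTrace Y = 0 → Y = 0) : SymmStabilizerTrivial l := by
  intro a b ha hb hab
  set c : ℝ := endInner 1 a / Module.finrank ℝ V₁ with hc
  -- subtract the multiple of the grading element with the same trace
  have ha' : IsSelfAdjoint (a + (-c) • (1 : V₁ →L[ℝ] V₁)) :=
    ha.add (IsSelfAdjoint.smul (IsSelfAdjoint.all _) (IsSelfAdjoint.one _))
  have hb' : IsSelfAdjoint (b + (-c) • (-2 : ℝ) • (1 : V₂ →L[ℝ] V₂)) :=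
    hb.add (IsSelfAdjoint.smul (IsSelfAdjoint.all _)
      (IsSelfAdjoint.smul (IsSelfAdjoint.all _) (IsSelfAdjoint.one _)))
  have h0 : bilInf (a + (-c) • 1) (b + (-c) • (-2 : ℝ) • 1) l = 0 := by
    rw [bilInf_add_left, hab, bilInf_smul_left, bilInf_grading]
    ext x y
    simp
  have ht : endInner 1 (a + (-c) • 1) = 0 := by
    rw [endInner_add_right, endInner_smul_right, endInner_one_one, hc, neg_mul,
      div_mul_cancel₀ _ finrank_pos_real.ne', add_neg_cancel]
  have h1 := hl (a + (-c) • 1, b + (-c) • (-2 : ℝ) • 1) h0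
    (Prod.ext (Prod.ext (sub_eq_zero.2 ha'.star_eq.symm) (sub_eq_zero.2 hb'.star_eq.symm)) ht)
  refine ⟨c, ?_, ?_⟩
  · have h2 : a + (-c) • 1 = 0 := congrArg Prod.fst h1
    rw [eq_neg_of_add_eq_zero_left h2, neg_smul, neg_neg]
  · have h2 : b + (-c) • (-2 : ℝ) • 1 = 0 := congrArg Prod.snd h1
    rw [eq_neg_of_add_eq_zero_left h2, smul_smul, ← neg_smul]
    congr 1
    ring

/-- Triviality of the symmetric stabiliser is an open condition. -/
theorem eventually_symmStabilizerTrivial (hκ' : SymmStabilizerTrivial κ) :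
    ∀ᶠ l in 𝓝 κ, SymmStabilizerTrivial l := by
  have h := eventually_eq_zero_of_apply_eq_zero (T := V₁ →L[ℝ] V₁ →L[ℝ] V₂)
    (G := (V₁ →L[ℝ] V₁) × (V₂ →L[ℝ] V₂)) (H := V₁ →L[ℝ] V₁ →L[ℝ] V₂)
    (H' := ((V₁ →L[ℝ] V₁) × (V₂ →L[ℝ] V₂)) × ℝ) (f := bilInfLinear) (l₀ := κ)
    continuous_bilInfLinear_apply skewPartTrace (eq_zero_of_symmStabilizerTrivial hκ')
  exact h.mono fun _ => symmStabilizerTrivial_of_forall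

end Slice

/-! ### Unitary pairs and uniqueness of the normal position -/

section OrbitUniqueness

section Single

variable {V : Type*} [NormedAddCommGroup V] [InnerProductSpace ℝ V] [FiniteDimensional ℝ V]
  [CompleteSpace V]

theorem opNorm_sq_le_endInner (A : V →L[ℝ] V) : ‖A‖ ^ 2 ≤ endInner A A := by
  have h0 := endInner_self_nonneg A
  rw [← Real.le_sqrt (norm_nonneg _) h0]
  refine A.opNorm_le_bound (Real.sqrt_nonneg _) fun x => ?_
  set e := stdOrthonormalBasis ℝ V
  have h1 : A x = ∑ i, ⟪e i, x⟫_ℝ • A (e i) := by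
    conv_lhs => rw [← e.sum_repr' x]
    simp
  have h2 : ‖A x‖ ≤ ∑ i, ‖A (e i)‖ * |⟪e i, x⟫_ℝ| := by
    rw [h1]
    refine (norm_sum_le _ _).trans (Finset.sum_le_sum fun i _ => ?_)
    rw [norm_smul, Real.norm_eq_abs, mul_comm]
  have h3 : ∑ i, ‖A (e i)‖ * |⟪e i, x⟫_ℝ| ≤
      Real.sqrt (∑ i, ‖A (e i)‖ ^ 2) * Real.sqrt (∑ i, |⟪e i, x⟫_ℝ| ^ 2) :=
    Real.sum_mul_le_sqrt_mul_sqrt _ _ _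
  have h4 : ∑ i, ‖A (e i)‖ ^ 2 = endInner A A := by
    simp only [endInner, real_inner_self_eq_norm_sq, e]
  have h5 : ∑ i, |⟪e i, x⟫_ℝ| ^ 2 = ‖x‖ ^ 2 := by
    rw [← e.sum_sq_norm_inner_right x]
    simp only [Real.norm_eq_abs]
  rw [h4, h5, Real.sqrt_sq (norm_nonneg x)] at h3
  exact h2.trans h3

theorem inner_map_map_of_mem_unitary {U : V →L[ℝ] V} (hU : U ∈ unitary (V →L[ℝ] V)) (x y : V) :
    ⟪U x, U y⟫_ℝ = ⟪x, y⟫_ℝ :=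
  (Unitary.linearIsometryEquiv ⟨U, hU⟩).inner_map_map x y

theorem endInner_self_of_mem_unitary {U : V →L[ℝ] V} (hU : U ∈ unitary (V →L[ℝ] V)) :
    endInner U U = Module.finrank ℝ V := by
  rw [← endInner_one_one]
  simp only [endInner, inner_map_map_of_mem_unitary hU, one_apply_eq_self]

theorem endInner_mul_left (A B C : V →L[ℝ] V) : endInner A (B * C) = endInner (star B * A) C := by
  simp only [endInner, mul_apply_eq_comp, ContinuousLinearMap.star_eq_adjoint,
    ContinuousLinearMap.adjoint_inner_left]

theorem endInner_mul_right {U : V →L[ℝ] V} (hU : U ∈ unitary (V →L[ℝ] V)) (A B : V →L[ℝ] V) :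
    endInner A (B * U) = endInner (A * star U) B := by
  let e := stdOrthonormalBasis ℝ V
  let e' := e.map (Unitary.linearIsometryEquiv ⟨U, hU⟩)
  have h1 := (sum_inner_apply_eq_trace e (A * star U).toLinearMap B.toLinearMap).trans
    (sum_inner_apply_eq_trace e' (A * star U).toLinearMap B.toLinearMap).symm
  refine Eq.trans ?_ h1.symm
  have he : ∀ i, star U (e' i) = e i := fun i => by
    change (star U * U) (e i) = e i
    rw [Unitary.star_mul_self_of_mem hU]
    rfl
  refine Finset.sum_congr rfl fun i _ => ?_
  change _ = ⟪A (star U (e' i)), B (e' i)⟫_ℝ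
  rw [he]
  rfl

theorem norm_apply_of_mem_unitary {U : V →L[ℝ] V} (hU : U ∈ unitary (V →L[ℝ] V)) (x : V) :
    ‖U x‖ = ‖x‖ :=
  (Unitary.linearIsometryEquiv ⟨U, hU⟩).norm_map x

theorem isCompact_unitary : IsCompact (unitary (V →L[ℝ] V) : Set (V →L[ℝ] V)) := by
  have : ProperSpace (V →L[ℝ] V) := FiniteDimensional.proper_real _
  refine Metric.isCompact_of_isClosed_isBounded isClosed_unitary ?_
  refine (Metric.isBounded_closedBall (x := (0 : V →L[ℝ] V)) (r := 1)).subset fun U hU => ?_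
  rw [mem_closedBall_zero_iff]
  exact U.opNorm_le_bound zero_le_one fun x => by rw [norm_apply_of_mem_unitary hU, one_mul]

theorem exp_smul_mem_unitary {a : V →L[ℝ] V} (ha : star a = -a) (t : ℝ) :
    NormedSpace.exp (t • a) ∈ unitary (V →L[ℝ] V) := by
  let +nondep : NormedAlgebra ℚ (V →L[ℝ] V) := NormedAlgebra.restrictScalars ℚ ℝ _
  refine NormedSpace.exp_mem_unitary_of_mem_skewAdjoint ?_
  rw [skewAdjoint.mem_iff, star_smul, ha, star_trivial, smul_neg]

end Single

variable {V₁ V₂ : Type*} [NormedAddCommGroup V₁] [InnerProductSpace ℝ V₁] [FiniteDimensional ℝ V₁]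
  [NormedAddCommGroup V₂] [InnerProductSpace ℝ V₂] [FiniteDimensional ℝ V₂]
  [CompleteSpace V₁] [CompleteSpace V₂] {κ : V₁ →L[ℝ] V₁ →L[ℝ] V₂}

/-- The pairs of unitary endomorphisms fixing `κ`. -/
def unitaryStabilizer (κ : V₁ →L[ℝ] V₁ →L[ℝ] V₂) : Set ((V₁ →L[ℝ] V₁) × (V₂ →L[ℝ] V₂)) :=
  {h | h.1 ∈ unitary (V₁ →L[ℝ] V₁) ∧ h.2 ∈ unitary (V₂ →L[ℝ] V₂) ∧ bilAct h.1 h.2 κ = κ}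

/-- Unitary pairs act by isometries for the operator norm; only the contraction is needed. -/
theorem norm_bilAct_le {A : V₁ →L[ℝ] V₁} {B : V₂ →L[ℝ] V₂} (hA : A ∈ unitary (V₁ →L[ℝ] V₁))
    (hB : B ∈ unitary (V₂ →L[ℝ] V₂)) (l : V₁ →L[ℝ] V₁ →L[ℝ] V₂) : ‖bilAct A B l‖ ≤ ‖l‖ := by
  refine ContinuousLinearMap.opNorm_le_bound₂ _ (norm_nonneg l) fun x y => ?_
  rw [bilAct_apply, norm_apply_of_mem_unitary hB]
  refine (l.le_opNorm₂ _ _).trans ?_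
  rw [norm_apply_of_mem_unitary hA, norm_apply_of_mem_unitary hA]

theorem bilAct_sub (A : V₁ →L[ℝ] V₁) (B : V₂ →L[ℝ] V₂) (l m : V₁ →L[ℝ] V₁ →L[ℝ] V₂) :
    bilAct A B (l - m) = bilAct A B l - bilAct A B m := by
  ext x y
  simp only [bilAct_apply, sub_apply, map_sub]

/-- One-parameter groups of the skew stabiliser fix `κ`. -/
theorem bilAct_exp_of_mem_skewStabilizer {Y : (V₁ →L[ℝ] V₁) × (V₂ →L[ℝ] V₂)}
    (hY : Y ∈ skewStabilizer κ) (t : ℝ) :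
    bilAct (NormedSpace.exp (t • Y.1)) (NormedSpace.exp (t • Y.2)) κ = κ := by
  refine ContinuousLinearMap.ext fun x => ContinuousLinearMap.ext fun y => ?_
  let f : ℝ → V₂ := fun t =>
    bilAct (NormedSpace.exp (t • Y.1)) (NormedSpace.exp (t • Y.2)) κ x y
  have h0 : ∀ t, HasDerivAt f 0 t := by
    intro t
    have h1 : ∀ z, HasDerivAt (fun t : ℝ => NormedSpace.exp (t • Y.1) z)
        ((Y.1 * NormedSpace.exp (t • Y.1)) z) t := fun z => by
      simpa using (hasDerivAt_exp_smul_const' Y.1 t).clm_apply (hasDerivAt_const t z)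
    have h2 := hasDerivAt_exp_smul_const Y.2 t
    have h3 := κ.hasFDerivAt.comp_hasDerivAt t (h1 x)
    have h4 := h2.clm_apply (h3.clm_apply (h1 y))
    refine h4.congr_deriv ?_
    have h5 := congrArg (fun b : V₁ →L[ℝ] V₁ →L[ℝ] V₂ => NormedSpace.exp (t • Y.2)
      (b (NormedSpace.exp (t • Y.1) x) (NormedSpace.exp (t • Y.1) y))) hY.2.2
    simp only [bilInf_apply, zero_apply, map_zero, map_add] at h5
    rw [← h5]
    simp only [mul_apply_eq_comp, map_add, Function.comp_apply]
    abel
  have h6 := is_const_of_deriv_eq_zero (fun t => (h0 t).differentiableAt)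
    (fun t => (h0 t).deriv) t 0
  refine h6.trans ?_
  simp [f, NormedSpace.exp_zero]

theorem isCompact_unitaryPairs : IsCompact ((unitary (V₁ →L[ℝ] V₁) : Set (V₁ →L[ℝ] V₁)) ×ˢ
    (unitary (V₂ →L[ℝ] V₂) : Set (V₂ →L[ℝ] V₂))) :=
  isCompact_unitary.prod isCompact_unitary

theorem continuous_bilAct (l : V₁ →L[ℝ] V₁ →L[ℝ] V₂) :
    Continuous fun h : (V₁ →L[ℝ] V₁) × (V₂ →L[ℝ] V₂) => bilAct h.1 h.2 l := by
  refine continuous_clm_apply.2 fun x => continuous_clm_apply.2 fun y => ?_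
  simp only [bilAct_apply]
  fun_prop

theorem isCompact_unitaryStabilizer (κ : V₁ →L[ℝ] V₁ →L[ℝ] V₂) :
    IsCompact (unitaryStabilizer κ) := by
  have h : unitaryStabilizer κ = ((unitary (V₁ →L[ℝ] V₁) : Set (V₁ →L[ℝ] V₁)) ×ˢ
      (unitary (V₂ →L[ℝ] V₂) : Set (V₂ →L[ℝ] V₂))) ∩ {h | bilAct h.1 h.2 κ = κ} := by
    ext h
    exact and_assoc.symm
  rw [h]
  exact isCompact_unitaryPairs.inter_right (isClosed_eq (continuous_bilAct κ) continuous_const)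

theorem one_mem_unitaryStabilizer (κ : V₁ →L[ℝ] V₁ →L[ℝ] V₂) :
    ((1, 1) : (V₁ →L[ℝ] V₁) × (V₂ →L[ℝ] V₂)) ∈ unitaryStabilizer κ :=
  ⟨one_mem _, one_mem _, bilAct_one κ⟩

/-- The overlap `⟨u, h⟩` of two pairs of endomorphisms; for unitary pairs it is maximal when the
Hilbert–Schmidt distance is minimal. -/
noncomputable def pairInner (u h : (V₁ →L[ℝ] V₁) × (V₂ →L[ℝ] V₂)) : ℝ :=
  endInner u.1 h.1 + endInner u.2 h.2

theorem continuous_pairInner_right (u : (V₁ →L[ℝ] V₁) × (V₂ →L[ℝ] V₂)) :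
    Continuous fun h : (V₁ →L[ℝ] V₁) × (V₂ →L[ℝ] V₂) => pairInner u h := by
  simp only [pairInner, endInner]
  fun_prop

theorem continuous_pairInner_left (h : (V₁ →L[ℝ] V₁) × (V₂ →L[ℝ] V₂)) :
    Continuous fun u : (V₁ →L[ℝ] V₁) × (V₂ →L[ℝ] V₂) => pairInner u h := by
  simp only [pairInner, endInner]
  fun_prop

/-- By compactness, a unitary pair moving `κ` only slightly is close to the stabiliser of `κ`. -/
theorem exists_near_unitaryStabilizer (κ : V₁ →L[ℝ] V₁ →L[ℝ] V₂) {δ : ℝ} (hδ : 0 < δ) :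
    ∃ ε > 0, ∀ u : (V₁ →L[ℝ] V₁) × (V₂ →L[ℝ] V₂), u.1 ∈ unitary (V₁ →L[ℝ] V₁) →
      u.2 ∈ unitary (V₂ →L[ℝ] V₂) → ‖bilAct u.1 u.2 κ - κ‖ < ε →
      ∃ h ∈ unitaryStabilizer κ,
        Module.finrank ℝ V₁ + Module.finrank ℝ V₂ - δ < pairInner u h := by
  let d : ℝ := Module.finrank ℝ V₁ + Module.finrank ℝ V₂
  let bad : Set ((V₁ →L[ℝ] V₁) × (V₂ →L[ℝ] V₂)) :=
    ((unitary (V₁ →L[ℝ] V₁) : Set (V₁ →L[ℝ] V₁)) ×ˢ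
      (unitary (V₂ →L[ℝ] V₂) : Set (V₂ →L[ℝ] V₂))) ∩
      ⋂ h ∈ unitaryStabilizer κ, {u | pairInner u h ≤ d - δ}
  have hbad : IsCompact bad := isCompact_unitaryPairs.inter_right
    (isClosed_biInter fun h _ => isClosed_le (continuous_pairInner_left h) continuous_const)
  have hcont : Continuous fun u : (V₁ →L[ℝ] V₁) × (V₂ →L[ℝ] V₂) => ‖bilAct u.1 u.2 κ - κ‖ :=
    (continuous_norm (E := V₁ →L[ℝ] V₁ →L[ℝ] V₂)).comp
      ((continuous_bilAct κ).sub continuous_const)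
  have hpos : ∀ u ∈ bad, 0 < ‖bilAct u.1 u.2 κ - κ‖ := by
    rintro u ⟨⟨hu₁, hu₂⟩, hu⟩
    refine (norm_pos_iff (E := V₁ →L[ℝ] V₁ →L[ℝ] V₂)).2 (sub_ne_zero.2 fun hκ => ?_)
    have h1 := Set.mem_iInter₂.1 hu u ⟨hu₁, hu₂, hκ⟩
    have h2 : pairInner u u ≤ d - δ := h1
    rw [pairInner, endInner_self_of_mem_unitary hu₁, endInner_self_of_mem_unitary hu₂] at h2
    linarith
  obtain ⟨ε, hε, h⟩ := hbad.exists_forall_le' hcont.continuousOn hpos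
  refine ⟨ε, hε, fun u hu₁ hu₂ hu => ?_⟩
  by_contra! hne
  exact (h u ⟨⟨hu₁, hu₂⟩, Set.mem_iInter₂.2 hne⟩).not_gt hu

/-- At the point `h` of the stabiliser of `κ` nearest to `u`, the quotient `u h⁻¹` is orthogonal to
the Lie algebra of the stabiliser. -/
theorem endInner_add_eq_zero_of_isMaxOn {u h : (V₁ →L[ℝ] V₁) × (V₂ →L[ℝ] V₂)}
    (hh : h ∈ unitaryStabilizer κ) (hmax : IsMaxOn (pairInner u) (unitaryStabilizer κ) h)
    {Y : (V₁ →L[ℝ] V₁) × (V₂ →L[ℝ] V₂)} (hY : Y ∈ skewStabilizer κ) :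
    endInner (star h.1 * u.1) Y.1 + endInner (u.2 * star h.2) Y.2 = 0 := by
  let c : ℝ → (V₁ →L[ℝ] V₁) × (V₂ →L[ℝ] V₂) := fun t =>
    (h.1 * NormedSpace.exp (t • Y.1), NormedSpace.exp (t • Y.2) * h.2)
  have hc : ∀ t, c t ∈ unitaryStabilizer κ := fun t =>
    ⟨mul_mem hh.1 (exp_smul_mem_unitary hY.1 t), mul_mem (exp_smul_mem_unitary hY.2.1 t) hh.2.1, by
      rw [← bilAct_bilAct, hh.2.2, bilAct_exp_of_mem_skewStabilizer hY]⟩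
  have hc0 : c 0 = h := by simp [c, NormedSpace.exp_zero]
  have hloc : IsLocalMax (fun t => pairInner u (c t)) 0 := by
    refine Filter.Eventually.of_forall fun t => ?_
    change pairInner u (c t) ≤ pairInner u (c 0)
    rw [hc0]
    exact hmax (hc t)
  have hd : HasDerivAt (fun t => pairInner u (c t))
      (endInner u.1 (h.1 * Y.1) + endInner u.2 (Y.2 * h.2)) 0 := by
    have h1 : ∀ z, HasDerivAt (fun t => (c t).1 z) ((h.1 * Y.1) z) 0 := fun z => by
      have := ((hasDerivAt_exp_smul_const Y.1 (0 : ℝ)).const_mul h.1).clm_apply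
        (hasDerivAt_const (0 : ℝ) z)
      simpa [c, NormedSpace.exp_zero] using this
    have h2 : ∀ z, HasDerivAt (fun t => (c t).2 z) ((Y.2 * h.2) z) 0 := fun z => by
      have := ((hasDerivAt_exp_smul_const Y.2 (0 : ℝ)).mul_const h.2).clm_apply
        (hasDerivAt_const (0 : ℝ) z)
      simpa [c, NormedSpace.exp_zero] using this
    refine HasDerivAt.add (HasDerivAt.fun_sum fun i _ => ?_) (HasDerivAt.fun_sum fun i _ => ?_)
    · simpa using (hasDerivAt_const (0 : ℝ) _).inner ℝ (h1 (stdOrthonormalBasis ℝ V₁ i))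
    · simpa using (hasDerivAt_const (0 : ℝ) _).inner ℝ (h2 (stdOrthonormalBasis ℝ V₂ i))
  have := hloc.hasDerivAt_eq_zero hd
  rwa [endInner_mul_left, endInner_mul_right hh.2.1] at this

theorem norm_sub_sq_le_of_unitary {V : Type*} [NormedAddCommGroup V] [InnerProductSpace ℝ V]
    [FiniteDimensional ℝ V] [CompleteSpace V] {u h : V →L[ℝ] V} (hu : u ∈ unitary (V →L[ℝ] V))
    (hh : h ∈ unitary (V →L[ℝ] V)) :
    ‖u - h‖ ^ 2 ≤ 2 * (Module.finrank ℝ V - endInner u h) := by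
  refine (opNorm_sq_le_endInner _).trans (le_of_eq ?_)
  rw [endInner_sub_left, endInner_comm u (u - h), endInner_comm h (u - h), endInner_sub_left,
    endInner_sub_left, endInner_self_of_mem_unitary hu, endInner_self_of_mem_unitary hh,
    endInner_comm h u]
  ring

theorem endInner_le_finrank_of_unitary {V : Type*} [NormedAddCommGroup V] [InnerProductSpace ℝ V]
    [FiniteDimensional ℝ V] [CompleteSpace V] {u h : V →L[ℝ] V} (hu : u ∈ unitary (V →L[ℝ] V))
    (hh : h ∈ unitary (V →L[ℝ] V)) : endInner u h ≤ Module.finrank ℝ V := by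
  have := norm_sub_sq_le_of_unitary hu hh
  nlinarith [sq_nonneg ‖u - h‖]

variable [Nontrivial V₁]

/-- Unitary pairs relating two points of the normal slice near `κ` fix `κ`: such a pair is close to
the stabiliser, and after division by the nearest element of the stabiliser the local uniqueness
applies. -/
theorem exists_bilAct_eq_of_unitary (hκ : CentralMoment κ) (hκ' : SymmStabilizerTrivial κ) :
    ∃ ε > 0, ∀ (l₁ : V₁ →L[ℝ] V₁ →L[ℝ] V₂) (u : (V₁ →L[ℝ] V₁) × (V₂ →L[ℝ] V₂)),
      u.1 ∈ unitary (V₁ →L[ℝ] V₁) → u.2 ∈ unitary (V₂ →L[ℝ] V₂) → l₁ ∈ normalSlice κ →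
      bilAct u.1 u.2 l₁ ∈ normalSlice κ → ‖l₁ - κ‖ < ε → ‖bilAct u.1 u.2 l₁ - κ‖ < ε →
      bilAct u.1 u.2 κ = κ := by
  obtain ⟨δ, hδ, huniq⟩ := exists_eq_zero_of_bilAct_mem_normalSlice hκ hκ'
  obtain ⟨ε, hε, hnear⟩ := exists_near_unitaryStabilizer κ (δ := δ ^ 2 / 2) (by positivity)
  refine ⟨min δ (ε / 2), by positivity, fun l₁ u hu₁ hu₂ hl₁ hl₂ hd₁ hd₂ => ?_⟩
  have hclose : ‖bilAct u.1 u.2 κ - κ‖ < ε := by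
    have h1 : bilAct u.1 u.2 κ - κ = -bilAct u.1 u.2 (l₁ - κ) + (bilAct u.1 u.2 l₁ - κ) := by
      rw [bilAct_sub]
      abel
    rw [h1]
    refine (norm_add_le (-bilAct u.1 u.2 (l₁ - κ)) (bilAct u.1 u.2 l₁ - κ)).trans_lt ?_
    have h0 := norm_neg (E := V₁ →L[ℝ] V₁ →L[ℝ] V₂) (bilAct u.1 u.2 (l₁ - κ))
    have h2 := norm_bilAct_le hu₁ hu₂ (l₁ - κ)
    have h3 := hd₁.trans_le (min_le_right _ _)
    have h4 := hd₂.trans_le (min_le_right _ _)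
    linarith
  obtain ⟨h', hh', hlt⟩ := hnear u hu₁ hu₂ hclose
  obtain ⟨h, hh, hmax⟩ := (isCompact_unitaryStabilizer κ).exists_isMaxOn
    ⟨_, one_mem_unitaryStabilizer κ⟩ (continuous_pairInner_right u).continuousOn
  have hlt' := hlt.trans_le (hmax hh')
  obtain ⟨hh₁, hh₂, hhκ⟩ := hh
  have hsu : star h.1 * u.1 ∈ unitary (V₁ →L[ℝ] V₁) := mul_mem (Unitary.star_mem hh₁) hu₁
  let X : (V₁ →L[ℝ] V₁) × (V₂ →L[ℝ] V₂) := (star h.1 * u.1 - 1, u.2 * star h.2 - 1)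
  have hX₁ : 1 + X.1 = star h.1 * u.1 := by simp [X]
  have hX₂ : 1 + X.2 = u.2 * star h.2 := by simp [X]
  have hact : ∀ l, bilAct (1 + X.1) (1 + X.2) (bilAct h.1 h.2 l) = bilAct u.1 u.2 l := by
    intro l
    rw [hX₁, hX₂, bilAct_bilAct, ← mul_assoc, Unitary.mul_star_self_of_mem hh₁, one_mul,
      mul_assoc, Unitary.star_mul_self_of_mem hh₂, mul_one]
  have hbound₁ : ‖X.1‖ < δ := by
    have h1 : X.1 = star h.1 * (u.1 - h.1) := by
      rw [mul_sub, Unitary.star_mul_self_of_mem hh₁]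
    have h2 := norm_sub_sq_le_of_unitary hu₁ hh₁
    have h3 := endInner_le_finrank_of_unitary hu₂ hh₂
    simp only [pairInner] at hlt'
    rw [h1, CStarRing.norm_mem_unitary_mul _ (Unitary.star_mem hh₁)]
    exact lt_of_pow_lt_pow_left₀ 2 hδ.le (by linarith)
  have hbound₂ : ‖X.2‖ < δ := by
    have h1 : X.2 = (u.2 - h.2) * star h.2 := by
      rw [sub_mul, Unitary.mul_star_self_of_mem hh₂]
    have h2 := norm_sub_sq_le_of_unitary hu₂ hh₂
    have h3 := endInner_le_finrank_of_unitary hu₁ hh₁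
    simp only [pairInner] at hlt'
    rw [h1, CStarRing.norm_mul_mem_unitary _ (Unitary.star_mem hh₂)]
    exact lt_of_pow_lt_pow_left₀ 2 hδ.le (by linarith)
  have hX0 : X = 0 := by
    refine huniq (bilAct h.1 h.2 l₁) X ?_ (max_lt hbound₁ hbound₂)
      (bilAct_mem_normalSlice_of_unitary hh₁ hh₂ hhκ hl₁) ?_ (fun Y hY => ?_) ?_
    · have h1 := norm_bilAct_le hh₁ hh₂ (l₁ - κ)
      rw [bilAct_sub, hhκ] at h1
      exact h1.trans_lt (hd₁.trans_le (min_le_left _ _))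
    · rw [hact]
      exact hl₂
    · have h1 := endInner_add_eq_zero_of_isMaxOn ⟨hh₁, hh₂, hhκ⟩ hmax hY
      rw [endInner_sub_left, endInner_sub_left, endInner_one_left, endInner_one_left,
        trace_eq_zero_of_star_eq_neg hY.1, trace_eq_zero_of_star_eq_neg hY.2.1]
      linarith
    · rw [hX₁, endInner_self_of_mem_unitary hsu]
  rw [← hact, hX0, hhκ]
  simp

/-- Two points of the normal slice near `κ` in the same orbit are related only by pairs that
fix `κ`. -/
theorem exists_bilAct_eq (hκ : CentralMoment κ) (hκ' : SymmStabilizerTrivial κ) :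
    ∃ ε > 0, ∀ (l₁ l₂ : V₁ →L[ℝ] V₁ →L[ℝ] V₂) (A : V₁ →L[ℝ] V₁) (B : V₂ →L[ℝ] V₂),
      IsUnit A → IsUnit B → l₁ ∈ normalSlice κ → l₂ ∈ normalSlice κ → ‖l₁ - κ‖ < ε →
      ‖l₂ - κ‖ < ε → bilAct A B l₁ = l₂ → bilAct A B κ = κ := by
  obtain ⟨ε₁, hε₁, h₁⟩ := exists_bilAct_eq_of_unitary hκ hκ'
  have h₀ := eventually_symmStabilizerTrivial hκ'
  obtain ⟨ε₂, hε₂, h₂⟩ := (Metric.eventually_nhds_iff (α := V₁ →L[ℝ] V₁ →L[ℝ] V₂)).1 h₀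
  refine ⟨min ε₁ ε₂, lt_min hε₁ hε₂, fun l₁ l₂ A B hA hB hl₁ hl₂ hd₁ hd₂ h => ?_⟩
  obtain ⟨U₁, hU₁, U₂, hU₂, hU⟩ := exists_unitary_of_mem_normalSlice hκ hl₁ hl₂
    (h₂ ((dist_eq_norm (E := V₁ →L[ℝ] V₁ →L[ℝ] V₂) l₁ κ).trans_lt
      (hd₁.trans_le (min_le_right _ _)))) hA hB h
  rw [hU] at h ⊢
  exact h₁ l₁ (U₁, U₂) hU₁ hU₂ hl₁ (by rw [h]; exact hl₂) (hd₁.trans_le (min_le_left _ _))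
    (by rw [h]; exact hd₂.trans_le (min_le_left _ _))

end OrbitUniqueness

/-! ### The locally unique standard bracket attached to a bracket -/

section StandardPairs

variable {V₁ V₂ : Type*} [NormedAddCommGroup V₁] [InnerProductSpace ℝ V₁] [FiniteDimensional ℝ V₁]
  [NormedAddCommGroup V₂] [InnerProductSpace ℝ V₂] [FiniteDimensional ℝ V₂]
  {κ : V₁ →L[ℝ] V₁ →L[ℝ] V₂} {ε : ℝ}

/-- A change of frame takes `k` to `κ` and `l` into the normal slice of `κ`. -/
def NormalPair (κ k l : V₁ →L[ℝ] V₁ →L[ℝ] V₂) : Prop :=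
  ∃ A B, IsUnit A ∧ IsUnit B ∧ bilAct A B k = κ ∧ bilAct A B l ∈ normalSlice κ

/-- A change of frame takes `k` to `κ` and `l` to a point of the normal slice at distance less than
`ε` from `κ`. -/
def NearNormalPair (κ : V₁ →L[ℝ] V₁ →L[ℝ] V₂) (ε : ℝ) (k l : V₁ →L[ℝ] V₁ →L[ℝ] V₂) : Prop :=
  ∃ A B, IsUnit A ∧ IsUnit B ∧ bilAct A B k = κ ∧ bilAct A B l ∈ normalSlice κ ∧
    ‖bilAct A B l - κ‖ < ε

theorem NearNormalPair.normalPair {k l : V₁ →L[ℝ] V₁ →L[ℝ] V₂} (h : NearNormalPair κ ε k l) :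
    NormalPair κ k l :=
  let ⟨A, B, hA, hB, hk, hl, _⟩ := h
  ⟨A, B, hA, hB, hk, hl⟩

theorem norm_sub_self_lt (hε : 0 < ε) (l : V₁ →L[ℝ] V₁ →L[ℝ] V₂) : ‖l - l‖ < ε := by
  have h := norm_zero (E := V₁ →L[ℝ] V₁ →L[ℝ] V₂)
  rw [sub_self]
  exact h.trans_lt hε

theorem nearNormalPair_self (hε : 0 < ε) : NearNormalPair κ ε κ κ :=
  ⟨1, 1, isUnit_one, isUnit_one, bilAct_one κ, self_mem_normalSlice κ, norm_sub_self_lt hε κ⟩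

theorem exists_bilAct_inverse {A : V₁ →L[ℝ] V₁} {B : V₂ →L[ℝ] V₂} (hA : IsUnit A)
    (hB : IsUnit B) : ∃ A' B', IsUnit A' ∧ IsUnit B' ∧
      (∀ l : V₁ →L[ℝ] V₁ →L[ℝ] V₂, bilAct A' B' (bilAct A B l) = l) ∧
      ∀ l : V₁ →L[ℝ] V₁ →L[ℝ] V₂, bilAct A B (bilAct A' B' l) = l := by
  obtain ⟨A, rfl⟩ := hA
  obtain ⟨B, rfl⟩ := hB
  refine ⟨(A⁻¹ : (V₁ →L[ℝ] V₁)ˣ), (B⁻¹ : (V₂ →L[ℝ] V₂)ˣ), Units.isUnit _, Units.isUnit _,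
    fun l => ?_, fun l => ?_⟩
  · rw [bilAct_bilAct, Units.mul_inv, Units.inv_mul, bilAct_one]
  · rw [bilAct_bilAct, Units.mul_inv, Units.inv_mul, bilAct_one]

theorem nearNormalPair_bilAct {k l : V₁ →L[ℝ] V₁ →L[ℝ] V₂} (h : NearNormalPair κ ε k l)
    {A : V₁ →L[ℝ] V₁} {B : V₂ →L[ℝ] V₂} (hA : IsUnit A) (hB : IsUnit B) :
    NearNormalPair κ ε (bilAct A B k) (bilAct A B l) := by
  obtain ⟨A', B', hA', hB', h1, -⟩ := exists_bilAct_inverse (V₁ := V₁) (V₂ := V₂) hA hB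
  obtain ⟨A₀, B₀, hA₀, hB₀, hk, hl, hl'⟩ := h
  refine ⟨A' * A₀, B₀ * B', hA'.mul hA₀, hB₀.mul hB', ?_, ?_, ?_⟩
  · rw [← bilAct_bilAct, h1, hk]
  · rw [← bilAct_bilAct, h1]
    exact hl
  · rw [← bilAct_bilAct, h1]
    exact hl'

/-- `k` is alternating if `κ` is, being in its orbit. -/
theorem NearNormalPair.apply_self {k l : V₁ →L[ℝ] V₁ →L[ℝ] V₂} (h : NearNormalPair κ ε k l)
    (hκ : ∀ v, κ v v = 0) (v : V₁) : k v v = 0 := by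
  obtain ⟨A, B, hA, hB, hk, -⟩ := h
  obtain ⟨A', B', hA', hB', h1, -⟩ := exists_bilAct_inverse (V₁ := V₁) (V₂ := V₂) hA hB
  rw [← h1 k, hk, bilAct_apply, hκ, map_zero]

theorem continuous_bilAct_prod : Continuous
    fun p : ((V₁ →L[ℝ] V₁) × (V₂ →L[ℝ] V₂)) × (V₁ →L[ℝ] V₁ →L[ℝ] V₂) =>
      bilAct p.1.1 p.1.2 p.2 := by
  refine continuous_clm_apply.2 fun x => continuous_clm_apply.2 fun y => ?_
  simp only [bilAct_apply]
  fun_prop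

theorem continuous_bilAct_right (A : V₁ →L[ℝ] V₁) (B : V₂ →L[ℝ] V₂) :
    Continuous fun l : V₁ →L[ℝ] V₁ →L[ℝ] V₂ => bilAct A B l :=
  continuous_bilAct_prod.comp (Continuous.prodMk_right (A, B))

variable [CompleteSpace V₁] [CompleteSpace V₂] [Nontrivial V₁]

theorem exists_isUnit_one_add (V : Type*) [NormedAddCommGroup V] [NormedSpace ℝ V]
    [CompleteSpace V] : ∃ δ > 0, ∀ X : V →L[ℝ] V, ‖X‖ < δ → IsUnit (1 + X) := by
  refine ⟨1, one_pos, fun X hX => ?_⟩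
  have := isUnit_one_sub_of_norm_lt_one (x := -X) (by rwa [norm_neg])
  rwa [sub_neg_eq_add] at this

/-- A radius `ε` such that, within distance `ε` of `κ`, points of the normal slice in the same orbit
are related by the stabiliser of `κ` only, and all maps near a point of the normal slice can be
moved into it by invertible pairs close to the identity. -/
def IsSliceRadius (κ : V₁ →L[ℝ] V₁ →L[ℝ] V₂) (ε : ℝ) : Prop :=
  0 < ε ∧
  (∀ (l₁ l₂ : V₁ →L[ℝ] V₁ →L[ℝ] V₂) (A : V₁ →L[ℝ] V₁) (B : V₂ →L[ℝ] V₂),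
    IsUnit A → IsUnit B → l₁ ∈ normalSlice κ → l₂ ∈ normalSlice κ → ‖l₁ - κ‖ < ε →
    ‖l₂ - κ‖ < ε → bilAct A B l₁ = l₂ → bilAct A B κ = κ) ∧
  ∀ l₀ : V₁ →L[ℝ] V₁ →L[ℝ] V₂, l₀ ∈ normalSlice κ → ‖l₀ - κ‖ < ε → ∀ δ > 0,
    ∀ᶠ l in 𝓝 l₀, ∃ X : (V₁ →L[ℝ] V₁) × (V₂ →L[ℝ] V₂), ‖X‖ < δ ∧
      IsUnit (1 + X.1) ∧ IsUnit (1 + X.2) ∧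
      bilAct (1 + X.1) (1 + X.2) l ∈ normalSlice κ ∧
      ‖bilAct (1 + X.1) (1 + X.2) l - κ‖ < ε

theorem exists_isSliceRadius (hκ : CentralMoment κ) (hκ' : SymmStabilizerTrivial κ) :
    ∃ ε, IsSliceRadius κ ε := by
  obtain ⟨ε₁, hε₁, h₁⟩ := exists_bilAct_eq hκ hκ'
  have h₀ := exists_eventually_bilAct_mem_normalSlice hκ hκ'
  obtain ⟨ε₂, hε₂, h₂⟩ := (Metric.eventually_nhds_iff (α := V₁ →L[ℝ] V₁ →L[ℝ] V₂)).1 h₀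
  refine ⟨min ε₁ ε₂, lt_min hε₁ hε₂, fun l₁ l₂ A B hA hB hl₁ hl₂ hd₁ hd₂ =>
    h₁ l₁ l₂ A B hA hB hl₁ hl₂ (hd₁.trans_le (min_le_left _ _)) (hd₂.trans_le (min_le_left _ _)),
    fun l₀ hl₀ hd δ hδ => ?_⟩
  have hcont : ContinuousAt
      (fun p : ((V₁ →L[ℝ] V₁) × (V₂ →L[ℝ] V₂)) × (V₁ →L[ℝ] V₁ →L[ℝ] V₂) =>
        ‖bilAct (1 + p.1.1) (1 + p.1.2) p.2 - κ‖) (0, l₀) := by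
    have h3 : Continuous
        fun p : ((V₁ →L[ℝ] V₁) × (V₂ →L[ℝ] V₂)) × (V₁ →L[ℝ] V₁ →L[ℝ] V₂) =>
          (((1 + p.1.1, 1 + p.1.2), p.2) :
            ((V₁ →L[ℝ] V₁) × (V₂ →L[ℝ] V₂)) × (V₁ →L[ℝ] V₁ →L[ℝ] V₂)) := by fun_prop
    exact ((continuous_norm (E := V₁ →L[ℝ] V₁ →L[ℝ] V₂)).comp
      ((continuous_bilAct_prod.comp h3).sub continuous_const)).continuousAt
  have hlt : ∀ᶠ p : ((V₁ →L[ℝ] V₁) × (V₂ →L[ℝ] V₂)) × (V₁ →L[ℝ] V₁ →L[ℝ] V₂) in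
      𝓝 0 ×ˢ 𝓝 l₀, ‖bilAct (1 + p.1.1) (1 + p.1.2) p.2 - κ‖ < min ε₁ ε₂ := by
    rw [← nhds_prod_eq]
    refine hcont.eventually_lt continuousAt_const ?_
    simpa using hd
  obtain ⟨P, hP, Q, hQ, hPQ⟩ := Filter.eventually_prod_iff.1 hlt
  obtain ⟨δ', hδ', hP⟩ := Metric.eventually_nhds_iff.1 hP
  obtain ⟨r₁, hr₁, hu₁⟩ := exists_isUnit_one_add V₁
  obtain ⟨r₂, hr₂, hu₂⟩ := exists_isUnit_one_add V₂
  have h4 := h₂ ((dist_eq_norm (E := V₁ →L[ℝ] V₁ →L[ℝ] V₂) l₀ κ).trans_lt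
    (hd.trans_le (min_le_right _ _))) hl₀ (min δ (min δ' (min r₁ r₂))) (by positivity)
  refine (h4.and hQ).mono fun l hl => ?_
  obtain ⟨⟨X, hX, hmem⟩, hQl⟩ := hl
  have hX' := lt_min_iff.1 (lt_min_iff.1 (lt_min_iff.1 hX).2).2
  refine ⟨X, (lt_min_iff.1 hX).1, hu₁ _ ((norm_fst_le X).trans_lt hX'.1),
    hu₂ _ ((norm_snd_le X).trans_lt hX'.2), hmem, ?_⟩
  exact hPQ (hP (by simpa using (lt_min_iff.1 (lt_min_iff.1 hX).2).1)) hQl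

/-- The standard bracket attached to a bracket is unique. -/
theorem NearNormalPair.unique (hε : IsSliceRadius κ ε)
    {k k' l : V₁ →L[ℝ] V₁ →L[ℝ] V₂} (h : NearNormalPair κ ε k l) (h' : NearNormalPair κ ε k' l) :
    k = k' := by
  obtain ⟨A, B, hA, hB, hk, hl, hd⟩ := h
  obtain ⟨A', B', hA', hB', hk', hl', hd'⟩ := h'
  obtain ⟨A₁, B₁, hA₁, hB₁, h1, h2⟩ := exists_bilAct_inverse (V₁ := V₁) (V₂ := V₂) hA hB
  obtain ⟨A₂, B₂, hA₂, hB₂, h3, h4⟩ := exists_bilAct_inverse (V₁ := V₁) (V₂ := V₂) hA' hB'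
  have h5 := hε.2.1 _ (bilAct A' B' l) (A₁ * A') (B' * B₁) (hA₁.mul hA') (hB'.mul hB₁) hl hl' hd hd'
    (by rw [← bilAct_bilAct, h1])
  rw [← bilAct_bilAct, ← hk, h1] at h5
  rw [← h3 k, h5, hk, ← hk', h3]

theorem continuousAt_inverse_one_add (V : Type*) [NormedAddCommGroup V] [NormedSpace ℝ V]
    [CompleteSpace V] : ContinuousAt (fun X : V →L[ℝ] V => Ring.inverse (1 + X)) 0 := by
  have h3 : ContinuousAt Ring.inverse (1 + 0 : V →L[ℝ] V) := by
    simpa using NormedRing.inverse_continuousAt (1 : (V →L[ℝ] V)ˣ)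
  exact ContinuousAt.comp (f := fun X : V →L[ℝ] V => 1 + X) h3
    (continuous_const.add continuous_id).continuousAt

theorem continuousAt_bilAct_inverse (A' : V₁ →L[ℝ] V₁) (B' : V₂ →L[ℝ] V₂)
    (κ : V₁ →L[ℝ] V₁ →L[ℝ] V₂) :
    ContinuousAt (fun X : (V₁ →L[ℝ] V₁) × (V₂ →L[ℝ] V₂) =>
      bilAct (Ring.inverse (1 + X.1) * A') (B' * Ring.inverse (1 + X.2)) κ) 0 := by
  have h3 : ContinuousAt (fun X : (V₁ →L[ℝ] V₁) × (V₂ →L[ℝ] V₂) => Ring.inverse (1 + X.1)) 0 :=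
    (continuousAt_inverse_one_add V₁).comp_of_eq continuousAt_fst rfl
  have h4 : ContinuousAt (fun X : (V₁ →L[ℝ] V₁) × (V₂ →L[ℝ] V₂) => Ring.inverse (1 + X.2)) 0 :=
    (continuousAt_inverse_one_add V₂).comp_of_eq continuousAt_snd rfl
  have h5 : ContinuousAt (fun X : (V₁ →L[ℝ] V₁) × (V₂ →L[ℝ] V₂) =>
      ((Ring.inverse (1 + X.1) * A', B' * Ring.inverse (1 + X.2)) :
        (V₁ →L[ℝ] V₁) × (V₂ →L[ℝ] V₂))) 0 :=
    (h3.mul continuousAt_const).prodMk (continuousAt_const.mul h4)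
  exact ContinuousAt.comp (x := 0) (continuous_bilAct κ).continuousAt h5

/-- The standard bracket attached to a bracket exists for all nearby brackets, and close to the
given one. -/
theorem NearNormalPair.eventually_exists (hε : IsSliceRadius κ ε)
    {k₀ l₀ : V₁ →L[ℝ] V₁ →L[ℝ] V₂} (h : NearNormalPair κ ε k₀ l₀)
    {N : Set (V₁ →L[ℝ] V₁ →L[ℝ] V₂)} (hN : N ∈ 𝓝 k₀) :
    ∀ᶠ l in 𝓝 l₀, ∃ k ∈ N, NearNormalPair κ ε k l := by
  obtain ⟨A, B, hA, hB, hk, hl, hd⟩ := h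
  obtain ⟨A', B', hA', hB', h1, h2⟩ := exists_bilAct_inverse (V₁ := V₁) (V₂ := V₂) hA hB
  -- the standard bracket attached to `l` is the image of `κ` under this pair
  let f : (V₁ →L[ℝ] V₁) × (V₂ →L[ℝ] V₂) → (V₁ →L[ℝ] V₁ →L[ℝ] V₂) := fun X =>
    bilAct (Ring.inverse (1 + X.1) * A') (B' * Ring.inverse (1 + X.2)) κ
  have hf0 : f 0 = k₀ := by
    rw [← h1 k₀, hk]
    simp [f]
  have hf : ContinuousAt f 0 := continuousAt_bilAct_inverse A' B' κ
  have hfN : ∀ᶠ X in 𝓝 (0 : (V₁ →L[ℝ] V₁) × (V₂ →L[ℝ] V₂)), f X ∈ N :=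
    hf.eventually (by rw [hf0]; exact hN)
  obtain ⟨δ, hδ, hfδ⟩ := Metric.eventually_nhds_iff.1 hfN
  have h4 := (continuous_bilAct_right A B).continuousAt.eventually (hε.2.2 _ hl hd δ hδ)
  refine h4.mono fun l hl => ?_
  obtain ⟨X, hX, hX₁, hX₂, hmem, hnorm⟩ := hl
  refine ⟨f X, hfδ (by simpa using hX), A * (1 + X.1), (1 + X.2) * B, hA.mul hX₁, hX₂.mul hB,
    ?_, by rwa [← bilAct_bilAct], by rwa [← bilAct_bilAct]⟩
  rw [← bilAct_bilAct]
  simp only [f]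
  rw [← bilAct_bilAct _ _ B', h2, bilAct_bilAct, Ring.inverse_mul_cancel _ hX₁,
    Ring.mul_inverse_cancel _ hX₂, bilAct_one]

/-- Near a pair `(k₀, l₀)` all normal pairs are near normal pairs: if `k` is close to `k₀` and in
the orbit of `κ`, the change of frame from `k` to `κ` can be chosen close to the one for `k₀`, and
the stabiliser of `κ` preserves the normal slice. -/
theorem NearNormalPair.exists_nhds (hκ : CentralMoment κ) (hκ' : SymmStabilizerTrivial κ)
    (hε : IsSliceRadius κ ε)
    {k₀ l₀ : V₁ →L[ℝ] V₁ →L[ℝ] V₂} (h : NearNormalPair κ ε k₀ l₀) :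
    ∃ N ∈ 𝓝 k₀, ∃ M ∈ 𝓝 l₀, ∀ k ∈ N, ∀ l ∈ M, NormalPair κ k l → NearNormalPair κ ε k l := by
  obtain ⟨A, B, hA, hB, hk, hl, hd⟩ := h
  have hcont : ContinuousAt
      (fun p : ((V₁ →L[ℝ] V₁) × (V₂ →L[ℝ] V₂)) × (V₁ →L[ℝ] V₁ →L[ℝ] V₂) =>
        ‖bilAct (A * (1 + p.1.1)) ((1 + p.1.2) * B) p.2 - κ‖) (0, l₀) := by
    have h3 : Continuous
        fun p : ((V₁ →L[ℝ] V₁) × (V₂ →L[ℝ] V₂)) × (V₁ →L[ℝ] V₁ →L[ℝ] V₂) =>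
          (((A * (1 + p.1.1), (1 + p.1.2) * B), p.2) :
            ((V₁ →L[ℝ] V₁) × (V₂ →L[ℝ] V₂)) × (V₁ →L[ℝ] V₁ →L[ℝ] V₂)) := by fun_prop
    exact ((continuous_norm (E := V₁ →L[ℝ] V₁ →L[ℝ] V₂)).comp
      ((continuous_bilAct_prod.comp h3).sub continuous_const)).continuousAt
  have hlt : ∀ᶠ p : ((V₁ →L[ℝ] V₁) × (V₂ →L[ℝ] V₂)) × (V₁ →L[ℝ] V₁ →L[ℝ] V₂) in
      𝓝 0 ×ˢ 𝓝 l₀, ‖bilAct (A * (1 + p.1.1)) ((1 + p.1.2) * B) p.2 - κ‖ < ε := by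
    rw [← nhds_prod_eq]
    refine hcont.eventually_lt continuousAt_const ?_
    simpa using hd
  obtain ⟨P, hP, Q, hQ, hPQ⟩ := Filter.eventually_prod_iff.1 hlt
  obtain ⟨δ, hδ, hP⟩ := Metric.eventually_nhds_iff.1 hP
  have h4 := hε.2.2 κ (self_mem_normalSlice κ) (norm_sub_self_lt hε.1 κ) δ hδ
  rw [← hk] at h4
  refine ⟨_, (continuous_bilAct_right A B).continuousAt.eventually h4, _, hQ,
    fun k hkN l hlM hkl => ?_⟩
  rw [hk] at hkN
  obtain ⟨X, hX, hX₁, hX₂, hmem, hnorm⟩ := hkN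
  obtain ⟨A₁, B₁, hA₁, hB₁, hk₁, hl₁⟩ := hkl
  rw [bilAct_bilAct] at hmem hnorm
  have hA₂ := hA.mul hX₁
  have hB₂ := hX₂.mul hB
  obtain ⟨A', B', hA', hB', h5, h6⟩ := exists_bilAct_inverse (V₁ := V₁) (V₂ := V₂) hA₂ hB₂
  obtain ⟨A₃, B₃, hA₃, hB₃, h7, h8⟩ := exists_bilAct_inverse (V₁ := V₁) (V₂ := V₂) hA₁ hB₁
  have h9 := hε.2.1 _ κ (A' * A₁) (B₁ * B') (hA'.mul hA₁) (hB₁.mul hB') hmem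
    (self_mem_normalSlice κ) hnorm (norm_sub_self_lt hε.1 κ) (by rw [← bilAct_bilAct, h5, hk₁])
  rw [← bilAct_bilAct] at h9
  have h10 : bilAct (A₃ * (A * (1 + X.1))) (((1 + X.2) * B) * B₃) κ = κ := by
    conv_lhs => rw [← h9]
    rw [← bilAct_bilAct, h7, h6]
  refine ⟨_, _, hA₂, hB₂, ?_, ?_, hPQ (hP (by simpa using hX)) hlM⟩
  · rw [← h7 k, hk₁, bilAct_bilAct, h10]
  · have := bilAct_mem_normalSlice hκ hκ' (hA₃.mul hA₂) (hB₂.mul hB₃) h10 hl₁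
    rwa [← bilAct_bilAct, h7] at this

end StandardPairs

/-! ### Changes of adapted frames -/

namespace TangentDistribution.AdaptedFrame

variable {E : Type*} [NormedAddCommGroup E] [NormedSpace ℝ E]
  {X : Type*} [TopologicalSpace X] [ChartedSpace E X] [IsManifold 𝓘(ℝ, E) ∞ X] {r : ℕ}
  {D : TangentDistribution E X r}
  {V₁ V₂ : Type*} [NormedAddCommGroup V₁] [InnerProductSpace ℝ V₁]
  [NormedAddCommGroup V₂] [InnerProductSpace ℝ V₂] {x : X}

theorem coe_horizontal (p : D.AdaptedFrame V₁ V₂ x) (v : V₁) :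
    (p.horizontal v : TangentSpace 𝓘(ℝ, E) x) = p.toLin (v, 0) :=
  rfl

theorem vertical_mkQ (p : D.AdaptedFrame V₁ V₂ x) (w : TangentSpace 𝓘(ℝ, E) x) :
    p.vertical ((D.space x).mkQ w) = (p.toLin.symm w).2 :=
  rfl

theorem horizontal_bijective (p : D.AdaptedFrame V₁ V₂ x) : Function.Bijective p.horizontal := by
  constructor
  · intro v w h
    have h1 : p.toLin (v, 0) = p.toLin (w, 0) := congrArg Subtype.val h
    exact congrArg Prod.fst (p.toLin.injective h1)
  · intro u
    have h1 := p.mem_iff (p.toLin.symm u)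
    rw [LinearEquiv.apply_symm_apply] at h1
    have h2 : ((p.toLin.symm u).1, (0 : V₂)) = p.toLin.symm u := Prod.ext rfl (h1.1 u.2).symm
    refine ⟨(p.toLin.symm u).1, Subtype.ext ?_⟩
    rw [coe_horizontal, h2, LinearEquiv.apply_symm_apply]

theorem vertical_bijective (p : D.AdaptedFrame V₁ V₂ x) : Function.Bijective p.vertical := by
  constructor
  · rw [injective_iff_map_eq_zero]
    intro q hq
    obtain ⟨w, rfl⟩ := (D.space x).mkQ_surjective q
    rw [vertical_mkQ] at hq
    have h1 := (p.mem_iff (p.toLin.symm w)).2 hq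
    rw [LinearEquiv.apply_symm_apply] at h1
    rwa [Submodule.mkQ_apply, Submodule.Quotient.mk_eq_zero]
  · intro z
    exact ⟨(D.space x).mkQ (p.toLin (0, z)), by rw [vertical_mkQ, LinearEquiv.symm_apply_apply]⟩

variable [FiniteDimensional ℝ V₁]

theorem coords_apply (p : D.AdaptedFrame V₁ V₂ x) (B : D.Bracket x) (v w : V₁) :
    (p.coords B).1 v w = p.vertical (B.1 (p.horizontal v) (p.horizontal w)) :=
  rfl

theorem coords_injective (p : D.AdaptedFrame V₁ V₂ x) :
    Function.Injective (p.coords : D.Bracket x → FormalBracket V₁ V₂) := by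
  intro B B' h
  refine Subtype.ext (LinearMap.ext fun u => LinearMap.ext fun u' => ?_)
  obtain ⟨v, rfl⟩ := p.horizontal_bijective.2 u
  obtain ⟨w, rfl⟩ := p.horizontal_bijective.2 u'
  apply p.vertical_bijective.1
  rw [← coords_apply, h, coords_apply]

theorem coords_surjective (p : D.AdaptedFrame V₁ V₂ x) :
    Function.Surjective (p.coords : D.Bracket x → FormalBracket V₁ V₂) := by
  intro l
  let h := LinearEquiv.ofBijective p.horizontal p.horizontal_bijective
  let v := LinearEquiv.ofBijective p.vertical p.vertical_bijective
  let b : V₁ →ₗ[ℝ] V₁ →ₗ[ℝ] V₂ := LinearMap.mk₂ ℝ (fun x y => l.1 x y)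
    (fun _ _ _ => by simp) (fun _ _ _ => by simp) (fun _ _ _ => by simp) (fun _ _ _ => by simp)
  refine ⟨⟨(b.compl₁₂ h.symm.toLinearMap h.symm.toLinearMap).compr₂ v.symm.toLinearMap,
    fun u => ?_⟩, ?_⟩
  · simp [LinearMap.compr₂_apply, LinearMap.compl₁₂_apply, b, l.2 (h.symm u)]
  · refine Subtype.ext (ContinuousLinearMap.ext fun y => ContinuousLinearMap.ext fun z => ?_)
    rw [coords_apply]
    have h1 : ∀ y, h.symm (p.horizontal y) = y := fun y => h.symm_apply_apply y
    have h2 : ∀ y, p.vertical (v.symm y) = y := fun y => v.apply_symm_apply y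
    simp [LinearMap.compr₂_apply, LinearMap.compl₁₂_apply, b, h1, h2]

theorem isUnit_toContinuousLinearMap {V : Type*} [NormedAddCommGroup V] [NormedSpace ℝ V]
    [FiniteDimensional ℝ V] (e : V ≃ₗ[ℝ] V) :
    IsUnit (LinearMap.toContinuousLinearMap e.toLinearMap) := by
  refine ⟨⟨LinearMap.toContinuousLinearMap e.toLinearMap,
    LinearMap.toContinuousLinearMap e.symm.toLinearMap, ?_, ?_⟩, rfl⟩
  · ext v
    exact e.apply_symm_apply v
  · ext v
    exact e.symm_apply_apply v

variable [FiniteDimensional ℝ V₂]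

/-- Expressions of brackets in two adapted frames are related by the action of
`GL(V₁) × GL(V₂)`. -/
theorem exists_coords_eq_bilAct (p q : D.AdaptedFrame V₁ V₂ x) :
    ∃ A B, IsUnit A ∧ IsUnit B ∧ ∀ K : D.Bracket x, (q.coords K).1 = bilAct A B (p.coords K).1 := by
  let h := LinearEquiv.ofBijective p.horizontal p.horizontal_bijective
  let v := LinearEquiv.ofBijective p.vertical p.vertical_bijective
  let h' := LinearEquiv.ofBijective q.horizontal q.horizontal_bijective
  let v' := LinearEquiv.ofBijective q.vertical q.vertical_bijective
  refine ⟨_, _, isUnit_toContinuousLinearMap (h'.trans h.symm),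
    isUnit_toContinuousLinearMap (v.symm.trans v'), fun K => ?_⟩
  ext y z
  rw [bilAct_apply, coords_apply, coords_apply]
  have h1 : ∀ y, p.horizontal (h.symm y) = y := fun y => h.apply_symm_apply y
  have h2 : ∀ y, v.symm (p.vertical y) = y := fun y => v.symm_apply_apply y
  simp only [LinearMap.coe_toContinuousLinearMap', LinearEquiv.coe_coe, LinearEquiv.trans_apply,
    h1, h2]
  rfl

/-- Every element of `GL(V₁) × GL(V₂)` is the change between a given and some other adapted
frame. -/
theorem exists_adaptedFrame_of_isUnit (p : D.AdaptedFrame V₁ V₂ x) {A : V₁ →L[ℝ] V₁}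
    {B : V₂ →L[ℝ] V₂} (hA : IsUnit A) (hB : IsUnit B) :
    ∃ q : D.AdaptedFrame V₁ V₂ x, ∀ K : D.Bracket x,
      (q.coords K).1 = bilAct A B (p.coords K).1 := by
  obtain ⟨A, rfl⟩ := hA
  obtain ⟨B, rfl⟩ := hB
  let a : V₁ ≃ₗ[ℝ] V₁ := (ContinuousLinearEquiv.ofUnit A).toLinearEquiv
  let b : V₂ ≃ₗ[ℝ] V₂ := (ContinuousLinearEquiv.ofUnit B).toLinearEquiv
  refine ⟨⟨(a.prodCongr b.symm).trans p.toLin, fun v => ?_⟩, fun K => ?_⟩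
  · simp [p.mem_iff]
  · ext y z
    rw [bilAct_apply, coords_apply, coords_apply]
    obtain ⟨w, hw⟩ := (D.space x).mkQ_surjective (K.1 (p.horizontal (A.1 y)) (p.horizontal (A.1 z)))
    rw [← hw]
    have h1 : ∀ y, horizontal ⟨(a.prodCongr b.symm).trans p.toLin, by simp [p.mem_iff]⟩ y =
        p.horizontal (A.1 y) := by
      intro y
      apply Subtype.ext
      simp [coe_horizontal, a]
      rfl
    rw [h1, h1, ← hw, vertical_mkQ, vertical_mkQ]
    rfl

end TangentDistribution.AdaptedFrame

/-! ### The codifferential as a moment map -/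

section Codifferential

variable {V₁ V₂ : Type*} [NormedAddCommGroup V₁] [InnerProductSpace ℝ V₁] [FiniteDimensional ℝ V₁]
  [NormedAddCommGroup V₂] [InnerProductSpace ℝ V₂]

theorem FormalBracket.inner_alpha (N M : FormalBracket V₁ V₂) (x y : V₁) :
    ⟪FormalBracket.alpha N M x, y⟫_ℝ =
      ∑ i, ⟪M.1 (stdOrthonormalBasis ℝ V₁ i) y, N.1 (stdOrthonormalBasis ℝ V₁ i) x⟫_ℝ := by
  simp only [FormalBracket.alpha, LinearMap.sum_apply, LinearMap.smulRight_apply,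
    LinearMap.comp_apply, innerₗ_apply_apply, ContinuousLinearMap.coe_coe, sum_inner,
    inner_smul_left, RCLike.conj_to_real]
  refine Finset.sum_congr rfl fun i _ => ?_
  conv_rhs => rw [← (stdOrthonormalBasis ℝ V₁).sum_repr' y]
  simp only [map_sum, map_smul, sum_inner, inner_smul_left, RCLike.conj_to_real]
  exact Finset.sum_congr rfl fun j _ => mul_comm _ _

theorem FormalBracket.inner_beta (N M : FormalBracket V₁ V₂) (z w : V₂) :
    ⟪FormalBracket.beta N M z, w⟫_ℝ =
      -(1 / 2) * ∑ i, ∑ j,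
        ⟪N.1 (stdOrthonormalBasis ℝ V₁ i) (stdOrthonormalBasis ℝ V₁ j), z⟫_ℝ *
        ⟪M.1 (stdOrthonormalBasis ℝ V₁ i) (stdOrthonormalBasis ℝ V₁ j), w⟫_ℝ := by
  simp only [FormalBracket.beta, LinearMap.smul_apply, LinearMap.sum_apply,
    LinearMap.smulRight_apply, innerₗ_apply_apply, sum_inner,
    inner_smul_left, RCLike.conj_to_real]

theorem FormalBracket.alpha_isSymmetric_iff (N M : FormalBracket V₁ V₂) :
    (FormalBracket.alpha N M).IsSymmetric ↔ FormalBracket.alpha M N = FormalBracket.alpha N M := by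
  have h : ∀ x y, ⟪x, FormalBracket.alpha N M y⟫_ℝ = ⟪FormalBracket.alpha M N x, y⟫_ℝ := by
    intro x y
    rw [real_inner_comm, FormalBracket.inner_alpha, FormalBracket.inner_alpha]
    exact Finset.sum_congr rfl fun i _ => real_inner_comm _ _
  constructor
  · intro hs
    refine LinearMap.ext fun x => ext_inner_right ℝ fun y => ?_
    rw [hs x y, h]
  · intro hs x y
    rw [h, hs]

theorem FormalBracket.beta_isSymmetric_iff (N M : FormalBracket V₁ V₂) :
    (FormalBracket.beta N M).IsSymmetric ↔ FormalBracket.beta M N = FormalBracket.beta N M := by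
  have h : ∀ x y, ⟪x, FormalBracket.beta N M y⟫_ℝ = ⟪FormalBracket.beta M N x, y⟫_ℝ := by
    intro x y
    rw [real_inner_comm, FormalBracket.inner_beta, FormalBracket.inner_beta]
    simp only [mul_comm]
  constructor
  · intro hs
    refine LinearMap.ext fun x => ext_inner_right ℝ fun y => ?_
    rw [hs x y, h]
  · intro hs x y
    rw [h, hs]

theorem FormalBracket.apply_swap (l : FormalBracket V₁ V₂) (x y : V₁) : l.1 x y = -l.1 y x := by
  have h := l.2 (x + y)
  simp only [map_add, add_apply, l.2 x, l.2 y, zero_add, add_zero] at h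
  exact eq_neg_of_add_eq_zero_right h

variable [FiniteDimensional ℝ V₂] [CompleteSpace V₁] [CompleteSpace V₂]

/-- The codifferential is the (polarised) moment map of the action of `GL(V₁) × GL(V₂)`. -/
theorem FormalBracket.bilInner_bilInf (l m : FormalBracket V₁ V₂) (a : V₁ →L[ℝ] V₁)
    (b : V₂ →L[ℝ] V₂) :
    bilInner (bilInf a b l.1) m.1 =
      2 * (endInner (LinearMap.toContinuousLinearMap (FormalBracket.alpha m l)) a -
        endInner (LinearMap.toContinuousLinearMap (FormalBracket.beta m l)) (star b)) := by
  set e := stdOrthonormalBasis ℝ V₁ with he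
  have h1 : endInner (LinearMap.toContinuousLinearMap (FormalBracket.alpha m l)) a =
      ∑ i, ∑ j, ⟪l.1 (e i) (a (e j)), m.1 (e i) (e j)⟫_ℝ := by
    simp only [endInner, LinearMap.coe_toContinuousLinearMap', FormalBracket.inner_alpha]
    rw [Finset.sum_comm]
  have h2 : endInner (LinearMap.toContinuousLinearMap (FormalBracket.beta m l)) (star b) =
      -(1 / 2) * ∑ i, ∑ j, ⟪b (l.1 (e i) (e j)), m.1 (e i) (e j)⟫_ℝ := by
    simp only [endInner, LinearMap.coe_toContinuousLinearMap', FormalBracket.inner_beta,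
      ← Finset.mul_sum]
    congr 1
    rw [Finset.sum_comm]
    refine Finset.sum_congr rfl fun i _ => ?_
    rw [Finset.sum_comm]
    refine Finset.sum_congr rfl fun j _ => ?_
    rw [← (stdOrthonormalBasis ℝ V₂).sum_inner_mul_inner]
    refine Finset.sum_congr rfl fun k _ => ?_
    rw [ContinuousLinearMap.star_eq_adjoint, ContinuousLinearMap.adjoint_inner_right, mul_comm,
      real_inner_comm (m.1 _ _)]
  have h3 : ∑ i, ∑ j, ⟪l.1 (a (e i)) (e j), m.1 (e i) (e j)⟫_ℝ =
      ∑ i, ∑ j, ⟪l.1 (e i) (a (e j)), m.1 (e i) (e j)⟫_ℝ := by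
    rw [Finset.sum_comm]
    refine Finset.sum_congr rfl fun i _ => Finset.sum_congr rfl fun j _ => ?_
    rw [FormalBracket.apply_swap l, FormalBracket.apply_swap m, inner_neg_neg]
  rw [h1, h2]
  simp only [bilInner, bilInf_apply, inner_add_left, Finset.sum_add_distrib, ← he]
  rw [h3]
  ring

theorem endInner_left_cancel {V : Type*} [NormedAddCommGroup V] [InnerProductSpace ℝ V]
    [FiniteDimensional ℝ V] [CompleteSpace V] {S T : V →L[ℝ] V}
    (h : ∀ a, endInner S a = endInner T a) : S = T := by
  rw [← sub_eq_zero]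
  have h1 : ‖S - T‖ ^ 2 ≤ 0 := by
    refine (opNorm_sq_le_endInner _).trans (le_of_eq ?_)
    rw [endInner_sub_left, h, sub_self]
  exact norm_eq_zero.1 (pow_eq_zero_iff two_ne_zero |>.1 (le_antisymm h1 (sq_nonneg _)))

theorem endInner_pair_cancel {S T : V₁ →ₗ[ℝ] V₁} {S' T' : V₂ →ₗ[ℝ] V₂}
    (h : ∀ a b, endInner (LinearMap.toContinuousLinearMap S) a -
        endInner (LinearMap.toContinuousLinearMap S') (star b) =
      endInner (LinearMap.toContinuousLinearMap T) a -
        endInner (LinearMap.toContinuousLinearMap T') (star b)) : S = T ∧ S' = T' := by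
  constructor
  · refine LinearMap.toContinuousLinearMap.injective (endInner_left_cancel fun a => ?_)
    simpa [endInner] using h a 0
  · refine LinearMap.toContinuousLinearMap.injective (endInner_left_cancel fun b => ?_)
    simpa [endInner] using h 0 (star b)

/-- The compatibility conditions say that the Levi bracket is in normal position. -/
theorem FormalBracket.mem_normalSlice_iff (κ l : FormalBracket V₁ V₂) :
    l.1 ∈ normalSlice κ.1 ↔
      FormalBracket.codiff κ κ = FormalBracket.codiff l l ∧
        (FormalBracket.codiff κ l).1.IsSymmetric ∧ (FormalBracket.codiff κ l).2.IsSymmetric := by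
  simp only [FormalBracket.codiff, FormalBracket.alpha_isSymmetric_iff,
    FormalBracket.beta_isSymmetric_iff, Prod.mk.injEq, normalSlice, Set.mem_ofPred_eq]
  constructor
  · intro h
    refine ⟨?_, ?_⟩
    · refine endInner_pair_cancel fun a b => ?_
      have := (h a b).1
      rw [FormalBracket.bilInner_bilInf, FormalBracket.bilInner_bilInf] at this
      linarith
    · refine endInner_pair_cancel fun a b => ?_
      have := (h a b).2
      rw [bilInner_comm κ.1, FormalBracket.bilInner_bilInf, FormalBracket.bilInner_bilInf] at this
      linarith
  · rintro ⟨⟨h1, h2⟩, h3, h4⟩ a b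
    rw [bilInner_comm κ.1, FormalBracket.bilInner_bilInf, FormalBracket.bilInner_bilInf,
      FormalBracket.bilInner_bilInf, FormalBracket.bilInner_bilInf, h1, h2, h3, h4]
    exact ⟨rfl, rfl⟩

end Codifferential

/-! ### Continuity of the Levi bracket on the bundle of adapted frames -/

/-- The coefficients of a vector with respect to linearly independent vectors depend continuously on
all of these vectors. -/
theorem exists_continuousAt_coeff {E : Type*} [NormedAddCommGroup E] [NormedSpace ℝ E]
    [FiniteDimensional ℝ E] {r : ℕ} {Y : Type*} [TopologicalSpace Y] {y₀ : Y}
    {S : Y → Fin r → E} {w : Y → E} (hS : ContinuousAt S y₀) (hw : ContinuousAt w y₀)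
    (hli : LinearIndependent ℝ (S y₀)) :
    ∃ g : Y → Fin r → ℝ, ContinuousAt g y₀ ∧
      ∀ᶠ y in 𝓝 y₀, ∀ c : Fin r → ℝ, w y = ∑ i, c i • S y i → g y = c := by
  obtain ⟨G, hG, hG'⟩ := exists_coeff_aux (S y₀) hli (w y₀)
  refine ⟨fun y => G (S y, w y), ?_, ?_⟩
  · exact ContinuousAt.comp (g := G) (f := fun y => (S y, w y)) hG.continuousAt (hS.prodMk hw)
  · filter_upwards [hS.eventually hG'] with y hy c hc
    rw [hc, hy]

namespace TangentDistribution

variable {E : Type*} [NormedAddCommGroup E] [NormedSpace ℝ E] [FiniteDimensional ℝ E]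
  {X : Type*} [TopologicalSpace X] [ChartedSpace E X] [IsManifold 𝓘(ℝ, E) ∞ X] {r : ℕ}
  {D : TangentDistribution E X r}
  {V₁ V₂ : Type*} [NormedAddCommGroup V₁] [InnerProductSpace ℝ V₁] [FiniteDimensional ℝ V₁]
  [NormedAddCommGroup V₂] [InnerProductSpace ℝ V₂] [FiniteDimensional ℝ V₂]

theorem FrameBundle.continuous_toLin (v : V₁ × V₂) :
    Continuous fun p : D.FrameBundle V₁ V₂ =>
      (⟨p.pt, p.frame.toLin v⟩ : TangentBundle 𝓘(ℝ, E) X) :=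
  (continuous_apply v).comp (continuous_induced_dom (f := fun (p : D.FrameBundle V₁ V₂)
    (v : V₁ × V₂) => (⟨p.pt, p.frame.toLin v⟩ : TangentBundle 𝓘(ℝ, E) X)))

theorem FrameBundle.continuous_pt : Continuous fun p : D.FrameBundle V₁ V₂ => p.pt :=
  (FiberBundle.continuous_proj E (TangentSpace 𝓘(ℝ, E) (M := X))).comp
    (FrameBundle.continuous_toLin (D := D) (0 : V₁ × V₂))

/-- The coordinate of a tangent vector at `x` in the trivialisation of the tangent bundle
around `x₀`. -/
noncomputable def tangentCoord (x₀ x : X) : TangentSpace 𝓘(ℝ, E) x →ₗ[ℝ] E :=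
  (trivializationAt E (TangentSpace 𝓘(ℝ, E)) x₀).linearMapAt ℝ x

theorem eventually_tangentCoord_injective (x₀ : X) :
    ∀ᶠ x in 𝓝 x₀, Function.Injective (tangentCoord (E := E) x₀ x) := by
  have h : ∀ᶠ x in 𝓝 x₀, x ∈ (trivializationAt E (TangentSpace 𝓘(ℝ, E)) x₀).baseSet :=
    (trivializationAt E (TangentSpace 𝓘(ℝ, E)) x₀).open_baseSet.mem_nhds
      (FiberBundle.mem_baseSet_trivializationAt E _ x₀)
  filter_upwards [h] with x hx v w hvw
  have := congrArg ((trivializationAt E (TangentSpace 𝓘(ℝ, E)) x₀).symmₗ ℝ x) hvw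
  simpa [tangentCoord, Bundle.Trivialization.symmₗ_linearMapAt _ hx] using this

/-- Continuous families of tangent vectors have continuous coordinates. -/
theorem continuousAt_tangentCoord {Y : Type*} [TopologicalSpace Y] {y₀ : Y} {f : Y → X}
    {w : ∀ y, TangentSpace 𝓘(ℝ, E) (f y)}
    (hw : ContinuousAt (fun y => (⟨f y, w y⟩ : TangentBundle 𝓘(ℝ, E) X)) y₀) :
    ContinuousAt (fun y => tangentCoord (f y₀) (f y) (w y)) y₀ := by
  let e := trivializationAt E (TangentSpace 𝓘(ℝ, E)) (f y₀)
  have hf : ContinuousAt f y₀ :=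
    ContinuousAt.comp (g := fun v : TangentBundle 𝓘(ℝ, E) X => v.proj)
      (FiberBundle.continuous_proj E (TangentSpace 𝓘(ℝ, E) (M := X))).continuousAt hw
  have hmem : f y₀ ∈ e.baseSet := FiberBundle.mem_baseSet_trivializationAt E _ (f y₀)
  have h1 : ContinuousAt (fun y => (e ⟨f y, w y⟩).2) y₀ := by
    have h2 : ContinuousAt e (⟨f y₀, w y₀⟩ : TangentBundle 𝓘(ℝ, E) X) :=
      e.continuousAt (e.mem_source.2 hmem)
    exact continuousAt_snd.comp (ContinuousAt.comp (g := e) h2 hw)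
  refine h1.congr ?_
  filter_upwards [hf.eventually (e.open_baseSet.mem_nhds hmem)] with y hy
  exact (congrFun (e.coe_linearMapAt_of_mem (R := ℝ) hy) (w y)).symm

/-- The components of a continuous family of tangent vectors with respect to adapted frames are
continuous. -/
theorem FrameBundle.continuousAt_symm_snd {p₀ : D.FrameBundle V₁ V₂}
    {w : ∀ x, TangentSpace 𝓘(ℝ, E) x}
    (hw : ContinuousAt (fun x => (⟨x, w x⟩ : TangentBundle 𝓘(ℝ, E) X)) p₀.pt) :
    ContinuousAt (fun p : D.FrameBundle V₁ V₂ => (p.frame.toLin.symm (w p.pt)).2) p₀ := by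
  let b := Module.finBasis ℝ (V₁ × V₂)
  have hpt := (FrameBundle.continuous_pt (D := D) (V₁ := V₁) (V₂ := V₂)).continuousAt (x := p₀)
  have h1 : ContinuousAt
      (fun p : D.FrameBundle V₁ V₂ => fun i => tangentCoord p₀.pt p.pt (p.frame.toLin (b i))) p₀ :=
    continuousAt_pi.2 fun i =>
      continuousAt_tangentCoord (FrameBundle.continuous_toLin (D := D) (b i)).continuousAt
  have h2 : ContinuousAt (fun p : D.FrameBundle V₁ V₂ => tangentCoord p₀.pt p.pt (w p.pt)) p₀ :=
    continuousAt_tangentCoord (ContinuousAt.comp (f := fun p : D.FrameBundle V₁ V₂ => p.pt) hw hpt)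
  have hinj := eventually_tangentCoord_injective (E := E) p₀.pt
  have h3 : LinearIndependent ℝ fun i => tangentCoord p₀.pt p₀.pt (p₀.frame.toLin (b i)) :=
    (b.linearIndependent.map' p₀.frame.toLin.toLinearMap p₀.frame.toLin.ker).map' _
      (LinearMap.ker_eq_bot.2 hinj.self_of_nhds)
  obtain ⟨g, hg, hg'⟩ := exists_continuousAt_coeff h1 h2 h3
  have h4 : ContinuousAt (fun p => (∑ i, g p i • b i).2) p₀ := by
    refine continuousAt_snd.comp (tendsto_finsetSum _ fun i _ => ?_)
    exact ((continuousAt_apply i _).comp hg).smul continuousAt_const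
  refine h4.congr ?_
  filter_upwards [hg'] with p hp
  have h5 : g p = b.repr (p.frame.toLin.symm (w p.pt)) := by
    refine hp _ ?_
    conv_lhs => rw [← p.frame.toLin.apply_symm_apply (w p.pt)]
    conv_lhs => rw [← b.sum_repr (p.frame.toLin.symm (w p.pt))]
    simp only [map_sum, map_smul]
  rw [h5, b.sum_repr]

theorem continuousAt_mlieBracket {U V : ∀ x : X, TangentSpace 𝓘(ℝ, E) x} {O : Set X}
    (hO : IsOpen O)
    (hU : ContMDiffOn 𝓘(ℝ, E) (𝓘(ℝ, E).prod 𝓘(ℝ, E)) ∞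
      (fun x => (⟨x, U x⟩ : TangentBundle 𝓘(ℝ, E) X)) O)
    (hV : ContMDiffOn 𝓘(ℝ, E) (𝓘(ℝ, E).prod 𝓘(ℝ, E)) ∞
      (fun x => (⟨x, V x⟩ : TangentBundle 𝓘(ℝ, E) X)) O) {x : X} (hx : x ∈ O) :
    ContinuousAt (fun x => (⟨x, VectorField.mlieBracket 𝓘(ℝ, E) U V x⟩ :
      TangentBundle 𝓘(ℝ, E) X)) x := by
  have : IsManifold 𝓘(ℝ, E) 2 X := inferInstance
  have : IsManifold 𝓘(ℝ, E) (((1 : ℕ∞) : WithTop ℕ∞) + 1) X := by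
    rwa [show ((1 : ℕ∞) : WithTop ℕ∞) + 1 = 2 from one_add_one_eq_two]
  have : IsManifold 𝓘(ℝ, E) (minSmoothness ℝ 2) X := by
    rwa [minSmoothness_of_isRCLikeNormedField]
  have h := ContMDiffAt.mlieBracket_vectorField (m := 0) (n := 1)
    ((hU.contMDiffAt (hO.mem_nhds hx)).of_le (by exact mod_cast le_top))
    ((hV.contMDiffAt (hO.mem_nhds hx)).of_le (by exact mod_cast le_top))
    (by rw [minSmoothness_of_isRCLikeNormedField]; simp)
  exact h.continuousAt

/-- The expression of the Levi bracket is continuous on the bundle of adapted frames. -/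
theorem continuous_coords_leviBracket :
    Continuous fun p : D.FrameBundle V₁ V₂ => p.frame.coords (D.leviBracket p.pt) := by
  rw [continuous_iff_continuousAt]
  intro p₀
  refine Topology.IsInducing.subtypeVal.continuousAt_iff.2 ?_
  refine continuousAt_clm_apply.2 fun y => continuousAt_clm_apply.2 fun z => ?_
  obtain ⟨O, s, hO, hx₀, hs, hfr⟩ := D.exists_frame p₀.pt
  have hpt := (FrameBundle.continuous_pt (D := D) (V₁ := V₁) (V₂ := V₂)).continuousAt (x := p₀)
  have hsc : ContinuousAt
      (fun p : D.FrameBundle V₁ V₂ => fun i => tangentCoord p₀.pt p.pt (s i p.pt)) p₀ :=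
    continuousAt_pi.2 fun i => continuousAt_tangentCoord (f := fun p : D.FrameBundle V₁ V₂ => p.pt)
      (ContinuousAt.comp (f := fun p : D.FrameBundle V₁ V₂ => p.pt)
        ((hs i).contMDiffAt (hO.mem_nhds hx₀)).continuousAt hpt)
  have hinj := eventually_tangentCoord_injective (E := E) p₀.pt
  have hli : LinearIndependent ℝ fun i => tangentCoord p₀.pt p₀.pt (s i p₀.pt) :=
    (hfr _ hx₀).1.map' _ (LinearMap.ker_eq_bot.2 hinj.self_of_nhds)
  -- the components of `p(y)` in the local frame of the distribution
  have hcoeff : ∀ y : V₁, ∃ g : D.FrameBundle V₁ V₂ → Fin r → ℝ, ContinuousAt g p₀ ∧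
      ∀ᶠ p in 𝓝 p₀, p.frame.toLin (y, 0) = ∑ i, g p i • s i p.pt := by
    intro y
    have h1 : ContinuousAt (fun p : D.FrameBundle V₁ V₂ =>
        tangentCoord p₀.pt p.pt (p.frame.toLin (y, 0))) p₀ :=
      continuousAt_tangentCoord (FrameBundle.continuous_toLin (D := D) (y, (0 : V₂))).continuousAt
    obtain ⟨g, hg, hg'⟩ := exists_continuousAt_coeff hsc h1 hli
    refine ⟨g, hg, ?_⟩
    filter_upwards [hg', hpt.eventually (hO.mem_nhds hx₀)] with p hp hpO
    have h2 : p.frame.toLin (y, 0) ∈ Submodule.span ℝ (Set.range fun i => s i p.pt) := by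
      rw [(hfr _ hpO).2]
      exact (p.frame.mem_iff _).2 rfl
    obtain ⟨c, hc⟩ := (Submodule.mem_span_range_iff_exists_fun ℝ).1 h2
    rw [hp c (by rw [← hc]; simp only [map_sum, map_smul]), hc]
  obtain ⟨g, hg, hgy⟩ := hcoeff y
  obtain ⟨h, hh, hhz⟩ := hcoeff z
  have hcont : ContinuousAt (fun p : D.FrameBundle V₁ V₂ => ∑ i, ∑ j, (g p i * h p j) •
      (p.frame.toLin.symm (VectorField.mlieBracket 𝓘(ℝ, E) (s i) (s j) p.pt)).2) p₀ := by
    refine tendsto_finsetSum _ fun i _ => tendsto_finsetSum _ fun j _ => ?_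
    exact (((continuousAt_apply i _).comp hg).mul ((continuousAt_apply j _).comp hh)).smul
      (FrameBundle.continuousAt_symm_snd (continuousAt_mlieBracket hO (hs i) (hs j) hx₀))
  refine hcont.congr ?_
  filter_upwards [hgy, hhz, hpt.eventually (hO.mem_nhds hx₀)] with p hpy hpz hpO
  have hsD : ∀ i, ∀ x ∈ O, s i x ∈ D.space x := fun i x hx => by
    rw [← (hfr x hx).2]
    exact Submodule.subset_span ⟨i, rfl⟩
  have h1 : p.frame.horizontal y = ∑ i, g p i • ⟨s i p.pt, hsD i _ hpO⟩ := by
    apply Subtype.ext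
    rw [AdaptedFrame.coe_horizontal, hpy]
    simp
  have h2 : p.frame.horizontal z = ∑ i, h p i • ⟨s i p.pt, hsD i _ hpO⟩ := by
    apply Subtype.ext
    rw [AdaptedFrame.coe_horizontal, hpz]
    simp
  change _ = ((p.frame.coords (D.leviBracket p.pt)).1 y) z
  rw [AdaptedFrame.coords_apply, h1, h2]
  simp only [map_sum, map_smul, LinearMap.sum_apply, LinearMap.smul_apply]
  rw [Finset.sum_comm]
  refine Finset.sum_congr rfl fun j _ => ?_
  rw [Finset.smul_sum]
  refine Finset.sum_congr rfl fun i _ => ?_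
  rw [D.leviBracket_apply hO (s i) (s j) (hs i) (hs j) (hsD i) (hsD j) p.pt hpO,
    AdaptedFrame.vertical_mkQ, smul_smul, mul_comm]

end TangentDistribution

/-! ### The compatible standard bracket of a distribution -/

namespace TangentDistribution

variable {E : Type*} [NormedAddCommGroup E] [NormedSpace ℝ E]
  {X : Type*} [TopologicalSpace X] [ChartedSpace E X] [IsManifold 𝓘(ℝ, E) ∞ X] {r : ℕ}
  {D : TangentDistribution E X r}
  {V₁ V₂ : Type*} [NormedAddCommGroup V₁] [InnerProductSpace ℝ V₁] [FiniteDimensional ℝ V₁]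
  [NormedAddCommGroup V₂] [InnerProductSpace ℝ V₂] [FiniteDimensional ℝ V₂]
  [CompleteSpace V₁] [CompleteSpace V₂] {κ : FormalBracket V₁ V₂} {ε : ℝ} {x : X}

/-- Compatibility, which asks for some adapted frame, can be read off in any given one. -/
theorem isCompatible_iff_normalPair (p : D.AdaptedFrame V₁ V₂ x) {K L : D.Bracket x} :
    IsCompatible κ K L ↔ NormalPair κ.1 (p.coords K).1 (p.coords L).1 := by
  simp only [IsCompatible, ← FormalBracket.mem_normalSlice_iff]
  constructor
  · rintro ⟨q, hK, hL⟩
    obtain ⟨A, B, hA, hB, h⟩ := p.exists_coords_eq_bilAct q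
    exact ⟨A, B, hA, hB, by rw [← h, hK], by rwa [← h]⟩
  · rintro ⟨A, B, hA, hB, hK, hL⟩
    obtain ⟨q, hq⟩ := p.exists_adaptedFrame_of_isUnit hA hB
    exact ⟨q, Subtype.ext (by rw [hq, hK]), by rwa [hq]⟩

theorem nearNormalPair_coords (p q : D.AdaptedFrame V₁ V₂ x) {K L : D.Bracket x}
    (h : NearNormalPair κ.1 ε (p.coords K).1 (p.coords L).1) :
    NearNormalPair κ.1 ε (q.coords K).1 (q.coords L).1 := by
  obtain ⟨A, B, hA, hB, h'⟩ := p.exists_coords_eq_bilAct q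
  rw [h', h']
  exact nearNormalPair_bilAct h hA hB

/-- Over the set of points where the Levi bracket has an expression in a small neighbourhood of
`κ`, there is a bracket which is near normal with the Levi bracket in every adapted frame. -/
theorem exists_nearNormalPair (D : TangentDistribution E X r) {U : Set (FormalBracket V₁ V₂)}
    (hU : ∀ l ∈ U, ∃ k, NearNormalPair κ.1 ε k l.1)
    (hx : (D.bracketOrbit V₁ V₂ x ∩ U).Nonempty) :
    ∃ K : D.Bracket x, ∀ p : D.AdaptedFrame V₁ V₂ x,
      NearNormalPair κ.1 ε (p.coords K).1 (p.coords (D.leviBracket x)).1 := by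
  obtain ⟨l, ⟨p, hp⟩, hl⟩ := hx
  obtain ⟨k, hk⟩ := hU l hl
  obtain ⟨K, hK⟩ := p.coords_surjective ⟨k, hk.apply_self κ.2⟩
  refine ⟨K, fun q => nearNormalPair_coords p q ?_⟩
  rw [hK, hp]
  exact hk

variable [FiniteDimensional ℝ E] [Nontrivial V₁]

/-- Near a given frame there is an attached bracket close to the given one, and it is the value of
`K` by uniqueness. -/
theorem continuousOver_of_nearNormalPair (hε : IsSliceRadius κ.1 ε) {S : Set X}
    {K : (x : X) → D.Bracket x}
    (hK : ∀ x ∈ S, ∀ p : D.AdaptedFrame V₁ V₂ x,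
      NearNormalPair κ.1 ε (p.coords (K x)).1 (p.coords (D.leviBracket x)).1) :
    ContinuousOver V₁ V₂ K S := by
  intro p₀ hp₀
  refine Topology.IsInducing.subtypeVal.continuousWithinAt_iff.2 ?_
  intro N hN
  have hL : ContinuousAt (fun p : D.FrameBundle V₁ V₂ =>
      (p.frame.coords (D.leviBracket p.pt)).1) p₀ :=
    (continuous_subtype_val.comp continuous_coords_leviBracket).continuousAt
  have h := hL.eventually ((hK _ hp₀ p₀.frame).eventually_exists hε hN)
  refine Filter.mem_map.2 ?_
  filter_upwards [mem_nhdsWithin_of_mem_nhds h, self_mem_nhdsWithin] with p hp hpS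
  obtain ⟨k, hkN, hk⟩ := hp
  have h1 := (hK _ hpS p.frame).unique hε hk
  change (p.frame.coords (K p.pt)).1 ∈ N
  rwa [h1]

/-- A compatible bracket near a value of `K` is near normal with the Levi bracket, as `K` is, and
uniqueness applies. -/
theorem locallyUniqueOver_of_nearNormalPair (hκ : CentralMoment κ.1)
    (hκ' : SymmStabilizerTrivial κ.1) (hε : IsSliceRadius κ.1 ε) {S : Set X}
    {K : (x : X) → D.Bracket x}
    (hK : ∀ x ∈ S, ∀ p : D.AdaptedFrame V₁ V₂ x,
      NearNormalPair κ.1 ε (p.coords (K x)).1 (p.coords (D.leviBracket x)).1) :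
    LocallyUniqueOver κ K S := by
  intro p₀ hp₀
  obtain ⟨N, hN, M, hM, h⟩ := (hK _ hp₀ p₀.frame).exists_nhds hκ hκ' hε
  have hL : ContinuousAt (fun p : D.FrameBundle V₁ V₂ =>
      (p.frame.coords (D.leviBracket p.pt)).1) p₀ :=
    (continuous_subtype_val.comp continuous_coords_leviBracket).continuousAt
  refine ⟨_, hL.eventually hM, _, continuous_subtype_val.continuousAt.eventually hN,
    fun p hpM hpS B hB hBN => ?_⟩
  have h1 := h _ hBN _ hpM ((isCompatible_iff_normalPair p.frame).1 hB)
  exact p.frame.coords_injective (Subtype.ext (h1.unique hε (hK _ hpS p.frame)))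

/-- A standard bracket with central moment map and no infinitesimal symmetric stabiliser beyond the
grading is attached, continuously and locally uniquely, to each nearby Levi bracket. -/
theorem exists_isOpen_compatible (E : Type*) [NormedAddCommGroup E] [NormedSpace ℝ E]
    [FiniteDimensional ℝ E] (κ : FormalBracket V₁ V₂) (hκ : CentralMoment κ.1)
    (hκ' : SymmStabilizerTrivial κ.1) (r : ℕ) :
    ∃ U : Set (FormalBracket V₁ V₂), IsOpen U ∧ κ ∈ U ∧
      ∀ (X : Type u) [TopologicalSpace X] [ChartedSpace E X] [IsManifold 𝓘(ℝ, E) ∞ X]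
        (D : TangentDistribution E X r),
        let S : Set X := {x | (D.bracketOrbit V₁ V₂ x ∩ U).Nonempty}
        ∃ K : (x : X) → D.Bracket x,
          (∀ x ∈ S, IsCompatible κ (K x) (D.leviBracket x)) ∧
          ContinuousOver V₁ V₂ K S ∧ LocallyUniqueOver κ K S := by
  classical
  obtain ⟨ε, hε⟩ := exists_isSliceRadius hκ hκ'
  let U : Set (FormalBracket V₁ V₂) := interior {l | ∃ k, NearNormalPair κ.1 ε k l.1}
  have hU : U ⊆ {l | ∃ k, NearNormalPair κ.1 ε k l.1} := interior_subset
  have hκU : κ ∈ U := by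
    have h1 := (nearNormalPair_self (κ := κ.1) hε.1).eventually_exists hε Filter.univ_mem
    rw [mem_interior_iff_mem_nhds]
    refine (continuous_subtype_val.continuousAt.eventually h1).mono fun l hl => ?_
    obtain ⟨k, -, hk⟩ := hl
    exact ⟨k, hk⟩
  refine ⟨U, isOpen_interior, hκU, fun X _ _ _ D => ?_⟩
  intro S
  have hex : ∀ x, ∃ K : D.Bracket x, x ∈ S → ∀ p : D.AdaptedFrame V₁ V₂ x,
      NearNormalPair κ.1 ε (p.coords K).1 (p.coords (D.leviBracket x)).1 := by
    intro x
    by_cases hx : x ∈ S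
    · obtain ⟨K, hK⟩ := D.exists_nearNormalPair (fun l hl => hU hl) hx
      exact ⟨K, fun _ => hK⟩
    · exact ⟨0, fun h => absurd h hx⟩
  choose K hK using hex
  refine ⟨K, fun x hx => ?_, continuousOver_of_nearNormalPair hε hK,
    locallyUniqueOver_of_nearNormalPair hκ hκ' hε hK⟩
  obtain ⟨l, ⟨p, hp⟩, hl⟩ := id hx
  exact (isCompatible_iff_normalPair p).2 (hK x hx p).normalPair

end TangentDistribution

/-! ### Brackets defined by Clifford modules -/

section Clifford

variable {V₁ V₂ : Type*} [NormedAddCommGroup V₁] [InnerProductSpace ℝ V₁]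
  [NormedAddCommGroup V₂] [InnerProductSpace ℝ V₂]

/-- `J` is the Clifford action corresponding to the bracket `l`: the maps `J z`, defined by
`⟨J z x, y⟩ = ⟨z, l (x, y)⟩`, are `‖z‖` times isometries. -/
structure IsCliffordAction (l : FormalBracket V₁ V₂) (J : V₂ → V₁ → V₁) : Prop where
  inner_apply : ∀ z x y, ⟪J z x, y⟫_ℝ = ⟪z, l.1 x y⟫_ℝ
  norm_apply : ∀ z x, ‖J z x‖ = ‖z‖ * ‖x‖

namespace IsCliffordAction

variable {l : FormalBracket V₁ V₂} {J : V₂ → V₁ → V₁} (hJ : IsCliffordAction l J)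
include hJ

theorem add_left (z w : V₂) (x : V₁) : J (z + w) x = J z x + J w x := by
  refine ext_inner_right ℝ fun y => ?_
  simp only [inner_add_left, hJ.inner_apply]

theorem smul_left (c : ℝ) (z : V₂) (x : V₁) : J (c • z) x = c • J z x := by
  refine ext_inner_right ℝ fun y => ?_
  simp only [real_inner_smul_left, hJ.inner_apply]

theorem add_right (z : V₂) (x y : V₁) : J z (x + y) = J z x + J z y := by
  refine ext_inner_right ℝ fun w => ?_
  simp only [inner_add_left, hJ.inner_apply, map_add, add_apply, inner_add_right]

theorem smul_right (c : ℝ) (z : V₂) (x : V₁) : J z (c • x) = c • J z x := by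
  refine ext_inner_right ℝ fun w => ?_
  simp only [real_inner_smul_left, hJ.inner_apply, map_smul, smul_apply, real_inner_smul_right]

theorem neg_right (z : V₂) (x : V₁) : J z (-x) = -J z x := by
  simpa using hJ.smul_right (-1) z x

theorem inner_swap (z : V₂) (x y : V₁) : ⟪J z x, y⟫_ℝ = -⟪x, J z y⟫_ℝ := by
  rw [real_inner_comm (J z y) x, hJ.inner_apply, hJ.inner_apply, ← inner_neg_right]
  have h := l.2 (x + y)
  simp only [map_add, add_apply, l.2 x, l.2 y, zero_add, add_zero] at h
  rw [eq_neg_of_add_eq_zero_right h]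

theorem inner_map_map (z : V₂) (x y : V₁) : ⟪J z x, J z y⟫_ℝ = ‖z‖ ^ 2 * ⟪x, y⟫_ℝ := by
  rw [real_inner_eq_norm_add_mul_self_sub_norm_mul_self_sub_norm_mul_self_div_two, ← hJ.add_right,
    real_inner_eq_norm_add_mul_self_sub_norm_mul_self_sub_norm_mul_self_div_two]
  simp only [hJ.norm_apply]
  ring

theorem inner_map_left (z w : V₂) (x : V₁) : ⟪J z x, J w x⟫_ℝ = ‖x‖ ^ 2 * ⟪z, w⟫_ℝ := by
  rw [real_inner_eq_norm_add_mul_self_sub_norm_mul_self_sub_norm_mul_self_div_two, ← hJ.add_left,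
    real_inner_eq_norm_add_mul_self_sub_norm_mul_self_sub_norm_mul_self_div_two]
  simp only [hJ.norm_apply]
  ring

theorem apply_apply (z : V₂) (x : V₁) : J z (J z x) = -(‖z‖ ^ 2 • x) := by
  refine ext_inner_right ℝ fun y => ?_
  rw [hJ.inner_swap, hJ.inner_map_map, inner_neg_left, real_inner_smul_left]

theorem apply_apply_of_orthogonal {z w : V₂} (h : ⟪z, w⟫_ℝ = 0) (x : V₁) :
    J z (J w x) = -J w (J z x) := by
  have h1 := hJ.apply_apply (z + w) x
  have h2 : ‖z + w‖ ^ 2 = ‖z‖ ^ 2 + ‖w‖ ^ 2 := by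
    have := norm_add_sq_real z w
    rw [h] at this
    linarith
  rw [h2, hJ.add_left, hJ.add_left, hJ.add_right, hJ.add_right, hJ.apply_apply, hJ.apply_apply,
    add_smul, neg_add] at h1
  have h3 : J z (J w x) + J w (J z x) = 0 := by
    have := sub_eq_zero.2 h1
    rw [← this]
    abel
  exact eq_neg_of_add_eq_zero_left h3

variable [FiniteDimensional ℝ V₁] [FiniteDimensional ℝ V₂]

/-- `α_l l` is scalar, as each `J z` with `‖z‖ = 1` is an isometry. -/
theorem alpha_self : FormalBracket.alpha l l = (Module.finrank ℝ V₂ : ℝ) • LinearMap.id := by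
  refine LinearMap.ext fun x => ext_inner_right ℝ fun y => ?_
  rw [FormalBracket.inner_alpha, LinearMap.smul_apply, LinearMap.id_apply, real_inner_smul_left]
  have h1 : ∀ i, ⟪l.1 (stdOrthonormalBasis ℝ V₁ i) y, l.1 (stdOrthonormalBasis ℝ V₁ i) x⟫_ℝ =
      ∑ k, ⟪J (stdOrthonormalBasis ℝ V₂ k) x, stdOrthonormalBasis ℝ V₁ i⟫_ℝ *
        ⟪stdOrthonormalBasis ℝ V₁ i, J (stdOrthonormalBasis ℝ V₂ k) y⟫_ℝ := by
    intro i
    rw [← (stdOrthonormalBasis ℝ V₂).sum_inner_mul_inner]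
    refine Finset.sum_congr rfl fun k _ => ?_
    rw [real_inner_comm, ← hJ.inner_apply, ← hJ.inner_apply, hJ.inner_swap _ _ y,
      hJ.inner_swap _ _ x, real_inner_comm _ (J _ x)]
    ring
  simp only [h1]
  rw [Finset.sum_comm]
  simp only [OrthonormalBasis.sum_inner_mul_inner, hJ.inner_map_map,
    OrthonormalBasis.norm_eq_one]
  simp

/-- `β_l l` is scalar, as `z ↦ J z x` is `‖x‖` times an isometry. -/
theorem beta_self :
    FormalBracket.beta l l = (-(1 / 2) * Module.finrank ℝ V₁ : ℝ) • LinearMap.id := by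
  refine LinearMap.ext fun z => ext_inner_right ℝ fun w => ?_
  rw [FormalBracket.inner_beta, LinearMap.smul_apply, LinearMap.id_apply, real_inner_smul_left,
    mul_assoc]
  congr 1
  have h1 : ∀ i j, ⟪l.1 (stdOrthonormalBasis ℝ V₁ i) (stdOrthonormalBasis ℝ V₁ j), z⟫_ℝ *
      ⟪l.1 (stdOrthonormalBasis ℝ V₁ i) (stdOrthonormalBasis ℝ V₁ j), w⟫_ℝ =
      ⟪J z (stdOrthonormalBasis ℝ V₁ i), stdOrthonormalBasis ℝ V₁ j⟫_ℝ *
        ⟪stdOrthonormalBasis ℝ V₁ j, J w (stdOrthonormalBasis ℝ V₁ i)⟫_ℝ := by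
    intro i j
    rw [real_inner_comm z, real_inner_comm w, ← hJ.inner_apply, ← hJ.inner_apply,
      real_inner_comm (J w _)]
  simp only [h1, OrthonormalBasis.sum_inner_mul_inner, hJ.inner_map_left,
    OrthonormalBasis.norm_eq_one]
  simp

variable [CompleteSpace V₁] [CompleteSpace V₂]

theorem centralMoment : CentralMoment l.1 := by
  refine ⟨2 * Module.finrank ℝ V₂, Module.finrank ℝ V₁, fun a b => ?_⟩
  rw [FormalBracket.bilInner_bilInf, hJ.alpha_self, hJ.beta_self]
  have h1 : LinearMap.toContinuousLinearMap ((Module.finrank ℝ V₂ : ℝ) • LinearMap.id) =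
      (Module.finrank ℝ V₂ : ℝ) • (1 : V₁ →L[ℝ] V₁) := rfl
  have h2 : LinearMap.toContinuousLinearMap
      ((-(1 / 2) * Module.finrank ℝ V₁ : ℝ) • LinearMap.id) =
      (-(1 / 2) * Module.finrank ℝ V₁ : ℝ) • (1 : V₂ →L[ℝ] V₂) := rfl
  have h3 : endInner 1 (star b) = endInner 1 b := by
    simp only [endInner, ContinuousLinearMap.star_eq_adjoint, one_apply_eq_self,
      ContinuousLinearMap.adjoint_inner_right]
    exact Finset.sum_congr rfl fun i _ => real_inner_comm _ _
  rw [h1, h2, endInner_smul_left, endInner_smul_left, h3, endInner_one_left, endInner_one_left]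
  ring

/-- In the equation `J (b z) + J z a + a J z = 0` for a symmetric pair `(a, b)` in the infinitesimal
stabiliser, `b` is scalar: for orthonormal eigenvectors `z`, `w` of `b` with eigenvalues `λ`, `μ`,
the equation gives `[J z J w, a] = (λ - μ) J z J w`, and exchanging `z` and `w` changes the sign of
`J z J w` on both sides, but also that of `λ - μ`. -/
theorem symmStabilizerTrivial [Nontrivial V₁]
    (h : ∀ a : V₁ →L[ℝ] V₁, (∀ z x, J z (a x) = -a (J z x)) → a = 0) :
    SymmStabilizerTrivial l.1 := by
  intro a b ha hb hab
  have has : (a : V₁ →ₗ[ℝ] V₁).IsSymmetric :=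
    (ContinuousLinearMap.isSelfAdjoint_iff_isSymmetric).1 ha
  have hbs : (b : V₂ →ₗ[ℝ] V₂).IsSymmetric :=
    (ContinuousLinearMap.isSelfAdjoint_iff_isSymmetric).1 hb
  have hab' : ∀ z x, J (b z) x + J z (a x) + a (J z x) = 0 := by
    intro z x
    refine ext_inner_right ℝ fun y => ?_
    have h1 : b (l.1 x y) + l.1 (a x) y + l.1 x (a y) = 0 := by
      rw [← bilInf_apply, hab]
      rfl
    have h2 : ⟪b z, l.1 x y⟫_ℝ = ⟪z, b (l.1 x y)⟫_ℝ := hbs z _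
    have h3 : ⟪a (J z x), y⟫_ℝ = ⟪J z x, a y⟫_ℝ := has _ y
    rw [inner_add_left, inner_add_left, h3, hJ.inner_apply, hJ.inner_apply, hJ.inner_apply, h2,
      ← inner_add_right, ← inner_add_right, h1, inner_zero_right, inner_zero_left]
  have hsc : ∃ c : ℝ, ∀ z, b z = c • z := by
    let f := hbs.eigenvectorBasis rfl
    have hf : ∀ i, b (f i) = hbs.eigenvalues rfl i • f i := fun i =>
      hbs.apply_eigenvectorBasis rfl i
    have heq : ∀ i j, hbs.eigenvalues rfl i = hbs.eigenvalues rfl j := by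
      intro i j
      by_cases hij : i = j
      · rw [hij]
      have horth : ⟪f i, f j⟫_ℝ = 0 := f.orthonormal.2 hij
      obtain ⟨x, hx⟩ := exists_ne (0 : V₁)
      have key : ∀ k x, J (f k) (a x) = -a (J (f k) x) - hbs.eigenvalues rfl k • J (f k) x := by
        intro k x
        have := hab' (f k) x
        rw [hf, hJ.smul_left] at this
        rw [← sub_eq_zero, ← this]
        abel
      have key₂ : ∀ k m, J (f k) (J (f m) (a x)) = a (J (f k) (J (f m) x)) +
          (hbs.eigenvalues rfl k - hbs.eigenvalues rfl m) • J (f k) (J (f m) x) := by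
        intro k m
        rw [key m, sub_eq_add_neg, hJ.add_right, hJ.neg_right, hJ.neg_right, key k, hJ.smul_right]
        module
      have h1 := key₂ i j
      have h2 := key₂ j i
      rw [hJ.apply_apply_of_orthogonal horth, hJ.apply_apply_of_orthogonal horth, h2, map_neg] at h1
      have h3 : (2 * (hbs.eigenvalues rfl i - hbs.eigenvalues rfl j)) •
          J (f j) (J (f i) x) = 0 := by
        rw [← sub_eq_zero.2 h1]
        module
      have h4 : J (f j) (J (f i) x) ≠ 0 := by
        rw [← norm_ne_zero_iff, hJ.norm_apply, hJ.norm_apply, f.norm_eq_one, f.norm_eq_one]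
        simpa using hx
      have h5 := (smul_eq_zero.1 h3).resolve_right h4
      linarith
    obtain hι | ⟨⟨i₀⟩⟩ := isEmpty_or_nonempty (Fin (Module.finrank ℝ V₂))
    · refine ⟨0, fun z => ?_⟩
      have : z = 0 := by
        rw [← f.sum_repr z]
        exact Finset.sum_of_isEmpty _
      rw [this, map_zero, smul_zero]
    · refine ⟨hbs.eigenvalues rfl i₀, fun z => ?_⟩
      conv_lhs => rw [← f.sum_repr z]
      conv_rhs => rw [← f.sum_repr z]
      simp only [map_sum, map_smul, hf, Finset.smul_sum]
      refine Finset.sum_congr rfl fun i _ => ?_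
      rw [heq i i₀, smul_comm]
  obtain ⟨c, hc⟩ := hsc
  have ha0 : a + (c / 2) • 1 = 0 := by
    refine h _ fun z x => ?_
    have h1 := hab' z x
    rw [hc, hJ.smul_left] at h1
    simp only [add_apply, smul_apply, one_apply_eq_self]
    rw [hJ.add_right, hJ.smul_right, ← sub_eq_zero, ← h1]
    module
  refine ⟨-(c / 2), ?_, ?_⟩
  · rw [neg_smul]
    exact eq_neg_of_add_eq_zero_left ha0
  · ext z
    rw [hc]
    simp only [smul_apply, one_apply_eq_self]
    congr 1
    ring

end IsCliffordAction

end Clifford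

/-! ### The standard quaternionic and octonionic brackets -/

theorem eq_zero_of_eq_neg_self {V : Type*} [AddCommGroup V] [Module ℝ V] {v : V} (h : v = -v) :
    v = 0 := by
  have h1 := eq_neg_iff_add_eq_zero.1 h
  rw [← two_smul ℝ] at h1
  exact (smul_eq_zero.1 h1).resolve_left two_ne_zero

theorem exists_quaternion_units : ∃ i j k : Quaternion ℝ, i.re = 0 ∧ j.re = 0 ∧ k.re = 0 ∧
    star i = -i ∧ star j = -j ∧ star k = -k ∧ i * j * k = -1 := by
  obtain ⟨i, hi⟩ : ∃ q : Quaternion ℝ, q.re = 0 ∧ q.imI = 1 ∧ q.imJ = 0 ∧ q.imK = 0 :=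
    ⟨⟨0, 1, 0, 0⟩, rfl, rfl, rfl, rfl⟩
  obtain ⟨j, hj⟩ : ∃ q : Quaternion ℝ, q.re = 0 ∧ q.imI = 0 ∧ q.imJ = 1 ∧ q.imK = 0 :=
    ⟨⟨0, 0, 1, 0⟩, rfl, rfl, rfl, rfl⟩
  obtain ⟨k, hk⟩ : ∃ q : Quaternion ℝ, q.re = 0 ∧ q.imI = 0 ∧ q.imJ = 0 ∧ q.imK = 1 :=
    ⟨⟨0, 0, 0, 1⟩, rfl, rfl, rfl, rfl⟩
  refine ⟨i, j, k, hi.1, hj.1, hk.1, Quaternion.star_eq_neg.2 hi.1, Quaternion.star_eq_neg.2 hj.1,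
    Quaternion.star_eq_neg.2 hk.1, ?_⟩
  apply Quaternion.ext <;> simp [hi, hj, hk] <;> rfl

section Quaternionic

/-- Right multiplication by imaginary quaternions on `ℍ^k`. -/
noncomputable def quatRightMul {k : ℕ} (z : ImQuaternion) (x : QuatSpace k) : QuatSpace k :=
  WithLp.toLp 2 fun a => x a * z.1

theorem isCliffordAction_quatRightMul (k : ℕ) :
    IsCliffordAction (quatBracket k) (quatRightMul (k := k)) where
  inner_apply z x y := by
    have h1 : ⟪z, (quatBracket k).1 x y⟫_ℝ = ⟪z.1, (quatHermitian x y).im⟫_ℝ := rfl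
    have h2 : ⟪z.1, (quatHermitian x y).im⟫_ℝ = ⟪z.1, quatHermitian x y⟫_ℝ := by
      have hz : z.1.re = 0 := z.2
      simp [Quaternion.inner_def, hz]
      ring
    rw [h1, h2, quatHermitian, inner_sum, PiLp.inner_apply]
    refine Finset.sum_congr rfl fun a _ => ?_
    simp only [quatRightMul, Quaternion.inner_def, Quaternion.re_mul, Quaternion.re_star,
      Quaternion.imI_star, Quaternion.imJ_star, Quaternion.imK_star, Quaternion.imI_mul,
      Quaternion.imJ_mul, Quaternion.imK_mul]
    ring
  norm_apply z x := by
    rw [← sq_eq_sq₀ (norm_nonneg _) (by positivity), mul_pow, PiLp.norm_sq_eq_of_L2,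
      PiLp.norm_sq_eq_of_L2, Finset.mul_sum]
    refine Finset.sum_congr rfl fun a _ => ?_
    have h1 : ‖z‖ = ‖z.1‖ := rfl
    rw [h1, quatRightMul, norm_mul, mul_pow, mul_comm]

theorem eq_zero_of_anticommute_quatRightMul {n : ℕ} (a : QuatSpace n →L[ℝ] QuatSpace n)
    (h : ∀ z x, quatRightMul z (a x) = -a (quatRightMul z x)) : a = 0 := by
  obtain ⟨i, j, k, hi, hj, hk, -, -, -, hijk⟩ := exists_quaternion_units
  have hprod : ∀ x : QuatSpace n,
      quatRightMul ⟨k, hk⟩ (quatRightMul ⟨j, hj⟩ (quatRightMul ⟨i, hi⟩ x)) = -x := by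
    intro x
    refine WithLp.ofLp_injective 2 (funext fun c => ?_)
    change x c * i * j * k = -x c
    rw [mul_assoc, mul_assoc, ← mul_assoc i, hijk, mul_neg_one]
  ext1 x
  -- `a` anticommutes with an odd product of generators that is equal to `-1`
  have h1 := hprod (a x)
  simp only [h, (isCliffordAction_quatRightMul n).neg_right, hprod, map_neg, neg_neg] at h1
  exact eq_zero_of_eq_neg_self h1

end Quaternionic

section Octonionic

/-- Right multiplication by imaginary octonions. -/
noncomputable def octRightMul (z : ImOctonion) (x : Octonion) : Octonion := x.mul z.1

theorem isCliffordAction_octRightMul : IsCliffordAction octBracket octRightMul where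
  inner_apply z x y := by
    have h1 : ⟪z, octBracket.1 x y⟫_ℝ = ⟪z.1.fst, (star x.fst * y.fst + star y.snd * x.snd).im⟫_ℝ +
        ⟪z.1.snd, y.snd * star x.fst - x.snd * star y.fst⟫_ℝ := by
      rw [← Octonion.im_conj_mul_fst, ← Octonion.im_conj_mul_snd]
      rfl
    have hz : z.1.fst.re = 0 := z.2
    rw [h1, WithLp.prod_inner_apply]
    simp [octRightMul, Octonion.mul, Quaternion.inner_def, Quaternion.re_mul, hz]
    ring
  norm_apply z x := by
    have h1 : ‖z‖ = ‖z.1‖ := rfl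
    rw [h1, ← sq_eq_sq₀ (norm_nonneg _) (by positivity), mul_pow]
    have h2 : ∀ w : Octonion, ‖w‖ ^ 2 =
        Quaternion.normSq w.fst + Quaternion.normSq w.snd := fun w => by
      rw [WithLp.prod_norm_sq_eq_of_L2, Quaternion.normSq_eq_norm_mul_self,
        Quaternion.normSq_eq_norm_mul_self, sq, sq]
    rw [h2, h2, h2]
    simp only [WithLp.toLp_fst, WithLp.toLp_snd, Quaternion.normSq_def', octRightMul, Octonion.mul,
      Quaternion.re_add, Quaternion.imI_add, Quaternion.imJ_add, Quaternion.imK_add,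
      Quaternion.re_sub, Quaternion.imI_sub, Quaternion.imJ_sub, Quaternion.imK_sub,
      Quaternion.re_mul, Quaternion.imI_mul, Quaternion.imJ_mul, Quaternion.imK_mul,
      Quaternion.re_star, Quaternion.imI_star, Quaternion.imJ_star, Quaternion.imK_star]
    ring

/-- The imaginary octonion `(q, 0)`. -/
noncomputable def imOctInl (q : Quaternion ℝ) (hq : q.re = 0) : ImOctonion :=
  ⟨WithLp.toLp 2 (q, 0), hq⟩

/-- The imaginary octonion `(0, q)`. -/
noncomputable def imOctInr (q : Quaternion ℝ) : ImOctonion :=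
  ⟨WithLp.toLp 2 (0, q), rfl⟩

theorem octRightMul_inl (q : Quaternion ℝ) (hq : q.re = 0) (a b : Quaternion ℝ) :
    octRightMul (imOctInl q hq) (WithLp.toLp 2 (a, b)) = WithLp.toLp 2 (a * q, -(b * q)) := by
  simp [octRightMul, imOctInl, Octonion.mul, Quaternion.star_eq_neg.2 hq]

theorem octRightMul_inr (q a b : Quaternion ℝ) :
    octRightMul (imOctInr q) (WithLp.toLp 2 (a, b)) = WithLp.toLp 2 (-(star q * b), q * a) := by
  simp [octRightMul, imOctInr, Octonion.mul]

theorem eq_zero_of_anticommute_octRightMul (a : Octonion →L[ℝ] Octonion)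
    (h : ∀ z x, octRightMul z (a x) = -a (octRightMul z x)) : a = 0 := by
  obtain ⟨i, j, k, hi, hj, hk, hi', hj', hk', hijk⟩ := exists_quaternion_units
  have hkji : k * (j * i) = 1 := by
    have := congrArg star hijk
    rwa [star_mul, star_mul, hi', hj', hk', neg_mul_neg, neg_mul, star_neg, star_one,
      neg_inj] at this
  have hkji' : ∀ q, k * (j * (i * q)) = q := fun q => by
    rw [← mul_assoc j, ← mul_assoc k, hkji, one_mul]
  have hijk' : ∀ q, q * i * j * k = -q := fun q => by
    rw [mul_assoc, mul_assoc, ← mul_assoc i, hijk, mul_neg_one]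
  have hprod : ∀ x, octRightMul (imOctInr k) (octRightMul (imOctInr j) (octRightMul (imOctInr i)
      (octRightMul (imOctInr 1) (octRightMul (imOctInl k hk) (octRightMul (imOctInl j hj)
        (octRightMul (imOctInl i hi) x)))))) = -x := by
    intro x
    have hx : x = WithLp.toLp 2 (x.fst, x.snd) := rfl
    rw [hx, octRightMul_inl, octRightMul_inl, octRightMul_inl, octRightMul_inr, octRightMul_inr,
      octRightMul_inr, octRightMul_inr, hi', hj', hk', ← WithLp.toLp_neg]
    congr 2
    · simp only [neg_mul, mul_neg, one_mul, neg_neg, hkji', hijk']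
    · simp only [neg_mul, mul_neg, one_mul, neg_neg, star_one, hkji', hijk']
  ext1 x
  -- `a` anticommutes with an odd product of generators that is equal to `-1`
  have h1 := hprod (a x)
  simp only [h, isCliffordAction_octRightMul.neg_right, hprod, map_neg, neg_neg] at h1
  exact eq_zero_of_eq_neg_self h1

end Octonionic

theorem mainTheorem4 :
    (∀ m : ℕ, 2 ≤ m →
      ∃ U : Set (FormalBracket (QuatSpace (m - 1)) ImQuaternion),
        IsOpen U ∧ quatBracket (m - 1) ∈ U ∧
        ∀ (X : Type u) [TopologicalSpace X] [ChartedSpace (EuclideanSpace ℝ (Fin (4 * m - 1))) X]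
          [IsManifold (𝓡 (4 * m - 1)) ∞ X]
          (D : TangentDistribution (EuclideanSpace ℝ (Fin (4 * m - 1))) X (4 * m - 4)),
          let S : Set X := {x | (D.bracketOrbit (QuatSpace (m - 1)) ImQuaternion x ∩ U).Nonempty}
          ∃ K : (x : X) → D.Bracket x,
            (∀ x ∈ S, TangentDistribution.IsCompatible (quatBracket (m - 1)) (K x)
              (D.leviBracket x)) ∧
            TangentDistribution.ContinuousOver (QuatSpace (m - 1)) ImQuaternion K S ∧
            TangentDistribution.LocallyUniqueOver (quatBracket (m - 1)) K S) ∧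
    (∃ U : Set (FormalBracket Octonion ImOctonion),
        IsOpen U ∧ octBracket ∈ U ∧
        ∀ (X : Type u) [TopologicalSpace X] [ChartedSpace (EuclideanSpace ℝ (Fin 15)) X]
          [IsManifold (𝓡 15) ∞ X]
          (D : TangentDistribution (EuclideanSpace ℝ (Fin 15)) X 8),
          let S : Set X := {x | (D.bracketOrbit Octonion ImOctonion x ∩ U).Nonempty}
          ∃ K : (x : X) → D.Bracket x,
            (∀ x ∈ S, TangentDistribution.IsCompatible octBracket (K x) (D.leviBracket x)) ∧
            TangentDistribution.ContinuousOver Octonion ImOctonion K S ∧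
            TangentDistribution.LocallyUniqueOver octBracket K S) := by
  refine ⟨fun m hm => ?_, ?_⟩
  · have : Nonempty (Fin (m - 1)) := ⟨⟨0, by omega⟩⟩
    have hJ := isCliffordAction_quatRightMul (m - 1)
    exact TangentDistribution.exists_isOpen_compatible (EuclideanSpace ℝ (Fin (4 * m - 1)))
      (quatBracket (m - 1)) hJ.centralMoment
      (hJ.symmStabilizerTrivial eq_zero_of_anticommute_quatRightMul) (4 * m - 4)
  · have hJ := isCliffordAction_octRightMul
    exact TangentDistribution.exists_isOpen_compatible (EuclideanSpace ℝ (Fin 15))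
      octBracket hJ.centralMoment
      (hJ.symmStabilizerTrivial eq_zero_of_anticommute_octRightMul) 8
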